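/- **Setting.** Let $T>0$ and let $\nu$ be a Lévy measure on $\mathbb R_0=\mathbb R\setminus\{0\}$, i.e. $\int_{\mathbb R_0}(1\wedge z^2)\,\nu(dz)<\infty$, with $v:=\int_{\mathbb R_0} z^2\,\nu(dz)<\infty$. On a probability space $(\Omega,\mathcal F,P)$ let $N$ be a Poisson random measure on $[0,T]\times\mathbb R\times\mathbb R_0$ of intensity $\mu=dt\,dx\,\nu(dz)$, let $\widehat N=N-\mu$ be the compensated measure, and let $$L_t(B)=\int_0^t\int_B\int_{\mathbb R_0} z\,\widehat N(ds,dx,dz),\qquad t\in[0,T],\ B\subset\mathbb R \text{ bounded Borel},$$ be the associated Lévy white noise (an $L^2(\Omega)$ integral). Let $\mathcal F^L_t$ be the $\sigma$-field generated by $L_s(B)$ for $s\in[0,t]$ and $B$ bounded Borel. A process $X=\{X(t,x);\,t\in[0,T],\,x\in\mathbb R\}$ is *predictable* if it is measurable with respect to the $\sigma$-field on $[0,T]\times\mathbb R\times\Omega$ generated by the sets $(a,b]\times A\times F$ with $0\le a<b$, $A$ bounded Borel, $F\in\mathcal F^L_a$, and $\{0\}\times A\times F$ with $A$ bounded Borel,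 $F\in\mathcal F^L_0$. For predictable $X$ with $E\int_0^T\int_{\mathbb R}|X(t,x)|^2\,dx\,dt<\infty$, the Itô integral $\int_0^T\int_{\mathbb R}X\,dL$ is the $L^2(\Omega)$-limit of $\sum_i Y_i\,(L_{b_i}(A_i)-L_{a_i}(A_i))$ along simple processes $\sum_i Y_i 1_{(a_i,b_i]}(t)1_{A_i}(x)$ converging to $X$ in $L^2(\Omega\times[0,T]\times\mathbb R)$, where $0\le a_i<b_i\le T$, $A_i$ is bounded Borel and $Y_i$ is bounded and $\mathcal F^L_{a_i}$-measurable. Let $\sigma:\mathbb R\to\mathbb R$ be Lipschitz continuous, let $w:[0,T]\times\mathbb R\to\mathbb R$, and let $G$ be a real-valued Borel function of $(t,x)$ with $G(t,\cdot)\in L^1(\mathbb R)$ for every $t\in(0,T]$. Write $\mathcal FG(t,\cdot)(\xi)=\int_{\mathbb R}e^{-i\xi x}G(t,x)\,dx$. Assume: * **(H1)** $w$ is continuous and bounded on $[0,T]\times\mathbb R$. * **(H2)** (a) $\int_0^T\int_{\mathbb R}G^2(t,x)\,dx\,dt<\infty$; (b) for every $\xi\in\mathbb R$, $t\mapsto\mathcal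 FG(t,\cdot)(\xi)$ is continuous on $(0,T]$; (c) there are $\varepsilon>0$ and a non-negative function $k_t(\xi)$ with $\int_0^T\int_{\mathbb R}|k_t(\xi)|^2\,d\xi\,dt<\infty$ and $|\mathcal FG(t+h,\cdot)(\xi)-\mathcal FG(t,\cdot)(\xi)|\le k_t(\xi)$ for all $\xi\in\mathbb R$, $t\in(0,T]$ and $h\in[0,\varepsilon]$ with $t+h\le T$. (For the equation $\mathcal L u=\sigma(u)\dot L$ with deterministic initial conditions, $w$ is the solution of $\mathcal L u=0$ with the same initial conditions and $G$ is the Green function of $\mathcal L$.) A (mild) *solution* is a predictable process $u$ such that for every $(t,x)\in[0,T]\times\mathbb R$ the stochastic integral below is defined (its integrand, set to $0$ for $s>t$, is predictable and square-integrable) and $$u(t,x)=w(t,x)+\int_0^t\int_{\mathbb R}G(t-s,x-y)\,\sigma(u(s,y))\,L(ds,dy)\qquad\text{a.s.}$$ **Theorem.** There exists a solution $u=\{u(t,x);\,t\in[0,T],\,x\in\mathbb R\}$ which is $L^2(\Omega)$-continuous on $[0,T]\times\mathbb R$ and satisfies $$\sup_{(t,x)\in[0,T]\times\mathbb R}E|u(t,x)|^2<\infty.$$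 It is unique: if $u'$ is any solution with $\sup_{(t,x)\in[0,T]\times\mathbb R}E|u'(t,x)|^2<\infty$, then $u'(t,x)=u(t,x)$ a.s. for every $(t,x)\in[0,T]\times\mathbb R$. -/

import Mathlib

open MeasureTheory ProbabilityTheory Set Filter Topology
open scoped ENNReal NNReal

noncomputable section

namespace LevySPDE

/-! ### Poisson random measures and the compensated integral -/

/-- `N` is a Poisson random measure on `E` of intensity `μ`: a random measure whose value on every
measurable set of finite intensity is Poisson distributed with mean `μ A`, and whose values on
disjoint measurable sets are independent. -/
structure IsPoissonRandomMeasure {Ω E : Type*} [MeasurableSpace Ω] [MeasurableSpace E]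
    (P : Measure Ω) (μ : Measure E) (N : Ω → Measure E) : Prop where
  measurable : Measurable N
  law : ∀ A : Set E, MeasurableSet A → μ A < ∞ →
    P.map (fun ω => N ω A) =
      (poissonMeasure (μ A).toNNReal).map (fun k : ℕ => (k : ℝ≥0∞))
  indep : ∀ (n : ℕ) (A : Fin n → Set E), (∀ i, MeasurableSet (A i)) →
    Pairwise (fun i j => Disjoint (A i) (A j)) → iIndepFun (fun i ω => N ω (A i)) P

/-- The compensated random measure `N(A) - μ(A)`, for sets of finite intensity. -/
def compensated {Ω E : Type*} [MeasurableSpace E] (μ : Measure E) (N : Ω → Measure E)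
    (A : Set E) (ω : Ω) : ℝ :=
  (N ω A).toReal - (μ A).toReal

/-- The integral of a simple function with respect to the compensated random measure. -/
def compensatedSimpleIntegral {Ω E : Type*} [MeasurableSpace E] (μ : Measure E)
    (N : Ω → Measure E) (φ : SimpleFunc E ℝ) (ω : Ω) : ℝ :=
  ∑ c ∈ φ.range, c * compensated μ N (φ ⁻¹' {c}) ω

/-- The random variable `F` is (a version of) the integral `∫ h dN̂` of the deterministic function
`h ∈ L²(μ)`: it is the `L²(P)`-limit of the integrals of square-integrable simple functions
converging to `h` in `L²(μ)`. -/
def IsCompensatedIntegral {Ω E : Type*} [MeasurableSpace Ω] [MeasurableSpace E] (P : Measure Ω)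
    (μ : Measure E) (N : Ω → Measure E) (h : E → ℝ) (F : Ω → ℝ) : Prop :=
  MemLp h 2 μ ∧ MemLp F 2 P ∧ ∃ φ : ℕ → SimpleFunc E ℝ,
    (∀ n, MemLp (φ n) 2 μ) ∧
    Tendsto (fun n => eLpNorm (h - ⇑(φ n)) 2 μ) atTop (𝓝 0) ∧
    Tendsto (fun n => eLpNorm (F - compensatedSimpleIntegral μ N (φ n)) 2 P) atTop (𝓝 0)

/-! ### Lévy white noise -/

/-- A Lévy measure on `ℝ \ {0}` (seen as a measure on `ℝ` that does not charge `0`) with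
`v = ∫ z² ν(dz) < ∞`. -/
structure IsSquareIntegrableLevyMeasure (ν : Measure ℝ) : Prop where
  zero : ν {0} = 0
  levy : ∫⁻ z, ENNReal.ofReal (min 1 (z ^ 2)) ∂ν < ∞
  variance : ∫⁻ z, ENNReal.ofReal (z ^ 2) ∂ν < ∞

/-- The intensity `dt dx ν(dz)` on `[0,T] × ℝ × (ℝ \ {0})`. -/
def intensity (T : ℝ) (ν : Measure ℝ) : Measure (ℝ × ℝ × ℝ) :=
  (volume.restrict (Icc 0 T)).prod ((volume : Measure ℝ).prod ν)

/-- `L` is the Lévy white noise built from the Poisson random measure `N`: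
`L_t(B) = ∫_0^t ∫_B ∫ z N̂(ds,dx,dz)` for `t ∈ [0,T]` and `B` bounded Borel. -/
structure IsLevyWhiteNoise {Ω : Type*} [MeasurableSpace Ω] (P : Measure Ω) (T : ℝ)
    (ν : Measure ℝ) (N : Ω → Measure (ℝ × ℝ × ℝ)) (L : ℝ → Set ℝ → Ω → ℝ) : Prop where
  measurable : ∀ t ∈ Icc 0 T, ∀ B : Set ℝ, MeasurableSet B → Bornology.IsBounded B →
    Measurable (L t B)
  integral : ∀ t ∈ Icc 0 T, ∀ B : Set ℝ, MeasurableSet B → Bornology.IsBounded B →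
    IsCompensatedIntegral P (intensity T ν) N
      (indicator (Icc 0 t ×ˢ B ×ˢ univ) (fun p => p.2.2)) (L t B)

/-- The σ-field `𝓕ᴸ_t` generated by `L_s(B)`, for `s ∈ [0,t]` and `B` bounded Borel. -/
@[reducible]
def noiseFiltration {Ω : Type*} (L : ℝ → Set ℝ → Ω → ℝ) (t : ℝ) : MeasurableSpace Ω :=
  ⨆ (s : ℝ) (_ : s ∈ Icc 0 t) (B : Set ℝ) (_ : MeasurableSet B) (_ : Bornology.IsBounded B),
    MeasurableSpace.comap (L s B) inferInstance

/-! ### Predictable random fields -/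

/-- The predictable σ-field on `[0,T] × ℝ × Ω`: it is generated by the sets `(a,b] × A × F` with
`0 ≤ a < b`, `A` bounded Borel, `F ∈ 𝓕_a`, and the sets `{0} × A × F` with `A` bounded Borel,
`F ∈ 𝓕_0`. -/
@[reducible]
def predictableSigma {Ω : Type*} (𝓕 : ℝ → MeasurableSpace Ω) (T : ℝ) :
    MeasurableSpace (Icc (0 : ℝ) T × ℝ × Ω) :=
  MeasurableSpace.generateFrom
    ({S | ∃ (A : Set ℝ) (F : Set Ω), MeasurableSet A ∧ Bornology.IsBounded A ∧
        MeasurableSet[𝓕 0] F ∧ S = {p | (p.1 : ℝ) = 0 ∧ p.2.1 ∈ A ∧ p.2.2 ∈ F}} ∪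
     {S | ∃ (a b : ℝ) (A : Set ℝ) (F : Set Ω), 0 ≤ a ∧ a < b ∧ MeasurableSet A ∧
        Bornology.IsBounded A ∧ MeasurableSet[𝓕 a] F ∧
        S = {p | (p.1 : ℝ) ∈ Ioc a b ∧ p.2.1 ∈ A ∧ p.2.2 ∈ F}})

/-- The process `{X(t,x); t ∈ [0,T], x ∈ ℝ}` is predictable. Only the values for `t ∈ [0,T]`
matter. -/
def IsPredictableField {Ω : Type*} (𝓕 : ℝ → MeasurableSpace Ω) (T : ℝ)
    (X : ℝ → ℝ → Ω → ℝ) : Prop :=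
  Measurable[predictableSigma 𝓕 T] (fun p : Icc (0 : ℝ) T × ℝ × Ω => X p.1 p.2.1 p.2.2)

/-! ### The Itô integral with respect to `L` -/

/-- A simple process `∑ᵢ Yᵢ(ω) 1_{(aᵢ,bᵢ]}(t) 1_{Aᵢ}(x)` with `0 ≤ aᵢ < bᵢ ≤ T`, `Aᵢ` bounded
Borel, and `Yᵢ` bounded and `𝓕_{aᵢ}`-measurable. -/
structure SimpleProcess {Ω : Type*} (𝓕 : ℝ → MeasurableSpace Ω) (T : ℝ) where
  n : ℕ
  a : Fin n → ℝ
  b : Fin n → ℝ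
  A : Fin n → Set ℝ
  Y : Fin n → Ω → ℝ
  a_nonneg : ∀ i, 0 ≤ a i
  a_lt_b : ∀ i, a i < b i
  b_le : ∀ i, b i ≤ T
  measurableSet_A : ∀ i, MeasurableSet (A i)
  isBounded_A : ∀ i, Bornology.IsBounded (A i)
  measurable_Y : ∀ i, Measurable[𝓕 (a i)] (Y i)
  bounded_Y : ∀ i, ∃ C : ℝ, ∀ ω, |Y i ω| ≤ C

/-- The process defined by a simple process. -/
def SimpleProcess.toFun {Ω : Type*} {𝓕 : ℝ → MeasurableSpace Ω} {T : ℝ} (S : SimpleProcess 𝓕 T)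
    (t x : ℝ) (ω : Ω) : ℝ :=
  ∑ i, S.Y i ω * (Ioc (S.a i) (S.b i)).indicator 1 t * (S.A i).indicator 1 x

/-- The integral `∑ᵢ Yᵢ (L_{bᵢ}(Aᵢ) - L_{aᵢ}(Aᵢ))` of a simple process. -/
def SimpleProcess.integral {Ω : Type*} {𝓕 : ℝ → MeasurableSpace Ω} {T : ℝ}
    (S : SimpleProcess 𝓕 T) (L : ℝ → Set ℝ → Ω → ℝ) (ω : Ω) : ℝ :=
  ∑ i, S.Y i ω * (L (S.b i) (S.A i) ω - L (S.a i) (S.A i) ω)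

/-- `E ∫_0^T ∫_ℝ |X(t,x)|² dx dt`, as an extended nonnegative number. -/
def energy {Ω : Type*} [MeasurableSpace Ω] (P : Measure Ω) (T : ℝ) (X : ℝ → ℝ → Ω → ℝ) : ℝ≥0∞ :=
  ∫⁻ ω, (∫⁻ t in Icc 0 T, (∫⁻ x : ℝ, ENNReal.ofReal (X t x ω ^ 2))) ∂P

/-- The random variable `F` is (a version of) the stochastic integral
`∫_0^T ∫_ℝ X(t,x) L(dt,dx)` of the predictable process `X` with `E ∫_0^T ∫_ℝ |X|² dx dt < ∞`: it is
the `L²(P)`-limit of the integrals of simple processes that converge to `X` in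
`L²(Ω × [0,T] × ℝ)`. -/
def IsItoIntegral {Ω : Type*} [MeasurableSpace Ω] (P : Measure Ω) (T : ℝ)
    (L : ℝ → Set ℝ → Ω → ℝ) (X : ℝ → ℝ → Ω → ℝ) (F : Ω → ℝ) : Prop :=
  IsPredictableField (noiseFiltration L) T X ∧ energy P T X < ∞ ∧ MemLp F 2 P ∧
  ∃ S : ℕ → SimpleProcess (noiseFiltration L) T,
    Tendsto (fun n => energy P T (X - (S n).toFun)) atTop (𝓝 0) ∧
    Tendsto (fun n => eLpNorm (F - (S n).integral L) 2 P) atTop (𝓝 0)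

/-! ### Mild solutions -/

/-- The integrand `(s,y) ↦ 1_{s ≤ t} G(t-s,x-y) σ(u(s,y))`. -/
def mildIntegrand {Ω : Type*} (G : ℝ → ℝ → ℝ) (σ : ℝ → ℝ) (u : ℝ → ℝ → Ω → ℝ) (t x : ℝ) :
    ℝ → ℝ → Ω → ℝ :=
  fun s y ω => (Iic t).indicator (fun r => G (t - r) (x - y) * σ (u r y ω)) s

/-- `u` is a (mild) solution: it is predictable and, for all `(t,x) ∈ [0,T] × ℝ`, the stochastic
integral below is defined and, almost surely,
`u(t,x) = w(t,x) + ∫_0^t ∫_ℝ G(t-s,x-y) σ(u(s,y)) L(ds,dy)`. -/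
structure IsMildSolution {Ω : Type*} [MeasurableSpace Ω] (P : Measure Ω) (T : ℝ)
    (L : ℝ → Set ℝ → Ω → ℝ) (w G : ℝ → ℝ → ℝ) (σ : ℝ → ℝ) (u : ℝ → ℝ → Ω → ℝ) : Prop where
  predictable : IsPredictableField (noiseFiltration L) T u
  equation : ∀ t ∈ Icc 0 T, ∀ x : ℝ,
    IsItoIntegral P T L (mildIntegrand G σ u t x) (fun ω => u t x ω - w t x)

/-- `sup_{(t,x) ∈ [0,T] × ℝ} E|u(t,x)|²`. -/
def supSecondMoment {Ω : Type*} [MeasurableSpace Ω] (P : Measure Ω) (T : ℝ)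
    (u : ℝ → ℝ → Ω → ℝ) : ℝ≥0∞ :=
  ⨆ t ∈ Icc 0 T, ⨆ x : ℝ, ∫⁻ ω, ENNReal.ofReal (u t x ω ^ 2) ∂P

/-- `u` is `L²(Ω)`-continuous on `[0,T] × ℝ`. -/
def IsL2Continuous {Ω : Type*} [MeasurableSpace Ω] (P : Measure Ω) (T : ℝ)
    (u : ℝ → ℝ → Ω → ℝ) : Prop :=
  (∀ t ∈ Icc 0 T, ∀ x : ℝ, MemLp (u t x) 2 P) ∧
  ∀ t ∈ Icc 0 T, ∀ x : ℝ,
    Tendsto (fun q : ℝ × ℝ => eLpNorm (u q.1 q.2 - u t x) 2 P)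
      (𝓝[Icc 0 T ×ˢ univ] (t, x)) (𝓝 0)

/-! ### The hypotheses -/

/-- `w` is continuous and uniformly bounded on `[0,T] × ℝ`. -/
structure HypothesisH1 (T : ℝ) (w : ℝ → ℝ → ℝ) : Prop where
  continuous : ContinuousOn (fun p : ℝ × ℝ => w p.1 p.2) (Icc 0 T ×ˢ univ)
  bounded : ∃ K : ℝ, ∀ t ∈ Icc 0 T, ∀ x : ℝ, |w t x| ≤ K

/-- The Fourier transform `∫ e^{-iξx} G(t,x) dx`. -/
def greenFourier (G : ℝ → ℝ → ℝ) (t ξ : ℝ) : ℂ :=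
  ∫ x : ℝ, Complex.exp (-(Complex.I * ξ * x)) * (G t x : ℂ)

/-- The hypotheses on the Green function `G`. The conditions on the spatial Fourier transform are
imposed for positive times only, since `G(0,·)` need not be a function (for the heat equation it is
a Dirac mass). -/
structure HypothesisH2 (T : ℝ) (G : ℝ → ℝ → ℝ) : Prop where
  measurable : Measurable (fun p : ℝ × ℝ => G p.1 p.2)
  integrable : ∀ t ∈ Ioc 0 T, Integrable (G t)
  square_integrable :
    MemLp (fun p : ℝ × ℝ => G p.1 p.2) 2 ((volume.restrict (Icc 0 T)).prod volume)
  continuous : ∀ ξ : ℝ, ContinuousOn (fun t => greenFourier G t ξ) (Ioc 0 T)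
  dominated : ∃ ε : ℝ, 0 < ε ∧ ∃ k : ℝ → ℝ → ℝ, (∀ t ξ, 0 ≤ k t ξ) ∧
    MemLp (fun p : ℝ × ℝ => k p.1 p.2) 2 ((volume.restrict (Icc 0 T)).prod volume) ∧
    ∀ t ∈ Ioc 0 T, ∀ h ∈ Icc 0 ε, t + h ≤ T → ∀ ξ : ℝ,
      ‖greenFourier G (t + h) ξ - greenFourier G t ξ‖ ≤ k t ξ

end LevySPDE

end

namespace LevySPDE

/-! ### Moments of the compensated random measure -/

/-! The solution is a Picard fixed point in a space of `L²(Ω)`-valued fields, and everything rests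
on the Itô isometry `E|∫X dL|² = v E∫∫X²`.

The isometry comes from the Poisson structure. Values of `N` on disjoint sets are independent and
the compensated measure has mean zero, so `N̂(A)` and `N̂(B)` have covariance `μ(A ∩ B)`, which
gives an isometry for deterministic integrands. An atom argument
(`IsPoissonRandomMeasure.indep_regionSigma`) makes the whole σ-field of a region independent of that
of a disjoint region. Hence the past of `L` up to time `a` is independent of its increments after
`a` (`IsLevyWhiteNoise.indep_futureSigma`), and for simple processes the cross terms can be computed
(`IsLevyWhiteNoise.isometry_simple`). Simple processes are dense among square-integrable predictable
ones (`IsLevyWhiteNoise.mem_closure_simple`), so the integral exists by completeness and the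
isometry extends (`IsItoIntegral.isometry`).

For the equation, weight fields by `e^{-βt}`. If two fields are at weighted distance `d`, the
isometry and the Lipschitz bound `C` on `σ` give images whose squared weighted distance is at most
`v C² d² ∫_0^T∫ e^{-2βr} G(r,y)² dy dr`. The last integral tends to `0` as `β → ∞` by dominated
convergence, so for large `β` the Picard map halves distances. It acts on the bounded continuous
adapted maps from `[0,T] × ℝ` to `L²(Ω)`, a complete space. It preserves continuity because
translations are continuous in `L²(ℝ²)` (`HypothesisH2.tendsto_mildKernel`). To be integrated, an
adapted continuous field first receives a predictable version (`exists_predictable_modification`).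

Uniqueness uses the same estimate: the weighted supremum `A` of `E|u₁ - u₂|²` is finite and
satisfies `A ≤ A/4`. This does not need continuity of the solutions. -/

lemma hasSum_poisson_id (r : ℝ≥0) :
    HasSum (fun n : ℕ => Real.exp (-r) * r ^ n / n.factorial * (n : ℝ)) r := by
  rw [← hasSum_nat_add_iff' 1]
  have h := (hasSum_one_poissonMeasure r).mul_left (r : ℝ)
  convert! h using 1
  · ext n
    have : (n.factorial : ℝ) ≠ 0 := by positivity
    rw [Nat.factorial_succ]
    push_cast
    field_simp
    ring
  · simp

/-- Since `n/n! = 1/(n-1)!`, shifting the index turns the mean into `r` times the total mass, and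
turns the second moment into `r` times the sum with weight `n + 1`. -/
lemma hasSum_poisson_sq (r : ℝ≥0) :
    HasSum (fun n : ℕ => Real.exp (-r) * r ^ n / n.factorial * (n : ℝ) ^ 2) (r ^ 2 + r) := by
  rw [← hasSum_nat_add_iff' 1]
  have h := ((hasSum_poisson_id r).add (hasSum_one_poissonMeasure r)).mul_left (r : ℝ)
  convert! h using 1
  · ext n
    have : (n.factorial : ℝ) ≠ 0 := by positivity
    rw [Nat.factorial_succ]
    push_cast
    field_simp
    ring
  · simp
    ring

lemma memLp_poisson_id (r : ℝ≥0) : MemLp (fun n : ℕ => (n : ℝ)) 2 (poissonMeasure r) := by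
  rw [memLp_two_iff_integrable_sq (by fun_prop), integrable_poissonMeasure_iff]
  simpa using (hasSum_poisson_sq r).summable

lemma integral_poisson_sub (r : ℝ≥0) : ∫ n : ℕ, ((n : ℝ) - r) ∂(poissonMeasure r) = 0 := by
  rw [integral_sub ((memLp_poisson_id r).integrable one_le_two) (integrable_const _),
    integral_poissonMeasure]
  simp [(hasSum_poisson_id r).tsum_eq]

lemma integral_poisson_sub_sq (r : ℝ≥0) :
    ∫ n : ℕ, ((n : ℝ) - r) ^ 2 ∂(poissonMeasure r) = r := by
  rw [integral_poissonMeasure]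
  have h := ((hasSum_poisson_sq r).sub ((hasSum_poisson_id r).mul_left (2 * r : ℝ))).add
    ((hasSum_one_poissonMeasure r).mul_left ((r : ℝ) ^ 2))
  convert h.tsum_eq using 1
  · congr 1
    ext n
    simp only [smul_eq_mul]
    ring
  · ring

section PoissonRandomMeasure

variable {Ω E : Type*} [MeasurableSpace Ω] [MeasurableSpace E] {P : Measure Ω}
  {μ : Measure E} {N : Ω → Measure E}

lemma IsPoissonRandomMeasure.measurable_apply (hN : IsPoissonRandomMeasure P μ N) {A : Set E}
    (hA : MeasurableSet A) : Measurable (fun ω => N ω A) :=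
  (Measure.measurable_coe hA).comp hN.measurable

lemma IsPoissonRandomMeasure.measurable_compensated (hN : IsPoissonRandomMeasure P μ N)
    {A : Set E} (hA : MeasurableSet A) : Measurable (compensated μ N A) :=
  (hN.measurable_apply hA).ennreal_toReal.sub_const _

lemma IsPoissonRandomMeasure.identDistrib (hN : IsPoissonRandomMeasure P μ N)
    {A : Set E} (hA : MeasurableSet A) (hμA : μ A < ∞) :
    IdentDistrib (compensated μ N A) (fun n : ℕ => (n : ℝ) - (μ A).toNNReal) P
      (poissonMeasure (μ A).toNNReal) := by
  have h : IdentDistrib (fun ω => N ω A) (fun k : ℕ => (k : ℝ≥0∞)) P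
      (poissonMeasure (μ A).toNNReal) :=
    ⟨(hN.measurable_apply hA).aemeasurable, by fun_prop, hN.law A hA hμA⟩
  exact h.comp (u := fun y : ℝ≥0∞ => y.toReal - (μ A).toReal)
    (ENNReal.measurable_toReal.sub_const _)

lemma IsPoissonRandomMeasure.memLp_compensated (hN : IsPoissonRandomMeasure P μ N)
    {A : Set E} (hA : MeasurableSet A) (hμA : μ A < ∞) : MemLp (compensated μ N A) 2 P :=
  (hN.identDistrib hA hμA).memLp_iff.2 ((memLp_poisson_id _).sub (memLp_const _))

lemma IsPoissonRandomMeasure.integral_compensated (hN : IsPoissonRandomMeasure P μ N)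
    {A : Set E} (hA : MeasurableSet A) (hμA : μ A < ∞) : ∫ ω, compensated μ N A ω ∂P = 0 :=
  (hN.identDistrib hA hμA).integral_eq.trans (integral_poisson_sub _)

lemma IsPoissonRandomMeasure.integral_compensated_sq (hN : IsPoissonRandomMeasure P μ N)
    {A : Set E} (hA : MeasurableSet A) (hμA : μ A < ∞) :
    ∫ ω, compensated μ N A ω * compensated μ N A ω ∂P = μ.real A := by
  have h := ((hN.identDistrib hA hμA).sq).integral_eq
  simp only [sq] at h
  rw [h]
  simp only [← sq]
  exact integral_poisson_sub_sq _

/-- Finiteness is needed because `compensated` uses `toReal`, which is additive only on finite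
values. -/
lemma IsPoissonRandomMeasure.ae_lt_top [IsProbabilityMeasure P]
    (hN : IsPoissonRandomMeasure P μ N) {A : Set E} (hA : MeasurableSet A) (hμA : μ A < ∞) :
    ∀ᵐ ω ∂P, N ω A < ∞ := by
  have h : ∀ᵐ y ∂(P.map (fun ω => N ω A)), y < ∞ := by
    rw [hN.law A hA hμA, ae_map_iff (by fun_prop) measurableSet_Iio]
    simp
  exact ae_of_ae_map (hN.measurable_apply hA).aemeasurable h

lemma IsPoissonRandomMeasure.compensated_union [IsProbabilityMeasure P]
    (hN : IsPoissonRandomMeasure P μ N) {A B : Set E} (hA : MeasurableSet A) (hμA : μ A < ∞)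
    (hB : MeasurableSet B) (hμB : μ B < ∞) (hAB : Disjoint A B) :
    compensated μ N (A ∪ B) =ᵐ[P] compensated μ N A + compensated μ N B := by
  filter_upwards [hN.ae_lt_top hA hμA, hN.ae_lt_top hB hμB] with ω h1 h2
  simp only [compensated, Pi.add_apply]
  rw [measure_union hAB hB, measure_union hAB hB, ENNReal.toReal_add h1.ne h2.ne,
    ENNReal.toReal_add hμA.ne hμB.ne]
  ring

/-- Independence factorises the expectation, and the factor of `A` has mean zero; the value of the
other factor is irrelevant, so `B` may have infinite intensity. -/
lemma IsPoissonRandomMeasure.integral_compensated_mul_of_disjoint [IsProbabilityMeasure P]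
    (hN : IsPoissonRandomMeasure P μ N) {A B : Set E} (hA : MeasurableSet A) (hμA : μ A < ∞)
    (hB : MeasurableSet B) (hAB : Disjoint A B) :
    ∫ ω, compensated μ N A ω * compensated μ N B ω ∂P = 0 := by
  have h := hN.indep 2 ![A, B] (by intro i; fin_cases i <;> simpa)
    (by
      intro i j hij
      fin_cases i <;> fin_cases j <;> simp_all [disjoint_comm])
  have h2 : IndepFun (fun ω => N ω A) (fun ω => N ω B) P :=
    h.indepFun (i := 0) (j := 1) (by simp)
  have h3 : IndepFun (compensated μ N A) (compensated μ N B) P :=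
    h2.comp (φ := fun y : ℝ≥0∞ => y.toReal - (μ A).toReal)
      (ψ := fun y : ℝ≥0∞ => y.toReal - (μ B).toReal)
      (ENNReal.measurable_toReal.sub_const _) (ENNReal.measurable_toReal.sub_const _)
  have h4 := h3.integral_mul_eq_mul_integral
    (hN.measurable_compensated hA).aestronglyMeasurable
    (hN.measurable_compensated hB).aestronglyMeasurable
  rw [hN.integral_compensated hA hμA, zero_mul] at h4
  exact h4

/-- Cutting `A` and `B` along `A ∩ B` leaves products over disjoint sets, which vanish, and one
square over the intersection. -/
lemma IsPoissonRandomMeasure.integral_compensated_mul [IsProbabilityMeasure P]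
    (hN : IsPoissonRandomMeasure P μ N) {A B : Set E} (hA : MeasurableSet A) (hμA : μ A < ∞)
    (hB : MeasurableSet B) (hμB : μ B < ∞) :
    ∫ ω, compensated μ N A ω * compensated μ N B ω ∂P = μ.real (A ∩ B) := by
  have fin : ∀ {S S' : Set E}, S ⊆ S' → μ S' < ∞ → μ S < ∞ :=
    fun h h' => (measure_mono h).trans_lt h'
  have hI := hA.inter hB
  have hμI := fin (inter_subset_left (s := A) (t := B)) hμA
  have hAd := hA.diff hB
  have hμAd := fin (sdiff_subset (s := A) (t := B)) hμA
  have hBd := hB.diff hA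
  have hμBd := fin (sdiff_subset (s := B) (t := A)) hμB
  have e1 := hN.compensated_union hI hμI hAd hμAd
    (disjoint_sdiff_right.mono_left inter_subset_right)
  have e2 := hN.compensated_union hI hμI hBd hμBd
    (disjoint_sdiff_right.mono_left inter_subset_left)
  rw [inter_union_sdiff] at e1
  rw [inter_comm A B, inter_union_sdiff, inter_comm B A] at e2
  have int : ∀ {S S' : Set E}, MeasurableSet S → μ S < ∞ → MeasurableSet S' → μ S' < ∞ →
      Integrable (fun ω => compensated μ N S ω * compensated μ N S' ω) P :=
    fun a b c d => (hN.memLp_compensated a b).integrable_mul (hN.memLp_compensated c d)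
  calc ∫ ω, compensated μ N A ω * compensated μ N B ω ∂P
      = ∫ ω, (compensated μ N (A ∩ B) ω * compensated μ N (A ∩ B) ω
          + compensated μ N (A ∩ B) ω * compensated μ N (B \ A) ω)
          + (compensated μ N (A \ B) ω * compensated μ N (A ∩ B) ω
          + compensated μ N (A \ B) ω * compensated μ N (B \ A) ω) ∂P := by
        refine integral_congr_ae ?_
        filter_upwards [e1, e2] with ω h1 h2
        rw [h1, h2]
        simp only [Pi.add_apply]
        ring
    _ = μ.real (A ∩ B) := by
        rw [integral_add ?_ ?_,
          integral_add (int hI hμI hI hμI) (int hI hμI hBd hμBd),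
          integral_add (int hAd hμAd hI hμI) (int hAd hμAd hBd hμBd),
          hN.integral_compensated_sq hI hμI,
          hN.integral_compensated_mul_of_disjoint hI hμI hBd
            (disjoint_sdiff_right.mono_left inter_subset_left),
          hN.integral_compensated_mul_of_disjoint hAd hμAd hI
            (disjoint_sdiff_left.mono_right inter_subset_right),
          hN.integral_compensated_mul_of_disjoint hAd hμAd hBd
            (disjoint_sdiff_left.mono_right sdiff_le)]
        · simp
        · exact (int hI hμI hI hμI).add (int hI hμI hBd hμBd)
        · exact (int hAd hμAd hI hμI).add (int hAd hμAd hBd hμBd)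

/-! ### The compensated integral -/

lemma measure_preimage_singleton_lt_top {φ : SimpleFunc E ℝ} (hφ : MemLp φ 2 μ) {c : ℝ}
    (hc : c ≠ 0) : μ (φ ⁻¹' {c}) < ∞ :=
  SimpleFunc.measure_preimage_lt_top_of_memLp (by simp) (by simp) φ hφ c hc

lemma IsPoissonRandomMeasure.memLp_compensatedSimpleIntegral [IsProbabilityMeasure P]
    (hN : IsPoissonRandomMeasure P μ N)
    {φ : SimpleFunc E ℝ} (hφ : MemLp φ 2 μ) : MemLp (compensatedSimpleIntegral μ N φ) 2 P := by
  refine memLp_finsetSum _ (fun c _ => ?_)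
  -- The level set of `0` may have infinite intensity, but its term carries the factor `0`.
  rcases eq_or_ne c 0 with rfl | hc
  · simp
  · exact (hN.memLp_compensated (φ.measurableSet_preimage _)
      (measure_preimage_singleton_lt_top hφ hc)).const_mul c

lemma simpleFunc_eq_sum (φ : SimpleFunc E ℝ) (x : E) :
    φ x = ∑ c ∈ φ.range, c * (φ ⁻¹' {c}).indicator 1 x := by
  rw [Finset.sum_eq_single (φ x)]
  · simp
  · intro c _ hc
    simp [indicator, hc.symm]
  · intro h
    simp at h

lemma IsPoissonRandomMeasure.integral_mul_compensatedSimpleIntegral [IsProbabilityMeasure P]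
    (hN : IsPoissonRandomMeasure P μ N) {φ ψ : SimpleFunc E ℝ} (hφ : MemLp φ 2 μ)
    (hψ : MemLp ψ 2 μ) :
    ∫ ω, compensatedSimpleIntegral μ N φ ω * compensatedSimpleIntegral μ N ψ ω ∂P
      = ∫ x, φ x * ψ x ∂μ := by
  simp only [compensatedSimpleIntegral]
  simp_rw [fun x => simpleFunc_eq_sum φ x, fun x => simpleFunc_eq_sum ψ x, Finset.sum_mul_sum]
  have i1 : ∀ c d : ℝ, Integrable (fun ω => c * compensated μ N (φ ⁻¹' {c}) ω *
      (d * compensated μ N (ψ ⁻¹' {d}) ω)) P := by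
    intro c d
    rcases eq_or_ne c 0 with rfl | hc
    · simp
    rcases eq_or_ne d 0 with rfl | hd
    · simp
    exact ((hN.memLp_compensated (φ.measurableSet_preimage _)
      (measure_preimage_singleton_lt_top hφ hc)).const_mul c).integrable_mul
      ((hN.memLp_compensated (ψ.measurableSet_preimage _)
      (measure_preimage_singleton_lt_top hψ hd)).const_mul d)
  have ind : ∀ c : ℝ, ∀ χ : SimpleFunc E ℝ, MemLp χ 2 μ → c ≠ 0 →
      MemLp ((χ ⁻¹' {c}).indicator (1 : E → ℝ)) 2 μ := fun c χ hχ hc =>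
    memLp_indicator_const 2 (χ.measurableSet_preimage _) (1 : ℝ)
      (Or.inr (measure_preimage_singleton_lt_top hχ hc).ne)
  have i2 : ∀ c d : ℝ, Integrable (fun x => c * (φ ⁻¹' {c}).indicator 1 x *
      (d * (ψ ⁻¹' {d}).indicator 1 x)) μ := by
    intro c d
    rcases eq_or_ne c 0 with rfl | hc
    · simp
    rcases eq_or_ne d 0 with rfl | hd
    · simp
    exact ((ind c φ hφ hc).const_mul c).integrable_mul ((ind d ψ hψ hd).const_mul d)
  rw [integral_finsetSum _ (fun c _ => integrable_finsetSum _ (fun d _ => i1 c d)),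
    integral_finsetSum _ (fun c _ => integrable_finsetSum _ (fun d _ => i2 c d))]
  refine Finset.sum_congr rfl (fun c _ => ?_)
  rw [integral_finsetSum _ (fun d _ => i1 c d), integral_finsetSum _ (fun d _ => i2 c d)]
  refine Finset.sum_congr rfl (fun d _ => ?_)
  rcases eq_or_ne c 0 with rfl | hc
  · simp
  rcases eq_or_ne d 0 with rfl | hd
  · simp
  have e1 : ∀ ω, c * compensated μ N (φ ⁻¹' {c}) ω * (d * compensated μ N (ψ ⁻¹' {d}) ω)
      = (c * d) * (compensated μ N (φ ⁻¹' {c}) ω * compensated μ N (ψ ⁻¹' {d}) ω) :=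
    fun ω => by ring
  have e2 : ∀ x, c * (φ ⁻¹' {c}).indicator 1 x * (d * (ψ ⁻¹' {d}).indicator 1 x)
      = (c * d) * ((φ ⁻¹' {c} ∩ ψ ⁻¹' {d}).indicator (1 : E → ℝ) x) := fun x => by
    rw [inter_indicator_one]
    simp only [Pi.mul_apply]
    ring
  simp_rw [e1, e2]
  rw [integral_const_mul, integral_const_mul,
    hN.integral_compensated_mul (φ.measurableSet_preimage _)
      (measure_preimage_singleton_lt_top hφ hc) (ψ.measurableSet_preimage _)
      (measure_preimage_singleton_lt_top hψ hd),
    integral_indicator_one ((φ.measurableSet_preimage _).inter (ψ.measurableSet_preimage _))]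

/-- The `L²` pairing is continuous. -/
lemma tendsto_integral_mul_of_eLpNorm {α : Type*} [MeasurableSpace α] {m : Measure α}
    {f g : ℕ → α → ℝ} {F G : α → ℝ} (hf : ∀ n, MemLp (f n) 2 m) (hg : ∀ n, MemLp (g n) 2 m)
    (hF : MemLp F 2 m) (hG : MemLp G 2 m)
    (hfF : Tendsto (fun n => eLpNorm (F - f n) 2 m) atTop (𝓝 0))
    (hgG : Tendsto (fun n => eLpNorm (G - g n) 2 m) atTop (𝓝 0)) :
    Tendsto (fun n => ∫ x, f n x * g n x ∂m) atTop (𝓝 (∫ x, F x * G x ∂m)) := by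
  have key : ∀ {u v : α → ℝ} (hu : MemLp u 2 m) (hv : MemLp v 2 m),
      ∫ x, u x * v x ∂m = inner ℝ (hu.toLp u) (hv.toLp v) := by
    intro u v hu hv
    rw [L2.inner_def]
    refine integral_congr_ae ?_
    filter_upwards [hu.coeFn_toLp, hv.coeFn_toLp] with x h1 h2
    simp [h1, h2, mul_comm]
  have conv : ∀ {u : ℕ → α → ℝ} {U : α → ℝ} (hu : ∀ n, MemLp (u n) 2 m) (hU : MemLp U 2 m),
      Tendsto (fun n => eLpNorm (U - u n) 2 m) atTop (𝓝 0) →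
      Tendsto (fun n => (hu n).toLp (u n)) atTop (𝓝 (hU.toLp U)) := by
    intro u U hu hU h
    rw [tendsto_iff_edist_tendsto_0]
    refine h.congr (fun n => ?_)
    rw [edist_comm, Lp.edist_toLp_toLp]
  simp_rw [fun n => key (hf n) (hg n), key hF hG]
  exact (conv hf hF hfF).inner (conv hg hG hgG)

/-- Both pairings are continuous in `L²`, so the identity for simple functions passes to the limit
along any approximating sequences. -/
lemma IsCompensatedIntegral.integral_mul [IsProbabilityMeasure P]
    (hN : IsPoissonRandomMeasure P μ N) {h h' : E → ℝ} {F F' : Ω → ℝ}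
    (hF : IsCompensatedIntegral P μ N h F) (hF' : IsCompensatedIntegral P μ N h' F') :
    ∫ ω, F ω * F' ω ∂P = ∫ x, h x * h' x ∂μ := by
  obtain ⟨hh, hF2, φ, hφ, hφh, hφF⟩ := hF
  obtain ⟨hh', hF2', ψ, hψ, hψh, hψF⟩ := hF'
  have t1 := tendsto_integral_mul_of_eLpNorm
    (fun n => hN.memLp_compensatedSimpleIntegral (hφ n))
    (fun n => hN.memLp_compensatedSimpleIntegral (hψ n)) hF2 hF2' hφF hψF
  have t2 := tendsto_integral_mul_of_eLpNorm hφ hψ hh hh' hφh hψh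
  refine tendsto_nhds_unique t1 (t2.congr (fun n => ?_))
  exact (hN.integral_mul_compensatedSimpleIntegral (hφ n) (hψ n)).symm

lemma IsPoissonRandomMeasure.isCompensatedIntegral_simpleFunc [IsProbabilityMeasure P]
    (hN : IsPoissonRandomMeasure P μ N) {φ : SimpleFunc E ℝ} (hφ : MemLp φ 2 μ) :
    IsCompensatedIntegral P μ N φ (compensatedSimpleIntegral μ N φ) :=
  ⟨hφ, hN.memLp_compensatedSimpleIntegral hφ, fun _ => φ, fun _ => hφ, by simp, by simp⟩

lemma IsPoissonRandomMeasure.integral_compensatedSimpleIntegral [IsProbabilityMeasure P]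
    (hN : IsPoissonRandomMeasure P μ N) {φ : SimpleFunc E ℝ} (hφ : MemLp φ 2 μ) :
    ∫ ω, compensatedSimpleIntegral μ N φ ω ∂P = 0 := by
  simp only [compensatedSimpleIntegral]
  rw [integral_finsetSum]
  · refine Finset.sum_eq_zero (fun c _ => ?_)
    rcases eq_or_ne c 0 with rfl | hc
    · simp
    rw [integral_const_mul, hN.integral_compensated (φ.measurableSet_preimage _)
      (measure_preimage_singleton_lt_top hφ hc), mul_zero]
  · intro c _
    rcases eq_or_ne c 0 with rfl | hc
    · simp
    exact ((hN.memLp_compensated (φ.measurableSet_preimage _)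
      (measure_preimage_singleton_lt_top hφ hc)).integrable one_le_two).const_mul c

lemma IsCompensatedIntegral.integral_eq_zero [IsProbabilityMeasure P]
    (hN : IsPoissonRandomMeasure P μ N) {h : E → ℝ} {F : Ω → ℝ}
    (hF : IsCompensatedIntegral P μ N h F) : ∫ ω, F ω ∂P = 0 := by
  obtain ⟨-, hF2, φ, hφ, -, hφF⟩ := hF
  -- The mean is the pairing with the constant `1`, which lies in `L²` of a probability measure.
  have t1 := tendsto_integral_mul_of_eLpNorm (g := fun _ _ => (1 : ℝ)) (G := fun _ => 1)
    (fun n => hN.memLp_compensatedSimpleIntegral (hφ n)) (fun n => memLp_const 1) hF2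
    (memLp_const 1) hφF (by simp)
  simp only [mul_one, fun n => hN.integral_compensatedSimpleIntegral (hφ n)] at t1
  exact (tendsto_nhds_unique t1 tendsto_const_nhds)

lemma integral_sq_sub_sub {α : Type*} [MeasurableSpace α] {m : Measure α} {a b c : α → ℝ}
    (ha : MemLp a 2 m) (hb : MemLp b 2 m) (hc : MemLp c 2 m) :
    ∫ x, (a x - b x - c x) ^ 2 ∂m = ∫ x, a x * a x ∂m + ∫ x, b x * b x ∂m + ∫ x, c x * c x ∂m
      - 2 * ∫ x, a x * b x ∂m - 2 * ∫ x, a x * c x ∂m + 2 * ∫ x, b x * c x ∂m := by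
  have e : ∀ x, (a x - b x - c x) ^ 2 = a x * a x + b x * b x + c x * c x
      - 2 * (a x * b x) - 2 * (a x * c x) + 2 * (b x * c x) := fun x => by ring
  simp_rw [e]
  have iaa : Integrable (fun x => a x * a x) m := ha.integrable_mul ha
  have ibb : Integrable (fun x => b x * b x) m := hb.integrable_mul hb
  have icc : Integrable (fun x => c x * c x) m := hc.integrable_mul hc
  have iab : Integrable (fun x => 2 * (a x * b x)) m := (ha.integrable_mul hb).const_mul 2
  have iac : Integrable (fun x => 2 * (a x * c x)) m := (ha.integrable_mul hc).const_mul 2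
  have ibc : Integrable (fun x => 2 * (b x * c x)) m := (hb.integrable_mul hc).const_mul 2
  rw [integral_add ?_ ibc, integral_sub ?_ iac, integral_sub ?_ iab, integral_add ?_ icc,
    integral_add iaa ibb, integral_const_mul, integral_const_mul, integral_const_mul]
  exacts [iaa.add ibb, (iaa.add ibb).add icc, ((iaa.add ibb).add icc).sub iab,
    (((iaa.add ibb).add icc).sub iab).sub iac]

/-- Second moment of a combination of three compensated integrals. -/
lemma IsCompensatedIntegral.integral_sq_combination [IsProbabilityMeasure P]
    (hN : IsPoissonRandomMeasure P μ N) {h₁ h₂ h₃ : E → ℝ} {F₁ F₂ F₃ : Ω → ℝ}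
    (H₁ : IsCompensatedIntegral P μ N h₁ F₁) (H₂ : IsCompensatedIntegral P μ N h₂ F₂)
    (H₃ : IsCompensatedIntegral P μ N h₃ F₃) :
    ∫ ω, (F₁ ω - F₂ ω - F₃ ω) ^ 2 ∂P = ∫ x, (h₁ x - h₂ x - h₃ x) ^ 2 ∂μ := by
  rw [integral_sq_sub_sub H₁.2.1 H₂.2.1 H₃.2.1, integral_sq_sub_sub H₁.1 H₂.1 H₃.1,
    H₁.integral_mul hN H₁, H₂.integral_mul hN H₂, H₃.integral_mul hN H₃, H₁.integral_mul hN H₂,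
    H₁.integral_mul hN H₃, H₂.integral_mul hN H₃]

end PoissonRandomMeasure

/-! ### `L²` preliminaries -/

section LTwo

variable {α : Type*} {m m₀ : MeasurableSpace α} {μ : Measure[m₀] α}

lemma eLpNorm_two_sq (f : α → ℝ) :
    eLpNorm f 2 μ ^ 2 = ∫⁻ x, ENNReal.ofReal (f x ^ 2) ∂μ := by
  rw [eLpNorm_eq_lintegral_rpow_enorm_toReal (by simp) (by simp), ← ENNReal.rpow_natCast,
    ← ENNReal.rpow_mul]
  simp only [ENNReal.toReal_ofNat, ENNReal.rpow_ofNat, one_div, Nat.cast_ofNat, ne_eq,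
    OfNat.ofNat_ne_zero, not_false_eq_true, inv_mul_cancel₀, ENNReal.rpow_one]
  refine lintegral_congr (fun x => ?_)
  rw [← ofReal_norm, ← ENNReal.ofReal_pow (norm_nonneg _), Real.norm_eq_abs, sq_abs]

lemma eLpNorm_two_sq_eq_integral {f : α → ℝ} (hf : MemLp f 2 μ) :
    eLpNorm f 2 μ ^ 2 = ENNReal.ofReal (∫ x, f x ^ 2 ∂μ) := by
  rw [eLpNorm_two_sq, ofReal_integral_eq_lintegral_ofReal hf.integrable_sq
    (ae_of_all _ fun x => sq_nonneg _)]

/-- Adaptedness will be obtained through this: measurability for a sub-σ-field, up to null sets, is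
a closed condition in `L²`. -/
lemma aestronglyMeasurable_of_tendsto_eLpNorm (hm : m ≤ m₀) {f : ℕ → α → ℝ} {F : α → ℝ}
    (hf : ∀ n, MemLp (f n) 2 μ) (hfm : ∀ n, AEStronglyMeasurable[m] (f n) μ) (hF : MemLp F 2 μ)
    (h : Tendsto (fun n => eLpNorm (F - f n) 2 μ) atTop (𝓝 0)) :
    AEStronglyMeasurable[m] F μ := by
  have hc := isClosed_aestronglyMeasurable (F := ℝ) (p := 2) (μ := μ) hm
  have ht : Tendsto (fun n => (hf n).toLp (f n)) atTop (𝓝 (hF.toLp F)) := by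
    rw [tendsto_iff_edist_tendsto_0]
    refine h.congr (fun n => ?_)
    rw [edist_comm, Lp.edist_toLp_toLp]
  have := hc.mem_of_tendsto ht
    (Eventually.of_forall fun n => (hfm n).congr (hf n).coeFn_toLp.symm)
  exact AEStronglyMeasurable.congr this hF.coeFn_toLp

end LTwo

/-! ### Independence of the random measure on disjoint regions -/

section Independence

variable {Ω E : Type*} [MeasurableSpace Ω] [MeasurableSpace E] {P : Measure Ω}
  {μ : Measure E} {N : Ω → Measure E}

/-- The σ-field generated by the restriction of the random measure `N` to the set `S`. -/
@[reducible]
def regionSigma (N : Ω → Measure E) (S : Set E) : MeasurableSpace Ω :=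
  ⨆ A ∈ {A : Set E | MeasurableSet A ∧ A ⊆ S},
    MeasurableSpace.comap (fun ω => N ω A) inferInstance

lemma measurable_regionSigma {S A : Set E} (hA : MeasurableSet A) (hAS : A ⊆ S) :
    Measurable[regionSigma N S] (fun ω => N ω A) :=
  Measurable.mono (comap_measurable _)
    (le_iSup₂ (f := fun (A : Set E) (_ : A ∈ {A : Set E | MeasurableSet A ∧ A ⊆ S}) =>
      MeasurableSpace.comap (fun ω => N ω A) inferInstance) A ⟨hA, hAS⟩) le_rfl

lemma IsPoissonRandomMeasure.regionSigma_le (hN : IsPoissonRandomMeasure P μ N) (S : Set E) :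
    regionSigma N S ≤ ‹MeasurableSpace Ω› :=
  iSup₂_le fun _ hA => (hN.measurable_apply hA.1).comap_le

/-- The atoms of the finite algebra generated by `t`, inside `S`. -/
def regionAtom (S : Set E) (t ε : Finset (Set E)) : Set E :=
  S ∩ {x | ∀ A ∈ t, x ∈ A ↔ A ∈ ε}

lemma measurableSet_regionAtom {S : Set E} (hS : MeasurableSet S) {t ε : Finset (Set E)}
    (ht : ∀ A ∈ t, MeasurableSet A) : MeasurableSet (regionAtom S t ε) := by
  refine hS.inter ?_
  have : {x | ∀ A ∈ t, x ∈ A ↔ A ∈ ε} = ⋂ A ∈ t, {x | x ∈ A ↔ A ∈ ε} := by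
    ext x; simp
  rw [this]
  refine Finset.measurableSet_biInter _ (fun A hA => ?_)
  by_cases h : A ∈ ε
  · simpa [h] using ht A hA
  · have : {x | x ∈ A ↔ A ∈ ε} = Aᶜ := by ext x; simp [h]
    rw [this]
    exact (ht A hA).compl

lemma disjoint_regionAtom {S : Set E} {t ε ε' : Finset (Set E)} (hε : ε ⊆ t) (hε' : ε' ⊆ t)
    (h : ε ≠ ε') : Disjoint (regionAtom S t ε) (regionAtom S t ε') := by
  rw [Set.disjoint_left]
  rintro x ⟨-, hx⟩ ⟨-, hx'⟩
  refine h (Finset.ext fun A => ⟨fun hA => ?_, fun hA => ?_⟩)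
  · exact (hx' A (hε hA)).1 ((hx A (hε hA)).2 hA)
  · exact (hx A (hε' hA)).1 ((hx' A (hε' hA)).2 hA)

open Classical in
lemma measure_eq_sum_regionAtom {S : Set E} (hS : MeasurableSet S) {t : Finset (Set E)}
    (ht : ∀ A ∈ t, MeasurableSet A) {A : Set E} (hA : A ∈ t) (hAS : A ⊆ S) (ρ : Measure E) :
    ρ A = ∑ ε ∈ t.powerset with A ∈ ε, ρ (regionAtom S t ε) := by
  have : A = ⋃ ε ∈ t.powerset.filter (A ∈ ·), regionAtom S t ε := by
    ext x
    simp only [Finset.mem_filter, Finset.mem_powerset, mem_iUnion, exists_prop]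
    constructor
    · intro hx
      refine ⟨t.filter (x ∈ ·), ⟨Finset.filter_subset _ _, ?_⟩, hAS hx, ?_⟩
      · simp [hA, hx]
      · intro B hB
        simp [hB]
    · rintro ⟨ε, ⟨-, h⟩, -, hx⟩
      exact (hx A hA).2 h
  conv_lhs => rw [this]
  refine measure_biUnion_finset ?_ (fun ε _ => measurableSet_regionAtom hS ht)
  intro ε hε ε' hε' hne
  simp only [Finset.coe_filter, Finset.mem_powerset, mem_ofPred_eq] at hε hε'
  exact disjoint_regionAtom hε.1 hε'.1 hne

/-- The hypothesis on `N` covers only finite families of disjoint sets. By π-systems it suffices to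
treat events on finitely many `N A`. Finitely many sets inside `S` are unions of the atoms of the
algebra they generate there, and likewise in `S'`. All these atoms are pairwise disjoint, and each
`N A` is a sum over atoms, so independence of two disjoint groups of atoms suffices. -/
lemma IsPoissonRandomMeasure.indep_regionSigma [IsProbabilityMeasure P]
    (hN : IsPoissonRandomMeasure P μ N) {S S' : Set E} (hS : MeasurableSet S)
    (hS' : MeasurableSet S') (hd : Disjoint S S') :
    Indep (regionSigma N S) (regionSigma N S') P := by
  classical
  refine IndepSets.indep (hN.regionSigma_le S) (hN.regionSigma_le S')
    (isPiSystem_piiUnionInter _ (fun A => @MeasurableSpace.isPiSystem_measurableSet Ω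
      (MeasurableSpace.comap (fun ω => N ω A) inferInstance)) _)
    (isPiSystem_piiUnionInter _ (fun A => @MeasurableSpace.isPiSystem_measurableSet Ω
      (MeasurableSpace.comap (fun ω => N ω A) inferInstance)) _)
    (generateFrom_piiUnionInter_measurableSet
      (fun A : Set E => MeasurableSpace.comap (fun ω => N ω A) inferInstance) _).symm
    (generateFrom_piiUnionInter_measurableSet
      (fun A : Set E => MeasurableSpace.comap (fun ω => N ω A) inferInstance) _).symm ?_
  rw [IndepSets_iff]
  rintro _ _ ⟨t, ht, f, hf, rfl⟩ ⟨t', ht', f', hf', rfl⟩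
  set atom : t.powerset ⊕ t'.powerset → Set E :=
    Sum.elim (fun ε => regionAtom S t ε) (fun ε => regionAtom S' t' ε) with hatom
  have matom : ∀ i, MeasurableSet (atom i) := by
    rintro (i | i)
    · exact measurableSet_regionAtom hS fun A hA => (ht hA).1
    · exact measurableSet_regionAtom hS' fun A hA => (ht' hA).1
  have datom : Pairwise (fun i j => Disjoint (atom i) (atom j)) := by
    rintro (i | i) (j | j) hij
    · exact disjoint_regionAtom (Finset.mem_powerset.1 i.2) (Finset.mem_powerset.1 j.2)
        (fun h => hij (by rw [Subtype.ext h]))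
    · exact hd.mono inter_subset_left inter_subset_left
    · exact hd.symm.mono inter_subset_left inter_subset_left
    · exact disjoint_regionAtom (Finset.mem_powerset.1 i.2) (Finset.mem_powerset.1 j.2)
        (fun h => hij (by rw [Subtype.ext h]))
  have hind : iIndepFun (fun i ω => N ω (atom i)) P := by
    -- Independence of `N` is stated for families indexed by `Fin n`, hence the renumbering of the
    -- atoms.
    let e := Fintype.equivFin (t.powerset ⊕ t'.powerset)
    have h := hN.indep _ (atom ∘ e.symm) (fun i => matom _)
      (fun i j hij => datom (e.symm.injective.ne hij))
    have h2 := h.precomp e.injective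
    simpa using h2
  have hI := indep_iSup_of_disjoint (fun i => (hN.measurable_apply (matom i)).comap_le)
    hind.iIndep (S := range Sum.inl) (T := range Sum.inr)
    (by rw [Set.disjoint_left]; rintro _ ⟨a, rfl⟩ ⟨b, hb⟩; exact absurd hb (by simp))
  rw [Indep_iff] at hI
  refine hI _ _ ?_ ?_
  · refine Finset.measurableSet_biInter _ (fun A hA => ?_)
    refine MeasurableSpace.comap_le_iff_le_map.2 ?_ _ (hf A hA)
    rw [← MeasurableSpace.comap_le_iff_le_map, ← measurable_iff_comap_le]
    simp_rw [measure_eq_sum_regionAtom hS (fun A hA => (ht hA).1) hA (ht hA).2]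
    refine Finset.measurable_sum _ (fun ε hε => ?_)
    refine Measurable.mono (comap_measurable _) ?_ le_rfl
    exact le_iSup₂ (f := fun i (_ : i ∈ range Sum.inl) =>
      MeasurableSpace.comap (fun ω => N ω (atom i)) inferInstance)
      (Sum.inl ⟨ε, (Finset.mem_filter.1 hε).1⟩) ⟨_, rfl⟩
  · refine Finset.measurableSet_biInter _ (fun A hA => ?_)
    refine MeasurableSpace.comap_le_iff_le_map.2 ?_ _ (hf' A hA)
    rw [← MeasurableSpace.comap_le_iff_le_map, ← measurable_iff_comap_le]
    simp_rw [measure_eq_sum_regionAtom hS' (fun A hA => (ht' hA).1) hA (ht' hA).2]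
    refine Finset.measurable_sum _ (fun ε hε => ?_)
    refine Measurable.mono (comap_measurable _) ?_ le_rfl
    exact le_iSup₂ (f := fun i (_ : i ∈ range Sum.inr) =>
      MeasurableSpace.comap (fun ω => N ω (atom i)) inferInstance)
      (Sum.inr ⟨ε, (Finset.mem_filter.1 hε).1⟩) ⟨_, rfl⟩

/-- Modifying events on null sets changes no probability. This matters because a compensated
integral is determined by the random measure only up to null sets. -/
lemma indep_eventuallyMeasurableSpace {m₁ m₂ : MeasurableSpace Ω} (h : Indep m₁ m₂ P) :
    Indep (eventuallyMeasurableSpace m₁ (ae P)) (eventuallyMeasurableSpace m₂ (ae P)) P := by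
  rw [Indep_iff] at h ⊢
  rintro s t ⟨s', hs', hss'⟩ ⟨t', ht', htt'⟩
  rw [measure_congr hss', measure_congr htt', measure_congr (hss'.inter htt'), h _ _ hs' ht']

lemma measurable_eventually_of_aestronglyMeasurable {m₁ : MeasurableSpace Ω} {F : Ω → ℝ}
    (h : AEStronglyMeasurable[m₁] F P) :
    Measurable[eventuallyMeasurableSpace m₁ (ae P)] F :=
  Measurable.eventuallyMeasurable_of_eventuallyEq (h.stronglyMeasurable_mk.measurable)
    h.ae_eq_mk

/-! ### Measurability of compensated integrals -/

lemma measurable_compensatedSimpleIntegral_restrict {S : Set E} (hS : MeasurableSet S)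
    (φ : SimpleFunc E ℝ) :
    Measurable[regionSigma N S] (compensatedSimpleIntegral μ N (φ.restrict S)) := by
  refine Finset.measurable_sum _ (fun c _ => ?_)
  rcases eq_or_ne c 0 with rfl | hc
  · simp
  · refine Measurable.const_mul ?_ c
    refine Measurable.sub_const (Measurable.ennreal_toReal ?_) _
    refine measurable_regionSigma (SimpleFunc.measurableSet_preimage _ _) ?_
    intro x hx
    by_contra hxS
    simp only [mem_preimage, mem_singleton_iff, SimpleFunc.restrict_apply _ hS,
      indicator_of_notMem hxS] at hx
    exact hc hx.symm

/-- Three integrals are allowed so that an increment `F₁ - F₂` can be compared directly with the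
integral of an approximating simple function, without first showing that differences are compensated
integrals. -/
lemma IsCompensatedIntegral.eLpNorm_sub_sub [IsProbabilityMeasure P]
    (hN : IsPoissonRandomMeasure P μ N) {h₁ h₂ h₃ : E → ℝ} {F₁ F₂ F₃ : Ω → ℝ}
    (H₁ : IsCompensatedIntegral P μ N h₁ F₁) (H₂ : IsCompensatedIntegral P μ N h₂ F₂)
    (H₃ : IsCompensatedIntegral P μ N h₃ F₃) :
    eLpNorm (F₁ - F₂ - F₃) 2 P = eLpNorm (h₁ - h₂ - h₃) 2 μ := by
  rw [← ENNReal.pow_right_strictMono (n := 2) two_ne_zero |>.injective.eq_iff]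
  rw [eLpNorm_two_sq_eq_integral ((H₁.2.1.sub H₂.2.1).sub H₃.2.1),
    eLpNorm_two_sq_eq_integral ((H₁.1.sub H₂.1).sub H₃.1)]
  exact congrArg _ (H₁.integral_sq_combination hN H₂ H₃)

/-- Approximate `h₁ - h₂` by simple functions and restrict these to `S`. Since `h₁ = h₂` off `S`,
the error does not grow, and the restricted integrals see only `N` on subsets of `S`. -/
lemma IsCompensatedIntegral.aestronglyMeasurable_sub [IsProbabilityMeasure P]
    (hN : IsPoissonRandomMeasure P μ N) {h₁ h₂ : E → ℝ} {F₁ F₂ : Ω → ℝ}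
    (H₁ : IsCompensatedIntegral P μ N h₁ F₁) (H₂ : IsCompensatedIntegral P μ N h₂ F₂)
    {S : Set E} (hS : MeasurableSet S) (hsupp : ∀ x ∉ S, h₁ x = h₂ x) :
    AEStronglyMeasurable[regionSigma N S] (F₁ - F₂) P := by
  have hh := H₁.1.sub H₂.1
  choose φ hφ hφ2 using fun n : ℕ =>
    hh.exists_simpleFunc_eLpNorm_sub_lt (by simp) (ε := ((n : ℝ≥0∞) + 1)⁻¹) (by simp)
  have hmem : ∀ n, MemLp ((φ n).restrict S) 2 μ := fun n => by
    rw [SimpleFunc.coe_restrict _ hS]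
    exact (hφ2 n).indicator hS
  refine aestronglyMeasurable_of_tendsto_eLpNorm (hN.regionSigma_le S)
    (fun n => hN.memLp_compensatedSimpleIntegral (hmem n))
    (fun n => (measurable_compensatedSimpleIntegral_restrict hS
      (φ n)).stronglyMeasurable.aestronglyMeasurable) (H₁.2.1.sub H₂.2.1) ?_
  simp_rw [fun n => H₁.eLpNorm_sub_sub hN H₂ (hN.isCompensatedIntegral_simpleFunc (hmem n))]
  have hlim : Tendsto (fun n : ℕ => ((n : ℝ≥0∞) + 1)⁻¹) atTop (𝓝 0) := by
    have := ENNReal.tendsto_inv_nat_nhds_zero.comp (tendsto_add_atTop_nat 1)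
    refine this.congr (fun n => ?_)
    simp
  refine tendsto_of_tendsto_of_tendsto_of_le_of_le tendsto_const_nhds hlim
    (fun n => zero_le) (fun n => ?_)
  refine le_trans ?_ (hφ n).le
  refine eLpNorm_mono (fun x => ?_)
  simp only [SimpleFunc.coe_restrict _ hS, Pi.sub_apply]
  by_cases hx : x ∈ S
  · simp [hx]
  · simp [hx, hsupp x hx]

lemma IsCompensatedIntegral.aestronglyMeasurable [IsProbabilityMeasure P]
    (hN : IsPoissonRandomMeasure P μ N) {h : E → ℝ} {F : Ω → ℝ}
    (H : IsCompensatedIntegral P μ N h F)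
    {S : Set E} (hS : MeasurableSet S) (hsupp : ∀ x ∉ S, h x = 0) :
    AEStronglyMeasurable[regionSigma N S] F P := by
  have h0 : compensatedSimpleIntegral μ N 0 = 0 := by
    ext ω
    refine Finset.sum_eq_zero (fun c hc => ?_)
    rw [SimpleFunc.mem_range] at hc
    obtain ⟨x, rfl⟩ := hc
    simp
  have hz : MemLp (0 : SimpleFunc E ℝ) 2 μ := by
    rw [SimpleFunc.coe_zero]; exact MemLp.zero
  have := H.aestronglyMeasurable_sub hN (hN.isCompensatedIntegral_simpleFunc hz) hS
    (by simpa using hsupp)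
  simpa [h0] using this

end Independence

/-! ### Second moments of the Lévy white noise -/

/-- Chebyshev's inequality bounds the mass of `{z² ≥ 1/(n+1)}`, and these sets with the null set
`{0}` exhaust the line. Fubini for the intensity needs this. -/
lemma IsSquareIntegrableLevyMeasure.sigmaFinite {ν : Measure ℝ}
    (hν : IsSquareIntegrableLevyMeasure ν) : SigmaFinite ν := by
  have hfin : ∀ n : ℕ, ν {z : ℝ | ((n : ℝ) + 1)⁻¹ ≤ z ^ 2} < ∞ := by
    intro n
    have h := meas_ge_le_lintegral_div (μ := ν) (f := fun z : ℝ => ENNReal.ofReal (z ^ 2))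
      (by fun_prop) (ε := ENNReal.ofReal (((n : ℝ) + 1)⁻¹))
      (by simp only [ne_eq, ENNReal.ofReal_eq_zero, not_le]; positivity) (by simp)
    refine lt_of_le_of_lt (le_trans (measure_mono ?_) h) (ENNReal.div_lt_top hν.variance.ne ?_)
    · intro z hz
      exact ENNReal.ofReal_le_ofReal hz
    · simp only [ne_eq, ENNReal.ofReal_eq_zero, not_le]
      positivity
  refine ⟨⟨⟨fun n => {z : ℝ | ((n : ℝ) + 1)⁻¹ ≤ z ^ 2} ∪ {0}, fun _ => trivial, fun n => ?_,
    ?_⟩⟩⟩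
  · exact (measure_union_le _ _).trans_lt (by rw [hν.zero, add_zero]; exact hfin n)
  · refine eq_univ_of_forall (fun z => ?_)
    rcases eq_or_ne z 0 with rfl | hz
    · exact mem_iUnion.2 ⟨0, Or.inr rfl⟩
    · obtain ⟨n, hn⟩ := exists_nat_one_div_lt (show (0 : ℝ) < z ^ 2 by positivity)
      refine mem_iUnion.2 ⟨n, Or.inl ?_⟩
      rw [one_div] at hn
      exact hn.le

/-- The variance `v = ∫ z² ν(dz)` of a Lévy measure. -/
noncomputable def levyVariance (ν : Measure ℝ) : ℝ := ∫ z, z ^ 2 ∂ν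

lemma levyVariance_nonneg (ν : Measure ℝ) : 0 ≤ levyVariance ν :=
  integral_nonneg fun _ => sq_nonneg _

section Noise

variable {Ω : Type*} [MeasurableSpace Ω] {P : Measure Ω} [IsProbabilityMeasure P] {T : ℝ}
  {ν : Measure ℝ} {N : Ω → Measure (ℝ × ℝ × ℝ)} {L : ℝ → Set ℝ → Ω → ℝ}

omit [IsProbabilityMeasure P] in
lemma IsLevyWhiteNoise.memLp (hL : IsLevyWhiteNoise P T ν N L) {t : ℝ} (ht : t ∈ Icc 0 T)
    {A : Set ℝ} (hA : MeasurableSet A) (hAb : Bornology.IsBounded A) : MemLp (L t A) 2 P :=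
  (hL.integral t ht A hA hAb).2.1

/-- The isometry turns the covariance into an integral of a product of indicators times `z²`, which
factorises over time, space and jump size. -/
lemma IsLevyWhiteNoise.integral_mul (hL : IsLevyWhiteNoise P T ν N L)
    (hν : IsSquareIntegrableLevyMeasure ν) (hN : IsPoissonRandomMeasure P (intensity T ν) N)
    {s t : ℝ} (hs : s ∈ Icc 0 T) (ht : t ∈ Icc 0 T)
    {A B : Set ℝ} (hA : MeasurableSet A) (hAb : Bornology.IsBounded A) (hB : MeasurableSet B)
    (hBb : Bornology.IsBounded B) :
    ∫ ω, L s A ω * L t B ω ∂P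
      = min s t * (volume.real (A ∩ B) * levyVariance ν) := by
  have := hν.sigmaFinite
  rw [(hL.integral s hs A hA hAb).integral_mul hN (hL.integral t ht B hB hBb)]
  have e : ∀ p : ℝ × ℝ × ℝ,
      indicator (Icc 0 s ×ˢ A ×ˢ univ) (fun p : ℝ × ℝ × ℝ => p.2.2) p *
        indicator (Icc 0 t ×ˢ B ×ˢ univ) (fun p : ℝ × ℝ × ℝ => p.2.2) p
      = (Icc 0 (min s t)).indicator 1 p.1 * ((A ∩ B).indicator 1 p.2.1 * p.2.2 ^ 2) := by
    intro p
    have h : p ∈ Icc 0 s ×ˢ A ×ˢ (univ : Set ℝ) ∧ p ∈ Icc 0 t ×ˢ B ×ˢ (univ : Set ℝ) ↔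
        p.1 ∈ Icc 0 (min s t) ∧ p.2.1 ∈ A ∩ B := by
      simp only [Set.mem_prod, Set.mem_univ, Set.mem_Icc, Set.mem_inter_iff, le_min_iff]
      tauto
    by_cases h1 : p ∈ Icc 0 s ×ˢ A ×ˢ (univ : Set ℝ)
    · by_cases h2 : p ∈ Icc 0 t ×ˢ B ×ˢ (univ : Set ℝ)
      · have h' := h.1 ⟨h1, h2⟩
        rw [indicator_of_mem h1, indicator_of_mem h2, indicator_of_mem h'.1, indicator_of_mem h'.2]
        simp [sq]
      · have h' := h.not.1 (fun h => h2 h.2)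
        rw [indicator_of_notMem h2]
        by_cases h3 : p.1 ∈ Icc 0 (min s t)
        · rw [indicator_of_notMem (s := A ∩ B) (fun h4 => h' ⟨h3, h4⟩)]; simp
        · rw [indicator_of_notMem h3]; simp
    · have h' := h.not.1 (fun h => h1 h.1)
      rw [indicator_of_notMem h1]
      by_cases h3 : p.1 ∈ Icc 0 (min s t)
      · rw [indicator_of_notMem (s := A ∩ B) (fun h4 => h' ⟨h3, h4⟩)]; simp
      · rw [indicator_of_notMem h3]; simp
  simp_rw [e]
  rw [intensity, integral_prod_mul (fun r : ℝ => (Icc 0 (min s t)).indicator (1 : ℝ → ℝ) r)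
    (fun q : ℝ × ℝ => (A ∩ B).indicator (1 : ℝ → ℝ) q.1 * q.2 ^ 2),
    integral_prod_mul (fun r : ℝ => (A ∩ B).indicator (1 : ℝ → ℝ) r) (fun z : ℝ => z ^ 2),
    integral_indicator_one (hA.inter hB), integral_indicator_one measurableSet_Icc,
    measureReal_restrict_apply measurableSet_Icc, levyVariance]
  congr 1
  rw [Icc_inter_Icc, max_self, min_eq_left ((min_le_left _ _).trans hs.2), measureReal_def,
    Real.volume_Icc, sub_zero, ENNReal.toReal_ofReal (le_min hs.1 ht.1)]

omit [IsProbabilityMeasure P] in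
lemma IsLevyWhiteNoise.noiseFiltration_le (hL : IsLevyWhiteNoise P T ν N L) {a : ℝ}
    (ha : a ≤ T) : noiseFiltration L a ≤ ‹MeasurableSpace Ω› :=
  iSup_le fun s => iSup_le fun hs => iSup_le fun A => iSup_le fun hA => iSup_le fun hAb =>
    (hL.measurable s ⟨hs.1, hs.2.trans ha⟩ A hA hAb).comap_le

omit [MeasurableSpace Ω] in
lemma noiseFiltration_mono {a b : ℝ} (hab : a ≤ b) : noiseFiltration L a ≤ noiseFiltration L b :=
  iSup_mono fun s => iSup_le fun hs =>
    le_iSup_of_le (i := (⟨hs.1, hs.2.trans hab⟩ : s ∈ Icc 0 b)) le_rfl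

omit [MeasurableSpace Ω] in
lemma measurable_noise {s t : ℝ} (hs : s ∈ Icc 0 t) {A : Set ℝ} (hA : MeasurableSet A)
    (hAb : Bornology.IsBounded A) : Measurable[noiseFiltration L t] (L s A) := by
  refine Measurable.mono (comap_measurable (L s A)) ?_ le_rfl
  exact le_iSup_of_le s (le_iSup_of_le hs (le_iSup_of_le A (le_iSup_of_le hA
    (le_iSup_of_le hAb le_rfl))))

/-- The events depending on the random measure after time `a`, up to null sets. -/
@[reducible]
def futureSigma (P : Measure Ω) (N : Ω → Measure (ℝ × ℝ × ℝ)) (a : ℝ) : MeasurableSpace Ω :=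
  eventuallyMeasurableSpace (regionSigma N {p : ℝ × ℝ × ℝ | a < p.1}) (ae P)

/-- For `s ≤ a` the integrand of `L_s(B)` vanishes after time `a`, so the past of `L` lies in the
completed σ-field of the region `{time ≤ a}`. -/
lemma IsLevyWhiteNoise.indep_futureSigma (hL : IsLevyWhiteNoise P T ν N L)
    (hN : IsPoissonRandomMeasure P (intensity T ν) N) {a : ℝ} (ha : a ≤ T) :
    Indep (noiseFiltration L a) (futureSigma P N a) P := by
  have hS : MeasurableSet {p : ℝ × ℝ × ℝ | p.1 ≤ a} := measurableSet_le measurable_fst (by fun_prop)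
  have hS' : MeasurableSet {p : ℝ × ℝ × ℝ | a < p.1} := measurableSet_lt (by fun_prop) measurable_fst
  have hd : Disjoint {p : ℝ × ℝ × ℝ | p.1 ≤ a} {p : ℝ × ℝ × ℝ | a < p.1} := by
    rw [Set.disjoint_left]
    intro p hp hp'
    simp only [Set.mem_ofPred_eq] at hp hp'
    exact absurd hp' (not_lt.2 hp)
  refine indep_of_indep_of_le_left
    (indep_eventuallyMeasurableSpace (hN.indep_regionSigma hS hS' hd)) ?_
  refine iSup_le fun s => iSup_le fun hs => iSup_le fun A => iSup_le fun hA => iSup_le fun hAb => ?_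
  rw [← measurable_iff_comap_le]
  refine measurable_eventually_of_aestronglyMeasurable ?_
  refine (hL.integral s ⟨hs.1, hs.2.trans ha⟩ A hA hAb).aestronglyMeasurable hN hS ?_
  intro p hp
  refine indicator_of_notMem (fun h => hp ?_) _
  exact h.1.2.trans hs.2

/-- The integrands of `L_b(A)` and `L_a(A)` agree at all times up to `a`. -/
lemma IsLevyWhiteNoise.measurable_increment (hL : IsLevyWhiteNoise P T ν N L)
    (hN : IsPoissonRandomMeasure P (intensity T ν) N) {a b : ℝ} (ha : 0 ≤ a) (hab : a ≤ b)
    (hb : b ≤ T) {A : Set ℝ} (hA : MeasurableSet A) (hAb : Bornology.IsBounded A) :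
    Measurable[futureSigma P N a] (L b A - L a A) := by
  refine measurable_eventually_of_aestronglyMeasurable ?_
  refine (hL.integral b ⟨ha.trans hab, hb⟩ A hA hAb).aestronglyMeasurable_sub hN
    (hL.integral a ⟨ha, hab.trans hb⟩ A hA hAb)
    (measurableSet_lt (by fun_prop) measurable_fst) ?_
  intro p hp
  have hp' : p.1 ≤ a := not_lt.1 hp
  have h : p ∈ Icc 0 b ×ˢ A ×ˢ (univ : Set ℝ) ↔ p ∈ Icc 0 a ×ˢ A ×ˢ (univ : Set ℝ) := by
    simp only [Set.mem_prod, Set.mem_Icc, hp', hp'.trans hab]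
  by_cases h' : p ∈ Icc 0 a ×ˢ A ×ˢ (univ : Set ℝ)
  · rw [indicator_of_mem h', indicator_of_mem (h.2 h')]
  · rw [indicator_of_notMem h', indicator_of_notMem (h.not.2 h')]

lemma IsLevyWhiteNoise.integral_mul_future (hL : IsLevyWhiteNoise P T ν N L)
    (hN : IsPoissonRandomMeasure P (intensity T ν) N) {a : ℝ} (ha : a ≤ T) {Y Z : Ω → ℝ}
    (hY : Measurable[noiseFiltration L a] Y) (hZ : Measurable[futureSigma P N a] Z)
    (hZm : AEStronglyMeasurable Z P) :
    ∫ ω, Y ω * Z ω ∂P = (∫ ω, Y ω ∂P) * ∫ ω, Z ω ∂P := by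
  have hI : IndepFun Y Z P := by
    rw [IndepFun_iff_Indep]
    exact indep_of_indep_of_le (hL.indep_futureSigma hN ha) hY.comap_le hZ.comap_le
  exact hI.integral_mul_eq_mul_integral
    ((hY.mono (hL.noiseFiltration_le ha) le_rfl).aestronglyMeasurable) hZm

lemma IsLevyWhiteNoise.integral_eq_zero (hL : IsLevyWhiteNoise P T ν N L)
    (hN : IsPoissonRandomMeasure P (intensity T ν) N) {t : ℝ} (ht : t ∈ Icc 0 T)
    {A : Set ℝ} (hA : MeasurableSet A) (hAb : Bornology.IsBounded A) :
    ∫ ω, L t A ω ∂P = 0 :=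
  (hL.integral t ht A hA hAb).integral_eq_zero hN

omit [IsProbabilityMeasure P] in
lemma memLp_bounded_mul {Y F : Ω → ℝ} (hY : Measurable Y) {C : ℝ} (hC : ∀ ω, |Y ω| ≤ C)
    (hF : MemLp F 2 P) : MemLp (fun ω => Y ω * F ω) 2 P := by
  refine MemLp.of_le_mul (c := C) hF (hY.aestronglyMeasurable.mul hF.1) (ae_of_all _ fun ω => ?_)
  rw [norm_mul]
  exact mul_le_mul_of_nonneg_right (hC ω) (norm_nonneg _)

/-- The covariance of `Y (L_b(A) - L_a(A))` and `Y' (L_{b'}(A') - L_{a'}(A'))` for `a ≤ a'`. -/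
lemma IsLevyWhiteNoise.integral_increment_mul (hL : IsLevyWhiteNoise P T ν N L)
    (hν : IsSquareIntegrableLevyMeasure ν) (hN : IsPoissonRandomMeasure P (intensity T ν) N)
    {a b a' b' : ℝ} (ha : 0 ≤ a) (hab : a < b) (hb : b ≤ T) (hab' : a' < b')
    (hb' : b' ≤ T) (haa' : a ≤ a') {A A' : Set ℝ} (hA : MeasurableSet A)
    (hAb : Bornology.IsBounded A) (hA' : MeasurableSet A') (hAb' : Bornology.IsBounded A')
    {Y Y' : Ω → ℝ} (hY : Measurable[noiseFiltration L a] Y)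
    (hY' : Measurable[noiseFiltration L a'] Y') {C C' : ℝ} (hC : ∀ ω, |Y ω| ≤ C)
    (hC' : ∀ ω, |Y' ω| ≤ C') :
    ∫ ω, (Y ω * (L b A ω - L a A ω)) * (Y' ω * (L b' A' ω - L a' A' ω)) ∂P
      = levyVariance ν * (volume.real (Ioc a b ∩ Ioc a' b') *
        (volume.real (A ∩ A') * ∫ ω, Y ω * Y' ω ∂P)) := by
  have ha'T : a' ≤ T := hab'.le.trans hb'
  have ha'0 : 0 ≤ a' := ha.trans haa'
  -- The interval `(a,b]` is cut at `a'`: `(a,p]` lies before `a'` and `(a',q]` after it. If `b ≤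
  -- a'` then `q = a'` and the second piece is empty.
  set p := min b a' with hp
  set q := max b a' with hq
  have hap : a ≤ p := le_min hab.le haa'
  have hqT : q ≤ T := max_le hb ha'T
  have ha'q : a' ≤ q := le_max_right _ _
  have mp : p ∈ Icc 0 T := ⟨ha.trans hap, (min_le_left _ _).trans hb⟩
  have mq : q ∈ Icc 0 T := ⟨ha'0.trans ha'q, hqT⟩
  have mb' : b' ∈ Icc 0 T := ⟨ha'0.trans hab'.le, hb'⟩
  have ma' : a' ∈ Icc 0 T := ⟨ha'0, ha'T⟩
  have ma : a ∈ Icc 0 T := ⟨ha, haa'.trans ha'T⟩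
  have hsplit : ∀ ω, L b A ω - L a A ω = (L p A ω - L a A ω) + (L q A ω - L a' A ω) := by
    intro ω
    rcases le_total b a' with h | h
    · simp [hp, hq, min_eq_left h, max_eq_right h]
    · simp [hp, hq, min_eq_right h, max_eq_left h]
  have hYa' : Measurable[noiseFiltration L a'] Y := hY.mono (noiseFiltration_mono haa') le_rfl
  have hYm : Measurable Y := hYa'.mono (hL.noiseFiltration_le ha'T) le_rfl
  have hYm' : Measurable Y' := hY'.mono (hL.noiseFiltration_le ha'T) le_rfl
  have D' : MemLp (L b' A' - L a' A') 2 P := (hL.memLp mb' hA' hAb').sub (hL.memLp ma' hA' hAb')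
  have D1 : MemLp (L p A - L a A) 2 P := (hL.memLp mp hA hAb).sub (hL.memLp ma hA hAb)
  have D2 : MemLp (L q A - L a' A) 2 P := (hL.memLp mq hA hAb).sub (hL.memLp ma' hA hAb)
  have YD' := memLp_bounded_mul hYm' hC' D'
  have YD1 := memLp_bounded_mul hYm hC D1
  have YD2 := memLp_bounded_mul hYm hC D2
  have mD' := hL.measurable_increment hN ha'0 hab'.le hb' hA' hAb'
  have mD2 := hL.measurable_increment hN ha'0 ha'q hqT hA hAb
  have mD1 : Measurable[noiseFiltration L a'] (L p A - L a A) :=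
    (measurable_noise ⟨mp.1, min_le_right _ _⟩ hA hAb).sub (measurable_noise ⟨ha, haa'⟩ hA hAb)
  have z' : ∫ ω, (L b' A' - L a' A') ω ∂P = 0 := by
    simp only [Pi.sub_apply]
    rw [integral_sub ((hL.memLp mb' hA' hAb').integrable one_le_two)
      ((hL.memLp ma' hA' hAb').integrable one_le_two), hL.integral_eq_zero hN mb' hA' hAb',
      hL.integral_eq_zero hN ma' hA' hAb', sub_zero]
  -- Apart from the increment over `(a',b']`, every factor is known at time `a'`, and that increment
  -- has mean zero.
  have first : ∫ ω, (Y ω * (L p A - L a A) ω) * (Y' ω * (L b' A' - L a' A') ω) ∂P = 0 := by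
    have := hL.integral_mul_future hN ha'T ((hYa'.mul mD1).mul hY') mD' D'.1
    rw [z', mul_zero] at this
    rw [← this]
    refine integral_congr_ae (ae_of_all _ fun ω => ?_)
    simp only [Pi.mul_apply]
    ring
  have cov : ∫ ω, (L q A - L a' A) ω * (L b' A' - L a' A') ω ∂P
      = (min q b' - a') * (volume.real (A ∩ A') * levyVariance ν) := by
    have i : ∀ {s t : ℝ}, s ∈ Icc 0 T → t ∈ Icc 0 T →
        Integrable (fun ω => L s A ω * L t A' ω) P := fun hs ht =>
      (hL.memLp hs hA hAb).integrable_mul (hL.memLp ht hA' hAb')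
    have e : ∀ ω, (L q A - L a' A) ω * (L b' A' - L a' A') ω = L q A ω * L b' A' ω
        - L q A ω * L a' A' ω - (L a' A ω * L b' A' ω - L a' A ω * L a' A' ω) := fun ω => by
      simp only [Pi.sub_apply]; ring
    simp_rw [e]
    rw [integral_sub ?_ ?_, integral_sub (i mq mb') (i mq ma'), integral_sub (i ma' mb') (i ma' ma'),
      hL.integral_mul hν hN mq mb' hA hAb hA' hAb', hL.integral_mul hν hN mq ma' hA hAb hA' hAb',
      hL.integral_mul hν hN ma' mb' hA hAb hA' hAb', hL.integral_mul hν hN ma' ma' hA hAb hA' hAb',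
      min_eq_right ha'q, min_eq_left hab'.le, min_self]
    · ring
    · exact (i mq mb').sub (i mq ma')
    · exact (i ma' mb').sub (i ma' ma')
  -- Here both increments lie after `a'`, so their product is independent of `Y Y'`.
  have second : ∫ ω, (Y ω * (L q A - L a' A) ω) * (Y' ω * (L b' A' - L a' A') ω) ∂P
      = (∫ ω, Y ω * Y' ω ∂P) * ((min q b' - a') * (volume.real (A ∩ A') * levyVariance ν)) := by
    have := hL.integral_mul_future hN ha'T (hYa'.mul hY') (mD2.mul mD') (D2.1.mul D'.1)
    simp only [Pi.mul_apply] at this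
    rw [cov] at this
    rw [← this]
    refine integral_congr_ae (ae_of_all _ fun ω => ?_)
    simp only []
    ring
  have hvol : volume.real (Ioc a b ∩ Ioc a' b') = min q b' - a' := by
    rw [Ioc_inter_Ioc, measureReal_def, Real.volume_Ioc, ENNReal.toReal_ofReal', hq]
    change max (min b b' - max a a') 0 = _
    rw [max_eq_right haa']
    rcases le_total b a' with h | h
    · rw [max_eq_right h, min_eq_left hab'.le, max_eq_right]
      · ring
      · linarith [min_le_left b b']
    · rw [max_eq_left h, max_eq_left]
      exact sub_nonneg.2 (le_min h hab'.le)
  calc _ = ∫ ω, (Y ω * (L p A - L a A) ω) * (Y' ω * (L b' A' - L a' A') ω)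
          + (Y ω * (L q A - L a' A) ω) * (Y' ω * (L b' A' - L a' A') ω) ∂P := by
        refine integral_congr_ae (ae_of_all _ fun ω => ?_)
        simp only [hsplit, Pi.sub_apply]
        ring
    _ = _ := by
        rw [MeasureTheory.integral_add ?_ ?_, first, second, hvol]
        · ring
        · exact YD1.integrable_mul YD'
        · exact YD2.integrable_mul YD'

end Noise

/-! ### The energy as an `L²` norm -/

section Energy

variable {Ω : Type*} [MeasurableSpace Ω] {P : Measure Ω} [IsProbabilityMeasure P] {T : ℝ}

/-- Lebesgue measure on the subtype `[0,T]`. -/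
noncomputable def timeMeasure (T : ℝ) : Measure (Icc (0 : ℝ) T) :=
  (volume : Measure ℝ).comap Subtype.val

instance (T : ℝ) : IsFiniteMeasure (timeMeasure T) := by
  refine ⟨?_⟩
  rw [timeMeasure, comap_subtype_coe_apply measurableSet_Icc]
  exact (measure_mono (image_subset_iff.2 fun t _ => t.2)).trans_lt (measure_Icc_lt_top (a := (0 : ℝ)) (b := T))

lemma lintegral_timeMeasure (T : ℝ) (f : ℝ → ℝ≥0∞) :
    ∫⁻ t : Icc (0 : ℝ) T, f t ∂(timeMeasure T) = ∫⁻ t in Icc 0 T, f t :=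
  lintegral_subtype_comap measurableSet_Icc f

/-- The measure `dt dx P(dω)` on `[0,T] × ℝ × Ω`. -/
noncomputable def energyMeasure (P : Measure Ω) (T : ℝ) : Measure (Icc (0 : ℝ) T × ℝ × Ω) :=
  (timeMeasure T).prod ((volume : Measure ℝ).prod P)

/-- A random field as a function on `[0,T] × ℝ × Ω`. -/
def fieldFun (T : ℝ) {Ω : Type*} (X : ℝ → ℝ → Ω → ℝ) (p : Icc (0 : ℝ) T × ℝ × Ω) : ℝ :=
  X p.1 p.2.1 p.2.2

/-- The definition of `energy` has `ω` outermost; moment bounds at fixed `(t,x)` require the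
expectation innermost. -/
lemma energy_eq_lintegral {X : ℝ → ℝ → Ω → ℝ} (hX : Measurable (fieldFun T X)) :
    energy P T X = ∫⁻ t in Icc 0 T, ∫⁻ x : ℝ, ∫⁻ ω, ENNReal.ofReal (X t x ω ^ 2) ∂P := by
  have hf : Measurable (fun p : Icc (0 : ℝ) T × ℝ × Ω => ENNReal.ofReal (fieldFun T X p ^ 2)) :=
    (hX.pow_const 2).ennreal_ofReal
  simp only [energy]
  simp_rw [← lintegral_timeMeasure]
  rw [lintegral_lintegral_swap]
  · refine lintegral_congr (fun t => ?_)
    rw [lintegral_lintegral_swap]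
    exact (hf.comp (f := fun q : Ω × ℝ => (t, q.2, q.1)) (by fun_prop)).aemeasurable
  · refine Measurable.aemeasurable ?_
    exact Measurable.lintegral_prod_right'
      (f := fun r : (Ω × Icc (0 : ℝ) T) × ℝ => ENNReal.ofReal (X r.1.2 r.2 r.1.1 ^ 2))
      (hf.comp (f := fun r : (Ω × Icc (0 : ℝ) T) × ℝ => (r.1.2, r.2, r.1.1)) (by fun_prop))

lemma energy_eq {X : ℝ → ℝ → Ω → ℝ} (hX : Measurable (fieldFun T X)) :
    energy P T X = eLpNorm (fieldFun T X) 2 (energyMeasure P T) ^ 2 := by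
  have hf : Measurable (fun p : Icc (0 : ℝ) T × ℝ × Ω => ENNReal.ofReal (fieldFun T X p ^ 2)) :=
    (hX.pow_const 2).ennreal_ofReal
  rw [energy_eq_lintegral hX, eLpNorm_two_sq, energyMeasure, lintegral_prod _ hf.aemeasurable,
    ← lintegral_timeMeasure]
  refine lintegral_congr (fun t => ?_)
  have ht : Measurable (fun q : ℝ × Ω => ENNReal.ofReal (fieldFun T X (t, q) ^ 2)) :=
    hf.comp (f := fun q : ℝ × Ω => (t, q)) (by fun_prop)
  rw [lintegral_prod _ ht.aemeasurable]
  rfl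

end Energy

lemma integral_sum_sq {α ι : Type*} [MeasurableSpace α] {m : Measure α} (s : Finset ι)
    {f : ι → α → ℝ} (hf : ∀ i, MemLp (f i) 2 m) :
    ∫ x, (∑ i ∈ s, f i x) ^ 2 ∂m = ∑ i ∈ s, ∑ j ∈ s, ∫ x, f i x * f j x ∂m := by
  simp_rw [sq, Finset.sum_mul_sum]
  have h : ∀ i j, Integrable (fun x => f i x * f j x) m := fun i j => (hf i).integrable_mul (hf j)
  rw [integral_finsetSum _ (fun i _ => integrable_finsetSum _ (fun j _ => h i j))]
  refine Finset.sum_congr rfl (fun i _ => ?_)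
  rw [integral_finsetSum _ (fun j _ => h i j)]

/-! ### Simple processes -/

namespace SimpleProcess

variable {Ω : Type*} {𝓕 : ℝ → MeasurableSpace Ω} {T : ℝ}

/-- The sum of two simple processes. -/
def add (S S' : SimpleProcess 𝓕 T) : SimpleProcess 𝓕 T where
  n := S.n + S'.n
  a := Fin.append S.a S'.a
  b := Fin.append S.b S'.b
  A := Fin.append S.A S'.A
  Y := Fin.append S.Y S'.Y
  a_nonneg i := by induction i using Fin.addCases <;> simp [S.a_nonneg, S'.a_nonneg]
  a_lt_b i := by induction i using Fin.addCases <;> simp [S.a_lt_b, S'.a_lt_b]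
  b_le i := by induction i using Fin.addCases <;> simp [S.b_le, S'.b_le]
  measurableSet_A i := by
    induction i using Fin.addCases <;> simp [S.measurableSet_A, S'.measurableSet_A]
  isBounded_A i := by induction i using Fin.addCases <;> simp [S.isBounded_A, S'.isBounded_A]
  measurable_Y i := by
    induction i using Fin.addCases with
    | left i => rw [Fin.append_left, Fin.append_left]; exact S.measurable_Y i
    | right i => rw [Fin.append_right, Fin.append_right]; exact S'.measurable_Y i
  bounded_Y i := by induction i using Fin.addCases <;> simp [S.bounded_Y, S'.bounded_Y]

/-- A scalar multiple of a simple process. -/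
def smul (c : ℝ) (S : SimpleProcess 𝓕 T) : SimpleProcess 𝓕 T where
  __ := S
  Y := fun i ω => c * S.Y i ω
  measurable_Y i := (S.measurable_Y i).const_mul c
  bounded_Y i := by
    obtain ⟨C, hC⟩ := S.bounded_Y i
    exact ⟨|c| * C, fun ω => by rw [abs_mul]; gcongr; exact hC ω⟩

lemma toFun_add (S S' : SimpleProcess 𝓕 T) : (S.add S').toFun = S.toFun + S'.toFun := by
  ext t x ω
  simp only [toFun, add, Pi.add_apply]
  erw [Fin.sum_univ_add]
  simp

lemma integral_add (S S' : SimpleProcess 𝓕 T) (L : ℝ → Set ℝ → Ω → ℝ) :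
    (S.add S').integral L = S.integral L + S'.integral L := by
  ext ω
  simp only [SimpleProcess.integral, add, Pi.add_apply]
  erw [Fin.sum_univ_add]
  simp

lemma toFun_smul (c : ℝ) (S : SimpleProcess 𝓕 T) : (S.smul c).toFun = c • S.toFun := by
  ext t x ω
  simp only [toFun, smul, Pi.smul_apply, smul_eq_mul, Finset.mul_sum]
  exact Finset.sum_congr rfl fun i _ => by ring

lemma integral_smul (c : ℝ) (S : SimpleProcess 𝓕 T) (L : ℝ → Set ℝ → Ω → ℝ) :
    (S.smul c).integral L = c • S.integral L := by
  ext ω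
  simp only [SimpleProcess.integral, smul, Pi.smul_apply, smul_eq_mul, Finset.mul_sum]
  exact Finset.sum_congr rfl fun i _ => by ring

end SimpleProcess

/-! ### The Itô isometry for simple processes. -/

section Isometry

variable {Ω : Type*} [MeasurableSpace Ω] {P : Measure Ω} [IsProbabilityMeasure P] {T : ℝ}
  {ν : Measure ℝ} {N : Ω → Measure (ℝ × ℝ × ℝ)} {L : ℝ → Set ℝ → Ω → ℝ}

omit [IsProbabilityMeasure P] in
lemma IsLevyWhiteNoise.measurable_Y (hL : IsLevyWhiteNoise P T ν N L)
    (S : SimpleProcess (noiseFiltration L) T) (i : Fin S.n) : Measurable (S.Y i) :=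
  (S.measurable_Y i).mono (hL.noiseFiltration_le ((S.a_lt_b i).le.trans (S.b_le i))) le_rfl

omit [IsProbabilityMeasure P] in
lemma IsLevyWhiteNoise.measurable_simpleTerm (hL : IsLevyWhiteNoise P T ν N L)
    (S : SimpleProcess (noiseFiltration L) T) (i : Fin S.n) :
    Measurable (fun p : Icc (0 : ℝ) T × ℝ × Ω =>
      S.Y i p.2.2 * (Ioc (S.a i) (S.b i)).indicator 1 (p.1 : ℝ) * (S.A i).indicator 1 p.2.1) := by
  refine Measurable.mul (Measurable.mul ?_ ?_) ?_
  · exact (hL.measurable_Y S i).comp (measurable_snd.comp measurable_snd)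
  · exact ((measurable_one.indicator measurableSet_Ioc).comp measurable_subtype_coe).comp
      measurable_fst
  · exact (measurable_one.indicator (S.measurableSet_A i)).comp
      (measurable_fst.comp measurable_snd)

omit [IsProbabilityMeasure P] in
lemma IsLevyWhiteNoise.measurable_fieldFun_simple (hL : IsLevyWhiteNoise P T ν N L)
    (S : SimpleProcess (noiseFiltration L) T) : Measurable (fieldFun T S.toFun) := by
  unfold fieldFun SimpleProcess.toFun
  exact Finset.measurable_sum _ (fun i _ => hL.measurable_simpleTerm S i)

omit [IsProbabilityMeasure P] in
lemma IsLevyWhiteNoise.memLp_simpleTerm (hL : IsLevyWhiteNoise P T ν N L)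
    (S : SimpleProcess (noiseFiltration L) T) (i : Fin S.n) :
    MemLp (fun ω => S.Y i ω * (L (S.b i) (S.A i) ω - L (S.a i) (S.A i) ω)) 2 P := by
  obtain ⟨C, hC⟩ := S.bounded_Y i
  have ha := S.a_nonneg i
  have hab := (S.a_lt_b i).le
  have hb := S.b_le i
  exact memLp_bounded_mul (hL.measurable_Y S i) hC
    ((hL.memLp ⟨ha.trans hab, hb⟩ (S.measurableSet_A i) (S.isBounded_A i)).sub
      (hL.memLp ⟨ha, hab.trans hb⟩ (S.measurableSet_A i) (S.isBounded_A i)))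

omit [IsProbabilityMeasure P] in
lemma IsLevyWhiteNoise.memLp_integral (hL : IsLevyWhiteNoise P T ν N L)
    (S : SimpleProcess (noiseFiltration L) T) : MemLp (S.integral L) 2 P :=
  memLp_finsetSum _ fun i _ => hL.memLp_simpleTerm S i

/-- The value matches, up to the factor `v`, the covariance in
`IsLevyWhiteNoise.integral_increment_mul`, so that the isometry can be checked term by term in the
double sum. -/
lemma IsLevyWhiteNoise.simpleTerm_mul (hL : IsLevyWhiteNoise P T ν N L)
    (S : SimpleProcess (noiseFiltration L) T) (i j : Fin S.n) :
    Integrable (fun p : Icc (0 : ℝ) T × ℝ × Ω =>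
      (S.Y i p.2.2 * (Ioc (S.a i) (S.b i)).indicator 1 (p.1 : ℝ) * (S.A i).indicator 1 p.2.1) *
      (S.Y j p.2.2 * (Ioc (S.a j) (S.b j)).indicator 1 (p.1 : ℝ) * (S.A j).indicator 1 p.2.1))
      (energyMeasure P T) ∧
    ∫ p : Icc (0 : ℝ) T × ℝ × Ω,
      (S.Y i p.2.2 * (Ioc (S.a i) (S.b i)).indicator 1 (p.1 : ℝ) * (S.A i).indicator 1 p.2.1) *
      (S.Y j p.2.2 * (Ioc (S.a j) (S.b j)).indicator 1 (p.1 : ℝ) * (S.A j).indicator 1 p.2.1)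
      ∂(energyMeasure P T)
    = volume.real (Ioc (S.a i) (S.b i) ∩ Ioc (S.a j) (S.b j)) *
        (volume.real (S.A i ∩ S.A j) * ∫ ω, S.Y i ω * S.Y j ω ∂P) := by
  have e : ∀ p : Icc (0 : ℝ) T × ℝ × Ω,
      (S.Y i p.2.2 * (Ioc (S.a i) (S.b i)).indicator 1 (p.1 : ℝ) * (S.A i).indicator 1 p.2.1) *
      (S.Y j p.2.2 * (Ioc (S.a j) (S.b j)).indicator 1 (p.1 : ℝ) * (S.A j).indicator 1 p.2.1)
      = (Ioc (S.a i) (S.b i) ∩ Ioc (S.a j) (S.b j)).indicator (1 : ℝ → ℝ) (p.1 : ℝ) *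
        ((S.A i ∩ S.A j).indicator (1 : ℝ → ℝ) p.2.1 * (S.Y i p.2.2 * S.Y j p.2.2)) := by
    intro p
    rw [inter_indicator_one, inter_indicator_one]
    simp only [Pi.mul_apply]
    ring
  have hI : MeasurableSet (Ioc (S.a i) (S.b i) ∩ Ioc (S.a j) (S.b j)) :=
    measurableSet_Ioc.inter measurableSet_Ioc
  have hIT : Ioc (S.a i) (S.b i) ∩ Ioc (S.a j) (S.b j) ⊆ Icc 0 T := fun t ht =>
    ⟨(S.a_nonneg i).trans ht.1.1.le, ht.1.2.trans (S.b_le i)⟩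
  have hA := (S.measurableSet_A i).inter (S.measurableSet_A j)
  have hAfin : volume (S.A i ∩ S.A j) < ∞ :=
    ((S.isBounded_A i).subset inter_subset_left).measure_lt_top
  obtain ⟨C, hC⟩ := S.bounded_Y i
  obtain ⟨C', hC'⟩ := S.bounded_Y j
  have hYj : MemLp (S.Y j) 2 P := MemLp.of_bound (hL.measurable_Y S j).aestronglyMeasurable C'
    (ae_of_all _ hC')
  have hYi : MemLp (S.Y i) 2 P := MemLp.of_bound (hL.measurable_Y S i).aestronglyMeasurable C
    (ae_of_all _ hC)
  have hYY : Integrable (fun ω => S.Y i ω * S.Y j ω) P := hYi.integrable_mul hYj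
  simp_rw [e]
  constructor
  · unfold energyMeasure
    refine Integrable.mul_prod (f := fun t : Icc (0 : ℝ) T =>
      (Ioc (S.a i) (S.b i) ∩ Ioc (S.a j) (S.b j)).indicator (1 : ℝ → ℝ) (t : ℝ))
      (g := fun q : ℝ × Ω => (S.A i ∩ S.A j).indicator (1 : ℝ → ℝ) q.1 *
        (S.Y i q.2 * S.Y j q.2)) ?_ ?_
    · refine Integrable.of_bound (C := 1) ?_ (ae_of_all _ fun t => ?_)
      · exact ((measurable_one.indicator hI).comp measurable_subtype_coe).aestronglyMeasurable
      · refine (norm_indicator_le_norm_self _ _).trans (by simp)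
    · refine Integrable.mul_prod (f := fun x : ℝ => (S.A i ∩ S.A j).indicator (1 : ℝ → ℝ) x)
        (g := fun ω => S.Y i ω * S.Y j ω) ?_ hYY
      exact (integrable_indicator_iff hA).2 (integrableOn_const hAfin.ne)
  · rw [energyMeasure, integral_prod_mul (fun t : Icc (0 : ℝ) T =>
      (Ioc (S.a i) (S.b i) ∩ Ioc (S.a j) (S.b j)).indicator (1 : ℝ → ℝ) (t : ℝ))
      (fun q : ℝ × Ω => (S.A i ∩ S.A j).indicator (1 : ℝ → ℝ) q.1 * (S.Y i q.2 * S.Y j q.2)),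
      integral_prod_mul (fun x : ℝ => (S.A i ∩ S.A j).indicator (1 : ℝ → ℝ) x)
        (fun ω => S.Y i ω * S.Y j ω), integral_indicator_one hA]
    congr 1
    rw [timeMeasure, integral_subtype_comap measurableSet_Icc
      (fun t => (Ioc (S.a i) (S.b i) ∩ Ioc (S.a j) (S.b j)).indicator (1 : ℝ → ℝ) t),
      integral_indicator_one hI, measureReal_restrict_apply hI, inter_eq_left.2 hIT]

lemma IsLevyWhiteNoise.memLp_fieldTerm (hL : IsLevyWhiteNoise P T ν N L)
    (S : SimpleProcess (noiseFiltration L) T) (i : Fin S.n) :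
    MemLp (fun p : Icc (0 : ℝ) T × ℝ × Ω =>
      S.Y i p.2.2 * (Ioc (S.a i) (S.b i)).indicator 1 (p.1 : ℝ) * (S.A i).indicator 1 p.2.1) 2
      (energyMeasure P T) := by
  rw [memLp_two_iff_integrable_sq (hL.measurable_simpleTerm S i).aestronglyMeasurable]
  simp_rw [sq]
  exact (hL.simpleTerm_mul S i i).1

lemma IsLevyWhiteNoise.memLp_fieldFun_simple (hL : IsLevyWhiteNoise P T ν N L)
    (S : SimpleProcess (noiseFiltration L) T) :
    MemLp (fieldFun T S.toFun) 2 (energyMeasure P T) := by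
  unfold fieldFun SimpleProcess.toFun
  exact memLp_finsetSum _ fun i _ => hL.memLp_fieldTerm S i

/-- The Itô isometry for simple processes. -/
lemma IsLevyWhiteNoise.isometry_simple (hL : IsLevyWhiteNoise P T ν N L)
    (hν : IsSquareIntegrableLevyMeasure ν) (hN : IsPoissonRandomMeasure P (intensity T ν) N)
    (S : SimpleProcess (noiseFiltration L) T) :
    eLpNorm (S.integral L) 2 P ^ 2 = ENNReal.ofReal (levyVariance ν) * energy P T S.toFun := by
  rw [energy_eq (hL.measurable_fieldFun_simple S),
    eLpNorm_two_sq_eq_integral (hL.memLp_integral S),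
    eLpNorm_two_sq_eq_integral (hL.memLp_fieldFun_simple S),
    ← ENNReal.ofReal_mul (levyVariance_nonneg ν)]
  congr 1
  simp only [SimpleProcess.integral, fieldFun, SimpleProcess.toFun]
  rw [integral_sum_sq _ (fun i => hL.memLp_simpleTerm S i), integral_sum_sq, Finset.mul_sum]
  · refine Finset.sum_congr rfl (fun i _ => ?_)
    rw [Finset.mul_sum]
    refine Finset.sum_congr rfl (fun j _ => ?_)
    rw [(hL.simpleTerm_mul S i j).2]
    obtain ⟨C, hC⟩ := S.bounded_Y i
    obtain ⟨C', hC'⟩ := S.bounded_Y j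
    -- The covariance formula assumes the first interval starts no later; the other case follows by
    -- symmetry.
    rcases le_total (S.a i) (S.a j) with h | h
    · exact hL.integral_increment_mul hν hN (S.a_nonneg i) (S.a_lt_b i) (S.b_le i) (S.a_lt_b j)
        (S.b_le j) h (S.measurableSet_A i) (S.isBounded_A i) (S.measurableSet_A j)
        (S.isBounded_A j) (S.measurable_Y i) (S.measurable_Y j) hC hC'
    · have := hL.integral_increment_mul hν hN (S.a_nonneg j) (S.a_lt_b j) (S.b_le j) (S.a_lt_b i)
        (S.b_le i) h (S.measurableSet_A j) (S.isBounded_A j) (S.measurableSet_A i)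
        (S.isBounded_A i) (S.measurable_Y j) (S.measurable_Y i) hC' hC
      rw [inter_comm (Ioc _ _), inter_comm (S.A i)]
      simp_rw [mul_comm (S.Y i _) (S.Y j _)]
      rw [← this]
      exact integral_congr_ae (ae_of_all _ fun ω => mul_comm _ _)
  · exact fun i => hL.memLp_fieldTerm S i

end Isometry

/-! ### The predictable σ-field -/

section Predictable

variable {Ω : Type*} {𝓕 : ℝ → MeasurableSpace Ω} {T : ℝ}

/-- The sets that generate the predictable σ-field. -/
def predictableRectangles (𝓕 : ℝ → MeasurableSpace Ω) (T : ℝ) :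
    Set (Set (Icc (0 : ℝ) T × ℝ × Ω)) :=
  {S | ∃ (A : Set ℝ) (F : Set Ω), MeasurableSet A ∧ Bornology.IsBounded A ∧
      MeasurableSet[𝓕 0] F ∧ S = {p | (p.1 : ℝ) = 0 ∧ p.2.1 ∈ A ∧ p.2.2 ∈ F}} ∪
   {S | ∃ (a b : ℝ) (A : Set ℝ) (F : Set Ω), 0 ≤ a ∧ a < b ∧ MeasurableSet A ∧
      Bornology.IsBounded A ∧ MeasurableSet[𝓕 a] F ∧
      S = {p | (p.1 : ℝ) ∈ Ioc a b ∧ p.2.1 ∈ A ∧ p.2.2 ∈ F}}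

lemma measurableSet_predictable_Ioc {a b : ℝ} (ha : 0 ≤ a) {A : Set ℝ}
    (hA : MeasurableSet A) (hAb : Bornology.IsBounded A) {F : Set Ω} (hF : MeasurableSet[𝓕 a] F) :
    MeasurableSet[predictableSigma 𝓕 T]
      {p : Icc (0 : ℝ) T × ℝ × Ω | (p.1 : ℝ) ∈ Ioc a b ∧ p.2.1 ∈ A ∧ p.2.2 ∈ F} := by
  rcases lt_or_ge a b with hab | hab
  · exact MeasurableSpace.measurableSet_generateFrom
      (Or.inr ⟨a, b, A, F, ha, hab, hA, hAb, hF, rfl⟩)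
  · simp [Ioc_eq_empty (not_lt.2 hab)]

lemma measurableSet_predictable_zero {A : Set ℝ} (hA : MeasurableSet A)
    (hAb : Bornology.IsBounded A) {F : Set Ω} (hF : MeasurableSet[𝓕 0] F) :
    MeasurableSet[predictableSigma 𝓕 T]
      {p : Icc (0 : ℝ) T × ℝ × Ω | (p.1 : ℝ) = 0 ∧ p.2.1 ∈ A ∧ p.2.2 ∈ F} :=
  MeasurableSpace.measurableSet_generateFrom (Or.inl ⟨A, F, hA, hAb, hF, rfl⟩)

/-- A slice at time `0` misses every `(a,b]` with `a ≥ 0`. Two intervals meet in one starting at the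
larger left end, at which monotonicity makes both events measurable. -/
lemma isPiSystem_predictableRectangles (hmono : Monotone 𝓕) :
    IsPiSystem (predictableRectangles 𝓕 T) := by
  rintro _ (⟨A, F, hA, hAb, hF, rfl⟩ | ⟨a, b, A, F, ha, hab, hA, hAb, hF, rfl⟩) _
    (⟨A', F', hA', hAb', hF', rfl⟩ | ⟨a', b', A', F', ha', hab', hA', hAb', hF', rfl⟩) hne
  · refine Or.inl ⟨A ∩ A', F ∩ F', hA.inter hA', hAb.subset inter_subset_left, hF.inter hF', ?_⟩
    ext p
    simp only [Set.mem_inter_iff, Set.mem_ofPred_eq]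
    tauto
  · obtain ⟨p, hp, hp'⟩ := hne
    simp only [Set.mem_ofPred_eq, Set.mem_Ioc] at hp hp'
    exact absurd hp'.1.1 (not_lt.2 (by rw [hp.1]; exact ha'))
  · obtain ⟨p, hp, hp'⟩ := hne
    simp only [Set.mem_ofPred_eq, Set.mem_Ioc] at hp hp'
    exact absurd hp.1.1 (not_lt.2 (by rw [hp'.1]; exact ha))
  · obtain ⟨p, hp, hp'⟩ := hne
    simp only [Set.mem_ofPred_eq, Set.mem_Ioc] at hp hp'
    refine Or.inr ⟨max a a', min b b', A ∩ A', F ∩ F', le_max_of_le_left ha,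
      (max_lt hp.1.1 hp'.1.1).trans_le (le_min hp.1.2 hp'.1.2), hA.inter hA',
      hAb.subset inter_subset_left,
      MeasurableSet.inter (hmono (le_max_left a a') _ hF) (hmono (le_max_right a a') _ hF'), ?_⟩
    ext p
    simp only [Set.mem_inter_iff, Set.mem_ofPred_eq, Set.mem_Ioc, max_lt_iff, le_min_iff]
    tauto

lemma predictableSigma_le [mΩ : MeasurableSpace Ω] (hT : 0 ≤ T) (h𝓕 : ∀ a ≤ T, 𝓕 a ≤ mΩ) :
    predictableSigma 𝓕 T ≤ (inferInstance : MeasurableSpace (Icc (0 : ℝ) T × ℝ × Ω)) := by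
  refine MeasurableSpace.generateFrom_le ?_
  rintro _ (⟨A, F, hA, hAb, hF, rfl⟩ | ⟨a, b, A, F, ha, hab, hA, hAb, hF, rfl⟩)
  · exact (measurableSet_eq_fun (by fun_prop) measurable_const).inter
      ((measurable_fst.comp measurable_snd hA).inter
        (measurable_snd.comp measurable_snd (h𝓕 0 hT F hF)))
  · rcases le_or_gt a T with haT | haT
    · exact (measurableSet_Ioc.preimage (measurable_subtype_coe.comp measurable_fst)).inter
        ((measurable_fst.comp measurable_snd hA).inter
          (measurable_snd.comp measurable_snd (h𝓕 a haT F hF)))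
    -- For `a > T` nothing is known about `𝓕 a`, but the rectangle contains no point with time in
    -- `[0,T]`.
    · convert MeasurableSet.empty
      ext p
      simp only [Set.mem_ofPred_eq, Set.mem_Ioc, mem_empty_iff_false, iff_false, not_and]
      intro h
      exact absurd (h.1.trans_le p.1.2.2) (not_lt.2 haT.le)

lemma measurable_predictable_term {a b : ℝ} (ha : 0 ≤ a) {A : Set ℝ} (hA : MeasurableSet A)
    (hAb : Bornology.IsBounded A) {Y : Ω → ℝ} (hY : Measurable[𝓕 a] Y) :
    Measurable[predictableSigma 𝓕 T] (fun p : Icc (0 : ℝ) T × ℝ × Ω =>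
      Y p.2.2 * (Ioc a b).indicator 1 (p.1 : ℝ) * A.indicator 1 p.2.1) := by
  set R : Set (Icc (0 : ℝ) T × ℝ × Ω) := {p | (p.1 : ℝ) ∈ Ioc a b ∧ p.2.1 ∈ A ∧ p.2.2 ∈ univ}
  have hR : MeasurableSet[predictableSigma 𝓕 T] R :=
    measurableSet_predictable_Ioc ha hA hAb MeasurableSet.univ
  have e : (fun p : Icc (0 : ℝ) T × ℝ × Ω =>
      Y p.2.2 * (Ioc a b).indicator 1 (p.1 : ℝ) * A.indicator 1 p.2.1)
      = R.indicator (fun p => Y p.2.2) := by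
    ext p
    by_cases h1 : (p.1 : ℝ) ∈ Ioc a b
    · by_cases h2 : p.2.1 ∈ A
      · have hp : p ∈ R := ⟨h1, h2, trivial⟩
        rw [indicator_of_mem h1, indicator_of_mem h2, indicator_of_mem hp]
        simp
      · rw [indicator_of_notMem h2, indicator_of_notMem (fun h : p ∈ R => h2 h.2.1)]
        simp
    · rw [indicator_of_notMem h1, indicator_of_notMem (fun h : p ∈ R => h1 h.1)]
      simp
  rw [e]
  intro B hB
  rw [indicator_preimage, Set.ite]
  refine MeasurableSet.union ?_ (MeasurableSet.diff ?_ hR)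
  · have : (fun p : Icc (0 : ℝ) T × ℝ × Ω => Y p.2.2) ⁻¹' B ∩ R =
        {p | (p.1 : ℝ) ∈ Ioc a b ∧ p.2.1 ∈ A ∧ p.2.2 ∈ Y ⁻¹' B} := by
      ext p
      simp only [R, Set.mem_inter_iff, Set.mem_preimage, Set.mem_ofPred_eq, Set.mem_univ]
      tauto
    rw [this]
    exact measurableSet_predictable_Ioc ha hA hAb (hY hB)
  · exact (@measurable_const _ _ _ (predictableSigma 𝓕 T) (0 : ℝ)) hB

lemma SimpleProcess.isPredictableField (S : SimpleProcess 𝓕 T) :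
    IsPredictableField 𝓕 T S.toFun := by
  unfold IsPredictableField SimpleProcess.toFun
  exact Finset.measurable_sum _ fun i _ => measurable_predictable_term (S.a_nonneg i)
    (S.measurableSet_A i) (S.isBounded_A i) (S.measurable_Y i)

/-- The indicator of a predictable rectangle `(a,b] × A × F` as a simple process. -/
noncomputable def SimpleProcess.rectangle {𝓕 : ℝ → MeasurableSpace Ω} {a b : ℝ} (ha : 0 ≤ a)
    (hab : a < b) (hb : b ≤ T) {A : Set ℝ} (hA : MeasurableSet A) (hAb : Bornology.IsBounded A)
    {F : Set Ω} (hF : MeasurableSet[𝓕 a] F) : SimpleProcess 𝓕 T where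
  n := 1
  a := fun _ => a
  b := fun _ => b
  A := fun _ => A
  Y := fun _ => F.indicator fun _ => 1
  a_nonneg _ := ha
  a_lt_b _ := hab
  b_le _ := hb
  measurableSet_A _ := hA
  isBounded_A _ := hAb
  measurable_Y _ := (@measurable_const _ _ _ (𝓕 a) (1 : ℝ)).indicator hF
  bounded_Y _ := ⟨1, fun ω => by
    by_cases h : ω ∈ F <;> simp [h]⟩

lemma SimpleProcess.fieldFun_rectangle {𝓕 : ℝ → MeasurableSpace Ω} {a b : ℝ} (ha : 0 ≤ a)
    (hab : a < b) (hb : b ≤ T) {A : Set ℝ} (hA : MeasurableSet A) (hAb : Bornology.IsBounded A)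
    {F : Set Ω} (hF : MeasurableSet[𝓕 a] F) :
    fieldFun T (SimpleProcess.rectangle ha hab hb hA hAb hF).toFun =
      indicator {p | (p.1 : ℝ) ∈ Ioc a b ∧ p.2.1 ∈ A ∧ p.2.2 ∈ F} 1 := by
  ext p
  have e : fieldFun T (SimpleProcess.rectangle ha hab hb hA hAb hF).toFun p =
      F.indicator (fun _ => (1 : ℝ)) p.2.2 * (Ioc a b).indicator 1 (p.1 : ℝ) *
        A.indicator 1 p.2.1 :=
    Fin.sum_univ_one (fun _ : Fin 1 => F.indicator (fun _ => (1 : ℝ)) p.2.2 *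
      (Ioc a b).indicator 1 (p.1 : ℝ) * A.indicator 1 p.2.1)
  rw [e]
  set R : Set (Icc (0 : ℝ) T × ℝ × Ω) := {p | (p.1 : ℝ) ∈ Ioc a b ∧ p.2.1 ∈ A ∧ p.2.2 ∈ F}
  by_cases h1 : (p.1 : ℝ) ∈ Ioc a b
  · by_cases h2 : p.2.1 ∈ A
    · by_cases h3 : p.2.2 ∈ F
      · have hp : p ∈ R := ⟨h1, h2, h3⟩
        rw [indicator_of_mem h1, indicator_of_mem h2, indicator_of_mem h3, indicator_of_mem hp]
        simp
      · rw [indicator_of_notMem h3, indicator_of_notMem (fun h : p ∈ R => h3 h.2.2)]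
        simp
    · rw [indicator_of_notMem h2, indicator_of_notMem (fun h : p ∈ R => h2 h.2.1)]
      simp
  · rw [indicator_of_notMem h1, indicator_of_notMem (fun h : p ∈ R => h1 h.1)]
    simp

end Predictable

/-! ### Density of the simple processes -/

section Density

variable {Ω : Type*} [mΩ : MeasurableSpace Ω] {P : Measure Ω} [IsProbabilityMeasure P] {T : ℝ}
  {ν : Measure ℝ} {N : Ω → Measure (ℝ × ℝ × ℝ)} {L : ℝ → Set ℝ → Ω → ℝ}

/-- The strip `(0,T] × [-n,n] × Ω`. -/
def strip (Ω : Type*) (T : ℝ) (n : ℕ) : Set (Icc (0 : ℝ) T × ℝ × Ω) :=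
  {p | (p.1 : ℝ) ∈ Ioc 0 T ∧ p.2.1 ∈ Icc (-n : ℝ) n ∧ p.2.2 ∈ univ}

lemma energyMeasure_strip_lt_top (n : ℕ) : energyMeasure P T (strip Ω T n) < ∞ := by
  have : strip Ω T n ⊆ univ ×ˢ (Icc (-n : ℝ) n ×ˢ (univ : Set Ω)) := fun p hp =>
    ⟨trivial, hp.2.1, trivial⟩
  refine (measure_mono this).trans_lt ?_
  rw [energyMeasure, Measure.prod_prod, Measure.prod_prod]
  exact ENNReal.mul_lt_top (measure_lt_top _ _)
    (ENNReal.mul_lt_top measure_Icc_lt_top (measure_lt_top _ _))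

lemma measurableSet_strip (n : ℕ) : MeasurableSet (strip Ω T n) :=
  (measurableSet_Ioc.preimage (measurable_subtype_coe.comp measurable_fst)).inter
    ((measurable_fst.comp measurable_snd measurableSet_Icc).inter MeasurableSet.univ)

lemma energyMeasure_zero_slice :
    energyMeasure P T {p | (p.1 : ℝ) = 0} = 0 := by
  have h : {p : Icc (0 : ℝ) T × ℝ × Ω | (p.1 : ℝ) = 0} =
      {t : Icc (0 : ℝ) T | (t : ℝ) = 0} ×ˢ (univ : Set (ℝ × Ω)) := by
    ext p; simp
  have h0 : timeMeasure T {t : Icc (0 : ℝ) T | (t : ℝ) = 0} = 0 := by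
    rw [timeMeasure, comap_subtype_coe_apply measurableSet_Icc]
    refine measure_mono_null (t := {0}) ?_ (by simp)
    rintro _ ⟨t, ht, rfl⟩
    exact ht
  rw [h, energyMeasure, Measure.prod_prod, h0, zero_mul]

lemma ae_mem_strip : ∀ᵐ p ∂(energyMeasure P T), ∃ n : ℕ, p ∈ strip Ω T n := by
  have h : ∀ᵐ p ∂(energyMeasure P T), (p.1 : ℝ) ≠ 0 := by
    rw [ae_iff]
    simpa using energyMeasure_zero_slice (P := P) (T := T)
  filter_upwards [h] with p hp
  obtain ⟨n, hn⟩ := exists_nat_ge |p.2.1|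
  exact ⟨n, ⟨lt_of_le_of_ne p.1.2.1 hp.symm, p.1.2.2⟩, abs_le.1 hn, trivial⟩

/-- A predictable function whose integrals over all predictable rectangles within the strips
vanish is zero. -/
lemma ae_eq_zero_of_rectangles (hT : 0 ≤ T) (hL : IsLevyWhiteNoise P T ν N L)
    {f : Icc (0 : ℝ) T × ℝ × Ω → ℝ} (hf : Measurable[predictableSigma (noiseFiltration L) T] f)
    (hf2 : MemLp f 2 (energyMeasure P T))
    (h0 : ∀ n, ∀ R ∈ predictableRectangles (noiseFiltration L) T,
      ∫ p in R, f p ∂((energyMeasure P T).restrict (strip Ω T n)) = 0) :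
    f =ᵐ[energyMeasure P T] 0 := by
  have hle := predictableSigma_le (𝓕 := noiseFiltration L) hT fun a ha => hL.noiseFiltration_le ha
  have hfin : ∀ n, IsFiniteMeasure ((energyMeasure P T).restrict (strip Ω T n)) := fun n =>
    ⟨by rw [Measure.restrict_apply_univ]; exact energyMeasure_strip_lt_top n⟩
  have hint : ∀ n, Integrable f ((energyMeasure P T).restrict (strip Ω T n)) := fun n =>
    (hf2.restrict _).integrable one_le_two
  have huniv : ∀ n, ∫ p, f p ∂((energyMeasure P T).restrict (strip Ω T n)) = 0 := by
    intro n
    -- The right end `T + 1` keeps the interval nondegenerate even when `T = 0`; this rectangle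
    -- contains the strip.
    have hR : {p : Icc (0 : ℝ) T × ℝ × Ω | (p.1 : ℝ) ∈ Ioc 0 (T + 1) ∧ p.2.1 ∈ Icc (-n : ℝ) n ∧
        p.2.2 ∈ univ} ∈ predictableRectangles (noiseFiltration L) T :=
      Or.inr ⟨0, T + 1, _, univ, le_rfl, by linarith, measurableSet_Icc,
        Metric.isBounded_Icc _ _, MeasurableSet.univ, rfl⟩
    have h := h0 n _ hR
    rw [Measure.restrict_restrict (hle _ (MeasurableSpace.measurableSet_generateFrom hR)),
      inter_eq_self_of_subset_right] at h
    · exact h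
    · intro p hp
      exact ⟨⟨hp.1.1, hp.1.2.trans (by linarith)⟩, hp.2⟩
  have key : ∀ n, ∀ S, MeasurableSet[predictableSigma (noiseFiltration L) T] S →
      ∫ p in S, f p ∂((energyMeasure P T).restrict (strip Ω T n)) = 0 := by
    intro n
    refine MeasurableSpace.induction_on_inter (m := predictableSigma (noiseFiltration L) T)
      (s := predictableRectangles (noiseFiltration L) T)
      (C := fun S _ => ∫ p in S, f p ∂((energyMeasure P T).restrict (strip Ω T n)) = 0) rfl
      (isPiSystem_predictableRectangles fun a b hab => noiseFiltration_mono hab) ?_ ?_ ?_ ?_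
    · simp
    · exact h0 n
    · intro S hS h
      rw [setIntegral_compl (hle S hS) (hint n), h, huniv, sub_zero]
    · intro S hd hS h
      rw [integral_iUnion (fun i => hle _ (hS i)) hd (hint n).integrableOn]
      simp [h]
  -- The sets `{f ≥ 0}` and `{f ≤ 0}` are themselves predictable, and `f` has integral zero and
  -- constant sign on each.
  have main : ∀ n, f =ᵐ[(energyMeasure P T).restrict (strip Ω T n)] 0 := by
    intro n
    have hp : MeasurableSet[predictableSigma (noiseFiltration L) T] {p | 0 ≤ f p} :=
      hf measurableSet_Ici
    have hm : MeasurableSet[predictableSigma (noiseFiltration L) T] {p | f p ≤ 0} :=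
      hf measurableSet_Iic
    have h1 := (setIntegral_eq_zero_iff_of_nonneg_ae
      ((ae_restrict_iff' (hle _ hp)).2 (ae_of_all _ fun p hp => hp)) (hint n).integrableOn).1
      (key n _ hp)
    have h2 := (setIntegral_eq_zero_iff_of_nonneg_ae (f := fun p => - f p)
      ((ae_restrict_iff' (hle _ hm)).2 (ae_of_all _ fun p hp => neg_nonneg.2 hp))
      (hint n).neg.integrableOn).1 (by rw [integral_neg, key n _ hm, neg_zero])
    have h1' := (ae_restrict_iff' (hle _ hp)).1 h1
    have h2' := (ae_restrict_iff' (hle _ hm)).1 h2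
    filter_upwards [h1', h2'] with p hp1 hp2
    rcases le_total 0 (f p) with h | h
    · exact hp1 h
    · exact neg_eq_zero.1 (hp2 h)
  have hall := ae_all_iff.2 fun n => (ae_restrict_iff' (measurableSet_strip n)).1 (main n)
  filter_upwards [hall, ae_mem_strip (P := P) (T := T)] with p hp ⟨n, hn⟩
  exact hp n hn

/-- The simple processes as a subspace of `L²([0,T] × ℝ × Ω)`. -/
noncomputable def IsLevyWhiteNoise.simpleSubmodule (hL : IsLevyWhiteNoise P T ν N L) :
    Submodule ℝ (Lp ℝ 2 (energyMeasure P T)) where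
  carrier := range fun S : SimpleProcess (noiseFiltration L) T =>
    (hL.memLp_fieldFun_simple S).toLp (fieldFun T S.toFun)
  add_mem' := by
    rintro _ _ ⟨S, rfl⟩ ⟨S', rfl⟩
    refine ⟨S.add S', ?_⟩
    simp only [← MemLp.toLp_add]
    congr 1
    rw [SimpleProcess.toFun_add]
    rfl
  zero_mem' := by
    refine ⟨⟨0, Fin.elim0, Fin.elim0, Fin.elim0, Fin.elim0, fun i => i.elim0, fun i => i.elim0,
      fun i => i.elim0, fun i => i.elim0, fun i => i.elim0, fun i => i.elim0,
      fun i => i.elim0⟩, ?_⟩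
    rw [Lp.eq_zero_iff_ae_eq_zero]
    refine (MemLp.coeFn_toLp _).trans (ae_of_all _ fun p => ?_)
    simp [fieldFun, SimpleProcess.toFun]
  smul_mem' := by
    rintro c _ ⟨S, rfl⟩
    refine ⟨S.smul c, ?_⟩
    simp only [← MemLp.toLp_const_smul]
    congr 1
    rw [SimpleProcess.toFun_smul]
    rfl

/-- Let `g` be `f` minus its orthogonal projection on the closure of the simple processes. It is
predictable up to null sets and orthogonal to the indicators of the rectangles cut to a strip, which
are simple processes. Hence `ae_eq_zero_of_rectangles` gives `g = 0`. -/
lemma IsLevyWhiteNoise.mem_closure_simple (hT : 0 ≤ T) (hL : IsLevyWhiteNoise P T ν N L)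
    {f : Icc (0 : ℝ) T × ℝ × Ω → ℝ} (hf : Measurable[predictableSigma (noiseFiltration L) T] f)
    (hf2 : MemLp f 2 (energyMeasure P T)) :
    hf2.toLp f ∈ hL.simpleSubmodule.topologicalClosure := by
  have hle := predictableSigma_le (𝓕 := noiseFiltration L) hT fun a ha => hL.noiseFiltration_le ha
  set K := hL.simpleSubmodule.topologicalClosure with hK
  have : CompleteSpace K := hL.simpleSubmodule.isClosed_topologicalClosure.completeSpace_coe
  have hKm : ∀ g ∈ K, AEStronglyMeasurable[predictableSigma (noiseFiltration L) T] g
      (energyMeasure P T) := by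
    intro g hg
    have hc := isClosed_aestronglyMeasurable (F := ℝ) (p := 2) (μ := energyMeasure P T) hle
    refine (closure_minimal ?_ hc) hg
    rintro _ ⟨S, rfl⟩
    exact (S.isPredictableField.stronglyMeasurable.aestronglyMeasurable).congr
      (hL.memLp_fieldFun_simple S).coeFn_toLp.symm
  set g := hf2.toLp f - K.starProjection (hf2.toLp f) with hg
  have hgm : AEStronglyMeasurable[predictableSigma (noiseFiltration L) T] g
      (energyMeasure P T) := by
    have h1 : AEStronglyMeasurable[predictableSigma (noiseFiltration L) T] (hf2.toLp f)
        (energyMeasure P T) :=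
      hf.stronglyMeasurable.aestronglyMeasurable.congr hf2.coeFn_toLp.symm
    exact (h1.sub (hKm _ (K.starProjection_apply_mem _))).congr (Lp.coeFn_sub _ _).symm
  have hg0 : ∀ S : SimpleProcess (noiseFiltration L) T,
      ∫ p, fieldFun T S.toFun p * hgm.mk g p ∂(energyMeasure P T) = 0 := by
    intro S
    have hm : (hL.memLp_fieldFun_simple S).toLp (fieldFun T S.toFun) ∈ K :=
      hL.simpleSubmodule.le_topologicalClosure ⟨S, rfl⟩
    have h := (Submodule.mem_orthogonal K g).1 (K.sub_starProjection_mem_orthogonal _) _ hm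
    rw [L2.inner_def] at h
    refine Eq.trans (integral_congr_ae ?_) h
    filter_upwards [(hL.memLp_fieldFun_simple S).coeFn_toLp, hgm.ae_eq_mk] with p h1 h2
    simp [h1, h2, mul_comm]
  have hz : hgm.mk g =ᵐ[energyMeasure P T] 0 := by
    refine ae_eq_zero_of_rectangles hT hL hgm.stronglyMeasurable_mk.measurable
      ((memLp_congr_ae hgm.ae_eq_mk).1 (Lp.memLp g)) ?_
    intro n R hR
    have hRm := hle R (MeasurableSpace.measurableSet_generateFrom hR)
    rw [Measure.restrict_restrict hRm]
    obtain ⟨A, F, hA, hAb, hF, rfl⟩ | ⟨a, b, A, F, ha, hab, hA, hAb, hF, rfl⟩ := hR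
    -- The slice at time `0` does not meet the strip, whose times are positive.
    · convert setIntegral_empty
      ext p
      simp only [strip, Set.mem_inter_iff, Set.mem_ofPred_eq, Set.mem_Ioc, mem_empty_iff_false,
        iff_false, not_and]
      intro h1 h2
      exact absurd h1.1 h2.1.ne'
    · have e : {p : Icc (0 : ℝ) T × ℝ × Ω | (p.1 : ℝ) ∈ Ioc a b ∧ p.2.1 ∈ A ∧ p.2.2 ∈ F} ∩
          strip Ω T n = {p | (p.1 : ℝ) ∈ Ioc a (min b T) ∧ p.2.1 ∈ A ∩ Icc (-n : ℝ) n ∧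
            p.2.2 ∈ F} := by
        ext p
        simp only [strip, Set.mem_inter_iff, Set.mem_ofPred_eq, Set.mem_Ioc, le_min_iff,
          Set.mem_univ]
        have := p.1.2.2
        constructor
        · tauto
        · rintro ⟨⟨h1, h2, h3⟩, ⟨h4, h5⟩, h6⟩
          exact ⟨⟨⟨h1, h2⟩, h4, h6⟩, ⟨ha.trans_lt h1, h3⟩, h5, trivial⟩
      have hRm' := hRm.inter (measurableSet_strip n)
      rw [e] at hRm' ⊢
      rcases lt_or_ge a (min b T) with h | h
      · have := hg0 (SimpleProcess.rectangle ha h (min_le_right _ _)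
          (hA.inter (measurableSet_Icc (a := (-n : ℝ)) (b := n)))
          (hAb.subset inter_subset_left) hF)
        rw [SimpleProcess.fieldFun_rectangle] at this
        rw [← integral_indicator hRm']
        refine Eq.trans (integral_congr_ae (ae_of_all _ fun p => ?_)) this
        by_cases hp : p ∈ {p : Icc (0 : ℝ) T × ℝ × Ω | (p.1 : ℝ) ∈ Ioc a (min b T) ∧
            p.2.1 ∈ A ∩ Icc (-n : ℝ) n ∧ p.2.2 ∈ F}
        · rw [indicator_of_mem hp, indicator_of_mem hp]; simp
        · rw [indicator_of_notMem hp, indicator_of_notMem hp]; simp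
      · simp [Ioc_eq_empty (not_lt.2 h)]
  have hg00 : g = 0 := by
    rw [Lp.eq_zero_iff_ae_eq_zero]
    exact hgm.ae_eq_mk.trans hz
  have : hf2.toLp f = K.starProjection (hf2.toLp f) := sub_eq_zero.1 hg00
  rw [this]
  exact K.starProjection_apply_mem _

/-! ### The Itô integral of predictable processes. -/

omit [IsProbabilityMeasure P] in
lemma IsPredictableField.measurable_fieldFun (hT : 0 ≤ T) (hL : IsLevyWhiteNoise P T ν N L)
    {X : ℝ → ℝ → Ω → ℝ} (hX : IsPredictableField (noiseFiltration L) T X) :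
    Measurable (fieldFun T X) :=
  Measurable.mono hX (predictableSigma_le hT fun _ ha => hL.noiseFiltration_le ha) le_rfl

lemma IsPredictableField.memLp_fieldFun (hT : 0 ≤ T) (hL : IsLevyWhiteNoise P T ν N L)
    {X : ℝ → ℝ → Ω → ℝ} (hX : IsPredictableField (noiseFiltration L) T X)
    (hE : energy P T X < ∞) : MemLp (fieldFun T X) 2 (energyMeasure P T) := by
  have hm := hX.measurable_fieldFun hT hL
  refine ⟨hm.aestronglyMeasurable, ?_⟩
  rw [energy_eq hm] at hE
  exact (ENNReal.pow_lt_top_iff.1 hE).resolve_right (by simp)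

lemma tendsto_zero_of_sq {α : Type*} {l : Filter α} {u : α → ℝ≥0∞}
    (h : Tendsto (fun n => u n ^ 2) l (𝓝 0)) : Tendsto u l (𝓝 0) := by
  rw [ENNReal.tendsto_nhds_zero] at h ⊢
  intro ε hε
  filter_upwards [h (ε ^ 2) (ENNReal.pow_pos hε 2)] with n hn
  exact (ENNReal.pow_le_pow_left_iff two_ne_zero).1 hn

lemma tendsto_toLp_of_energy (hT : 0 ≤ T) (hL : IsLevyWhiteNoise P T ν N L)
    {X : ℝ → ℝ → Ω → ℝ} (hX : IsPredictableField (noiseFiltration L) T X)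
    (hE : energy P T X < ∞) (S : ℕ → SimpleProcess (noiseFiltration L) T) :
    Tendsto (fun n => energy P T (X - (S n).toFun)) atTop (𝓝 0) ↔
    Tendsto (fun n => (hL.memLp_fieldFun_simple (S n)).toLp (fieldFun T (S n).toFun)) atTop
      (𝓝 ((hX.memLp_fieldFun hT hL hE).toLp (fieldFun T X))) := by
  rw [tendsto_iff_edist_tendsto_0]
  have e : ∀ n, energy P T (X - (S n).toFun) =
      edist ((hL.memLp_fieldFun_simple (S n)).toLp (fieldFun T (S n).toFun))
        ((hX.memLp_fieldFun hT hL hE).toLp (fieldFun T X)) ^ 2 := by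
    intro n
    have hm : Measurable (fieldFun T (X - (S n).toFun)) :=
      (hX.measurable_fieldFun hT hL).sub (hL.measurable_fieldFun_simple (S n))
    rw [energy_eq hm, edist_comm, Lp.edist_toLp_toLp]
    rfl
  simp_rw [e]
  constructor
  · intro h
    exact tendsto_zero_of_sq h
  · intro h
    simpa using ENNReal.Tendsto.pow (n := 2) h

lemma IsLevyWhiteNoise.edist_integral (hL : IsLevyWhiteNoise P T ν N L)
    (hν : IsSquareIntegrableLevyMeasure ν) (hN : IsPoissonRandomMeasure P (intensity T ν) N)
    (S S' : SimpleProcess (noiseFiltration L) T) :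
    edist ((hL.memLp_integral S).toLp (S.integral L))
      ((hL.memLp_integral S').toLp (S'.integral L)) ^ 2 =
    ENNReal.ofReal (levyVariance ν) *
      edist ((hL.memLp_fieldFun_simple S).toLp (fieldFun T S.toFun))
        ((hL.memLp_fieldFun_simple S').toLp (fieldFun T S'.toFun)) ^ 2 := by
  have h := hL.isometry_simple hν hN (S.add (S'.smul (-1)))
  have e1 : (S.add (S'.smul (-1))).toFun = S.toFun - S'.toFun := by
    rw [SimpleProcess.toFun_add, SimpleProcess.toFun_smul, neg_one_smul, sub_eq_add_neg]
  have e2 : (S.add (S'.smul (-1))).integral L = S.integral L - S'.integral L := by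
    rw [SimpleProcess.integral_add, SimpleProcess.integral_smul, neg_one_smul, sub_eq_add_neg]
  rw [energy_eq (hL.measurable_fieldFun_simple _), e1, e2] at h
  rw [Lp.edist_toLp_toLp, Lp.edist_toLp_toLp, h]
  rfl

/-- The Itô isometry. -/
lemma IsItoIntegral.isometry (hT : 0 ≤ T) (hL : IsLevyWhiteNoise P T ν N L)
    (hν : IsSquareIntegrableLevyMeasure ν) (hN : IsPoissonRandomMeasure P (intensity T ν) N)
    {X X' : ℝ → ℝ → Ω → ℝ} {F F' : Ω → ℝ} (h : IsItoIntegral P T L X F)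
    (h' : IsItoIntegral P T L X' F') :
    eLpNorm (F - F') 2 P ^ 2 = ENNReal.ofReal (levyVariance ν) * energy P T (X - X') := by
  obtain ⟨hX, hE, hF, S, hS, hI⟩ := h
  obtain ⟨hX', hE', hF', S', hS', hI'⟩ := h'
  rw [tendsto_toLp_of_energy hT hL hX hE] at hS
  rw [tendsto_toLp_of_energy hT hL hX' hE'] at hS'
  have conv : ∀ {F : Ω → ℝ} (hF : MemLp F 2 P) (S : ℕ → SimpleProcess (noiseFiltration L) T),
      Tendsto (fun n => eLpNorm (F - (S n).integral L) 2 P) atTop (𝓝 0) →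
      Tendsto (fun n => (hL.memLp_integral (S n)).toLp ((S n).integral L)) atTop
        (𝓝 (hF.toLp F)) := by
    intro F hF S h
    rw [tendsto_iff_edist_tendsto_0]
    refine h.congr (fun n => ?_)
    rw [edist_comm, Lp.edist_toLp_toLp]
  have t1 := ENNReal.Tendsto.pow (n := 2) ((conv hF S hI).edist (conv hF' S' hI'))
  have t2 := ENNReal.Tendsto.const_mul (a := ENNReal.ofReal (levyVariance ν))
    (ENNReal.Tendsto.pow (n := 2) (hS.edist hS')) (Or.inr ENNReal.ofReal_ne_top)
  simp_rw [fun n => hL.edist_integral hν hN (S n) (S' n)] at t1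
  have := tendsto_nhds_unique t1 t2
  rw [Lp.edist_toLp_toLp, Lp.edist_toLp_toLp] at this
  rw [this, energy_eq ((hX.measurable_fieldFun hT hL).sub (hX'.measurable_fieldFun hT hL))]
  rfl

lemma cauchySeq_of_edist_sq_le {α β : Type*} [PseudoEMetricSpace α] [PseudoEMetricSpace β]
    {u : ℕ → α} {v : ℕ → β} (hu : CauchySeq u) {c : ℝ≥0∞} (hc : c ≠ ∞)
    (h : ∀ n m, edist (v n) (v m) ^ 2 ≤ c * edist (u n) (u m) ^ 2) : CauchySeq v := by
  rw [EMetric.cauchySeq_iff] at hu ⊢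
  intro ε hε
  -- Passing from `c` to `c + 1` gives a nonzero constant by which `ε` can be divided.
  have hc1 : c + 1 ≠ ∞ := by simp [hc]
  have hc0 : (c + 1) ≠ 0 := by simp
  have hr0 : (c + 1) ^ (1 / 2 : ℝ) ≠ 0 := by simp [ENNReal.rpow_eq_zero_iff, hc]
  have hr1 : (c + 1) ^ (1 / 2 : ℝ) ≠ ∞ := by simp [ENNReal.rpow_eq_top_iff, hc]
  obtain ⟨M, hM⟩ := hu (ε / (c + 1) ^ (1 / 2 : ℝ)) (ENNReal.div_pos hε.ne' hr1)
  refine ⟨M, fun m hm n hn => ?_⟩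
  have h1 := hM m hm n hn
  have h2 : edist (v m) (v n) ≤ (c + 1) ^ (1 / 2 : ℝ) * edist (u m) (u n) := by
    rw [← ENNReal.pow_le_pow_left_iff (n := 2) two_ne_zero, mul_pow]
    refine (h m n).trans (mul_le_mul_left ?_ _)
    rw [← ENNReal.rpow_natCast, ← ENNReal.rpow_mul]
    simp
  refine h2.trans_lt ?_
  rw [mul_comm]
  exact (ENNReal.lt_div_iff_mul_lt (Or.inl hr0) (Or.inl hr1)).1 h1

lemma IsLevyWhiteNoise.exists_simple_tendsto (hT : 0 ≤ T) (hL : IsLevyWhiteNoise P T ν N L)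
    {X : ℝ → ℝ → Ω → ℝ} (hX : IsPredictableField (noiseFiltration L) T X)
    (hE : energy P T X < ∞) : ∃ S : ℕ → SimpleProcess (noiseFiltration L) T,
      Tendsto (fun n => energy P T (X - (S n).toFun)) atTop (𝓝 0) := by
  have h := hL.mem_closure_simple hT hX (hX.memLp_fieldFun hT hL hE)
  obtain ⟨v, hv, hlim⟩ := mem_closure_iff_seq_limit.1 h
  choose S hS using hv
  refine ⟨S, (tendsto_toLp_of_energy hT hL hX hE S).2 ?_⟩
  exact hlim.congr (fun n => (hS n).symm)

/-- The part of a simple process before time `t`. -/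
noncomputable def SimpleProcess.truncate {𝓕 : ℝ → MeasurableSpace Ω} (S : SimpleProcess 𝓕 T)
    (t : ℝ) : SimpleProcess 𝓕 T where
  n := S.n
  a := S.a
  -- A term starting at or after `t` cannot be shortened, since `a < b` is required; it keeps its
  -- interval and its coefficient becomes zero.
  b := fun i => if S.a i < t then min (S.b i) t else S.b i
  A := S.A
  Y := fun i => if S.a i < t then S.Y i else fun _ => 0
  a_nonneg := S.a_nonneg
  a_lt_b i := by
    split_ifs with h
    · exact lt_min (S.a_lt_b i) h
    · exact S.a_lt_b i
  b_le i := by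
    split_ifs with h
    · exact (min_le_left _ _).trans (S.b_le i)
    · exact S.b_le i
  measurableSet_A := S.measurableSet_A
  isBounded_A := S.isBounded_A
  measurable_Y i := by
    split_ifs with h
    · exact S.measurable_Y i
    · exact @measurable_const _ _ _ (𝓕 (S.a i)) (0 : ℝ)
  bounded_Y i := by
    split_ifs with h
    · exact S.bounded_Y i
    · exact ⟨0, by simp⟩

omit mΩ in
lemma SimpleProcess.toFun_truncate {𝓕 : ℝ → MeasurableSpace Ω} (S : SimpleProcess 𝓕 T)
    (t s x : ℝ) (ω : Ω) : (S.truncate t).toFun s x ω = if s ≤ t then S.toFun s x ω else 0 := by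
  simp only [SimpleProcess.toFun, SimpleProcess.truncate]
  split_ifs with hs
  · refine Finset.sum_congr rfl (fun i _ => ?_)
    split_ifs with h
    · congr 2
      simp only [indicator, Set.mem_Ioc, le_min_iff, hs, and_true]
    · rw [indicator_of_notMem (fun h' : s ∈ Ioc (S.a i) (S.b i) => h (h'.1.trans_le hs))]
      simp
  · refine Finset.sum_eq_zero (fun i _ => ?_)
    split_ifs with h
    · rw [indicator_of_notMem (fun h' : s ∈ Ioc (S.a i) (min (S.b i) t) =>
        hs (h'.2.trans (min_le_right _ _)))]
      simp
    · simp

omit mΩ in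
lemma SimpleProcess.measurable_integral_truncate
    (S : SimpleProcess (noiseFiltration L) T) (t : ℝ) :
    Measurable[noiseFiltration L t] ((S.truncate t).integral L) := by
  refine Finset.measurable_sum _ (fun i _ => ?_)
  simp only [SimpleProcess.truncate]
  split_ifs with h
  · refine Measurable.mul ((S.measurable_Y i).mono (noiseFiltration_mono h.le) le_rfl) ?_
    refine Measurable.sub ?_ ?_
    · exact measurable_noise ⟨(S.a_nonneg i).trans (lt_min (S.a_lt_b i) h).le, min_le_right _ _⟩
        (S.measurableSet_A i) (S.isBounded_A i)
    · exact measurable_noise ⟨S.a_nonneg i, h.le⟩ (S.measurableSet_A i) (S.isBounded_A i)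
  · simp only [zero_mul]
    exact @measurable_const _ _ _ (noiseFiltration L t) (0 : ℝ)

/-- Existence of the Itô integral, and its adaptedness. -/
lemma IsLevyWhiteNoise.exists_isItoIntegral (hT : 0 ≤ T) (hL : IsLevyWhiteNoise P T ν N L)
    (hν : IsSquareIntegrableLevyMeasure ν) (hN : IsPoissonRandomMeasure P (intensity T ν) N)
    {X : ℝ → ℝ → Ω → ℝ} (hX : IsPredictableField (noiseFiltration L) T X)
    (hE : energy P T X < ∞) {t : ℝ} (ht : t ≤ T) (hXt : ∀ s x ω, t < s → X s x ω = 0) :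
    ∃ F : Lp ℝ 2 P, IsItoIntegral P T L X F ∧ AEStronglyMeasurable[noiseFiltration L t] F P := by
  obtain ⟨S, hS⟩ := hL.exists_simple_tendsto hT hX hE
  -- As `X` vanishes after `t`, truncating the approximants does not increase the error, and it
  -- makes their integrals measurable at time `t`.
  have hS' : Tendsto (fun n => energy P T (X - ((S n).truncate t).toFun)) atTop (𝓝 0) := by
    refine tendsto_of_tendsto_of_tendsto_of_le_of_le tendsto_const_nhds hS (fun n => zero_le)
      (fun n => ?_)
    refine lintegral_mono fun ω => lintegral_mono fun s => lintegral_mono fun x => ?_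
    simp only [Pi.sub_apply, SimpleProcess.toFun_truncate]
    split_ifs with h
    · exact le_rfl
    · simp [hXt s x ω (not_le.1 h)]
  have hc := ((tendsto_toLp_of_energy hT hL hX hE _).1 hS').cauchySeq
  have hc' := cauchySeq_of_edist_sq_le
    (v := fun n => (hL.memLp_integral ((S n).truncate t)).toLp (((S n).truncate t).integral L))
    hc ENNReal.ofReal_ne_top (fun n m => (hL.edist_integral hν hN _ _).le)
  obtain ⟨F, hF⟩ := cauchySeq_tendsto_of_complete hc'
  have hF' : Tendsto (fun n => eLpNorm (⇑F - ((S n).truncate t).integral L) 2 P) atTop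
      (𝓝 0) := by
    rw [tendsto_iff_edist_tendsto_0] at hF
    refine hF.congr (fun n => ?_)
    rw [edist_comm, Lp.edist_def]
    exact eLpNorm_congr_ae (EventuallyEq.rfl.sub (MemLp.coeFn_toLp _))
  refine ⟨F, ⟨hX, hE, Lp.memLp F, _, hS', hF'⟩, ?_⟩
  exact aestronglyMeasurable_of_tendsto_eLpNorm (hL.noiseFiltration_le ht)
    (fun n => hL.memLp_integral ((S n).truncate t))
    (fun n => ((S n).measurable_integral_truncate t).stronglyMeasurable.aestronglyMeasurable)
    (Lp.memLp F) hF'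

end Density

/-! ### Predictable modifications -/

section Modification

variable {Ω : Type*} [mΩ : MeasurableSpace Ω] {P : Measure Ω} {T : ℝ} {𝓕 : ℝ → MeasurableSpace Ω}

/-- The value of `Z` at the grid point of mesh `1/M` to the left of `(t,x)`. -/
noncomputable def gridField (hT : 0 ≤ T) (Z : Icc (0 : ℝ) T × ℝ → Ω → ℝ) (M : ℕ) (t x : ℝ) :
    Ω → ℝ :=
  -- For `t > 0` the point `(⌈tM⌉ - 1)/M` lies strictly before `t`, which yields predictability; at
  -- `t = 0` the truncated subtraction gives `0`.
  Z (projIcc 0 T hT (((⌈t * M⌉₊ - 1 : ℕ) : ℝ) / M), (⌊x * M⌋ : ℝ) / M)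

omit mΩ in
-- On each cell `((k-1)/M, k/M] × [j/M, (j+1)/M)` the field is one random variable known at the left
-- end `(k-1)/M`, and there are countably many cells.
lemma isPredictableField_gridField (hT : 0 ≤ T) {Z : Icc (0 : ℝ) T × ℝ → Ω → ℝ}
    (hZ : ∀ p, Measurable[𝓕 p.1] (Z p)) {M : ℕ} (hM : 0 < M) :
    IsPredictableField 𝓕 T (gridField hT Z M) := by
  have hM' : (0 : ℝ) < M := by exact_mod_cast hM
  intro B hB
  set Zk : ℕ → ℤ → Ω → ℝ := fun k j =>
    Z (projIcc 0 T hT (((k - 1 : ℕ) : ℝ) / M), (j : ℝ) / M) with hZk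
  have e : (fun p : Icc (0 : ℝ) T × ℝ × Ω => gridField hT Z M p.1 p.2.1 p.2.2) ⁻¹' B =
      ⋃ k : ℕ, ⋃ j : ℤ, {p | ⌈(p.1 : ℝ) * M⌉₊ = k ∧ p.2.1 ∈ {x : ℝ | ⌊x * M⌋ = j} ∧
        p.2.2 ∈ Zk k j ⁻¹' B} := by
    ext p
    simp [gridField, hZk]
  rw [e]
  refine MeasurableSet.iUnion fun k => MeasurableSet.iUnion fun j => ?_
  have hA : MeasurableSet {x : ℝ | ⌊x * M⌋ = j} :=
    (Int.measurable_floor.comp (measurable_id.mul_const (M : ℝ))) (measurableSet_singleton j)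
  have hAb : Bornology.IsBounded {x : ℝ | ⌊x * M⌋ = j} := by
    refine (Metric.isBounded_Icc ((j : ℝ) / M) ((j + 1 : ℝ) / M)).subset (fun x hx => ?_)
    obtain ⟨h1, h2⟩ := Int.floor_eq_iff.1 hx
    exact ⟨(div_le_iff₀ hM').2 h1, (le_div_iff₀ hM').2 h2.le⟩
  rcases Nat.eq_zero_or_pos k with rfl | hk
  · have : {p : Icc (0 : ℝ) T × ℝ × Ω | ⌈(p.1 : ℝ) * M⌉₊ = 0 ∧ p.2.1 ∈ {x : ℝ | ⌊x * M⌋ = j} ∧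
        p.2.2 ∈ Zk 0 j ⁻¹' B} = {p | (p.1 : ℝ) = 0 ∧ p.2.1 ∈ {x : ℝ | ⌊x * M⌋ = j} ∧
        p.2.2 ∈ Zk 0 j ⁻¹' B} := by
      ext p
      have hp : ⌈(p.1 : ℝ) * M⌉₊ = 0 ↔ (p.1 : ℝ) = 0 := by
        rw [Nat.ceil_eq_zero]
        constructor
        · intro h
          exact le_antisymm (nonpos_of_mul_nonpos_left h hM') p.1.2.1
        · intro h
          simp [h]
      simp only [Set.mem_ofPred_eq, hp]
    rw [this]
    refine measurableSet_predictable_zero hA hAb ?_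
    have h0 : projIcc 0 T hT (((0 - 1 : ℕ) : ℝ) / M) = ⟨0, le_rfl, hT⟩ := by
      simp [projIcc]
    simp only [hZk, h0]
    exact hZ (⟨0, le_rfl, hT⟩, _) hB
  · have : {p : Icc (0 : ℝ) T × ℝ × Ω | ⌈(p.1 : ℝ) * M⌉₊ = k ∧ p.2.1 ∈ {x : ℝ | ⌊x * M⌋ = j} ∧
        p.2.2 ∈ Zk k j ⁻¹' B} = {p | (p.1 : ℝ) ∈ Ioc (((k - 1 : ℕ) : ℝ) / M) ((k : ℝ) / M) ∧
        p.2.1 ∈ {x : ℝ | ⌊x * M⌋ = j} ∧ p.2.2 ∈ Zk k j ⁻¹' B} := by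
      ext p
      have hp : ⌈(p.1 : ℝ) * M⌉₊ = k ↔
          (p.1 : ℝ) ∈ Ioc (((k - 1 : ℕ) : ℝ) / M) ((k : ℝ) / M) := by
        rw [Nat.ceil_eq_iff hk.ne', Set.mem_Ioc, div_lt_iff₀ hM', le_div_iff₀ hM']
      simp only [Set.mem_ofPred_eq, hp]
    rw [this]
    have hk0 : 0 ≤ ((k - 1 : ℕ) : ℝ) / M := by positivity
    rcases le_or_gt (((k - 1 : ℕ) : ℝ) / M) T with hkT | hkT
    · refine measurableSet_predictable_Ioc hk0 hA hAb ?_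
      have := hZ (projIcc 0 T hT (((k - 1 : ℕ) : ℝ) / M), (j : ℝ) / M)
      rw [projIcc_of_mem hT ⟨hk0, hkT⟩] at this
      simp only [hZk, projIcc_of_mem hT ⟨hk0, hkT⟩]
      exact this hB
    · convert MeasurableSet.empty
      ext p
      simp only [Set.mem_ofPred_eq, Set.mem_Ioc, mem_empty_iff_false, iff_false, not_and]
      intro h
      exact absurd (h.1.trans_le p.1.2.2) (not_lt.2 hkT.le)

lemma grid_time_dist {T : ℝ} (hT : 0 ≤ T) (t : Icc (0 : ℝ) T) {M : ℕ} (hM : 0 < M) :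
    dist (projIcc 0 T hT (((⌈(t : ℝ) * M⌉₊ - 1 : ℕ) : ℝ) / M)) t ≤ 1 / M := by
  have hM' : (0 : ℝ) < M := by exact_mod_cast hM
  rcases eq_or_lt_of_le t.2.1 with h | h
  · have : (projIcc 0 T hT (((⌈(t : ℝ) * M⌉₊ - 1 : ℕ) : ℝ) / M)) = t := by
      ext
      simp [projIcc, ← h, hT]
    rw [this, dist_self]
    positivity
  · have hk : ⌈(t : ℝ) * M⌉₊ ≠ 0 := by
      rw [Ne, Nat.ceil_eq_zero, not_le]
      positivity
    obtain ⟨h1, h2⟩ := (Nat.ceil_eq_iff hk).1 rfl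
    have h3 : (((⌈(t : ℝ) * M⌉₊ - 1 : ℕ) : ℝ) / M) < t := (div_lt_iff₀ hM').2 h1
    rw [projIcc_of_mem hT ⟨by positivity, h3.le.trans t.2.2⟩, Subtype.dist_eq, Real.dist_eq,
      abs_sub_comm, abs_of_nonneg (sub_nonneg.2 h3.le), sub_le_iff_le_add, ← add_div,
      le_div_iff₀ hM']
    refine h2.trans ?_
    rw [Nat.cast_sub (Nat.one_le_iff_ne_zero.2 hk)]
    simp

lemma grid_space_dist (x : ℝ) {M : ℕ} (hM : 0 < M) : dist ((⌊x * M⌋ : ℝ) / M) x ≤ 1 / M := by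
  have hM' : (0 : ℝ) < M := by exact_mod_cast hM
  have h1 : (⌊x * M⌋ : ℝ) / M ≤ x := (div_le_iff₀ hM').2 (Int.floor_le _)
  rw [Real.dist_eq, abs_sub_comm, abs_of_nonneg (sub_nonneg.2 h1), sub_le_iff_le_add, ← add_div,
    le_div_iff₀ hM']
  linarith [Int.lt_floor_add_one (x * M)]

/-- Uniform continuity on the compact `[0,T] × [-(n+1), n+1]`; the extra unit leaves room for the
grid point, which is within distance `1` of `x`. -/
lemma exists_mesh (hT : 0 ≤ T) {v : Icc (0 : ℝ) T × ℝ → Lp ℝ 2 P} (hv : Continuous v) (n : ℕ) :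
    ∃ M : ℕ, 0 < M ∧ ∀ (t : Icc (0 : ℝ) T) (x : ℝ), |x| ≤ n →
      dist (v (projIcc 0 T hT (((⌈(t : ℝ) * M⌉₊ - 1 : ℕ) : ℝ) / M), (⌊x * M⌋ : ℝ) / M))
        (v (t, x)) ≤ (1 / 2) ^ n := by
  have hK : IsCompact ((univ : Set (Icc (0 : ℝ) T)) ×ˢ Icc (-(n + 1) : ℝ) (n + 1)) :=
    isCompact_univ.prod isCompact_Icc
  have hu := Metric.uniformContinuousOn_iff.1
    (hK.uniformContinuousOn_of_continuous hv.continuousOn) ((1 / 2) ^ n) (by positivity)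
  obtain ⟨δ, hδ, h⟩ := hu
  obtain ⟨M, hM⟩ := exists_nat_one_div_lt hδ
  have hM1 : (1 : ℝ) / ((M + 1 : ℕ) : ℝ) ≤ 1 := by
    rw [div_le_one (by positivity)]
    exact_mod_cast Nat.succ_le_succ (Nat.zero_le M)
  refine ⟨M + 1, Nat.succ_pos M, fun t x hx => ?_⟩
  have hdt := grid_time_dist hT t (Nat.succ_pos M)
  have hdx := grid_space_dist x (Nat.succ_pos M)
  obtain ⟨hx1, hx2⟩ := abs_le.1 hx
  refine (h _ ⟨trivial, ?_⟩ _ ⟨trivial, ?_⟩ ?_).le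
  · have := abs_le.1 (hdx.trans hM1)
    constructor <;> simp only [Nat.succ_eq_add_one] at * <;> linarith [this.1, this.2]
  · constructor <;> simp only <;> linarith
  · rw [Prod.dist_eq]
    have hM2 : (1 : ℝ) / ((M + 1 : ℕ) : ℝ) < δ := by exact_mod_cast hM
    exact max_lt (hdt.trans_lt hM2) (hdx.trans_lt hM2)

/-- The squared errors have summable expectations, so their sum is almost surely finite and its
terms tend to zero. -/
lemma ae_tendsto_of_eLpNorm_le {f : ℕ → Ω → ℝ} {F : Ω → ℝ} (hf : ∀ n, AEStronglyMeasurable (f n) P)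
    (hF : AEStronglyMeasurable F P) {n₀ : ℕ}
    (h : ∀ n ≥ n₀, eLpNorm (f n - F) 2 P ≤ ENNReal.ofReal ((1 / 2) ^ n)) :
    ∀ᵐ ω ∂P, Tendsto (fun n => f n ω) atTop (𝓝 (F ω)) := by
  have hm : ∀ n, AEMeasurable (fun ω => ENNReal.ofReal ((f (n + n₀) ω - F ω) ^ 2)) P := fun n =>
    (((hf _).sub hF).aemeasurable.pow_const 2).ennreal_ofReal
  have hsum : ∫⁻ ω, ∑' n, ENNReal.ofReal ((f (n + n₀) ω - F ω) ^ 2) ∂P ≠ ∞ := by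
    rw [lintegral_tsum hm]
    have hle : ∀ n, ∫⁻ ω, ENNReal.ofReal ((f (n + n₀) ω - F ω) ^ 2) ∂P ≤
        ENNReal.ofReal ((1 / 2) ^ n) := by
      intro n
      have h1 := h (n + n₀) (Nat.le_add_left _ _)
      have h2 : ENNReal.ofReal ((1 / 2) ^ (n + n₀)) ≤ ENNReal.ofReal ((1 / 2) ^ n) :=
        ENNReal.ofReal_le_ofReal
          (pow_le_pow_of_le_one (by norm_num) (by norm_num) (Nat.le_add_right _ _))
      have h3 : ENNReal.ofReal ((1 / 2) ^ n) ≤ 1 := by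
        rw [ENNReal.ofReal_le_one]
        exact pow_le_one₀ (by norm_num) (by norm_num)
      calc _ = eLpNorm (f (n + n₀) - F) 2 P ^ 2 := (eLpNorm_two_sq _).symm
        _ ≤ ENNReal.ofReal ((1 / 2) ^ n) ^ 2 := pow_le_pow_left' (h1.trans h2) 2
        _ ≤ ENNReal.ofReal ((1 / 2) ^ n) := by
          rw [sq]
          exact mul_le_of_le_one_right' h3
    refine ne_top_of_le_ne_top ?_ (ENNReal.tsum_le_tsum hle)
    rw [← ENNReal.ofReal_tsum_of_nonneg (fun n => by positivity) summable_geometric_two]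
    exact ENNReal.ofReal_ne_top
  filter_upwards [ae_lt_top' (AEMeasurable.tsum hm) hsum] with ω hω
  have h0 := ENNReal.tendsto_atTop_zero_of_tsum_ne_top hω.ne
  have h1 : Tendsto (fun n => (f (n + n₀) ω - F ω) ^ 2) atTop (𝓝 0) := by
    have := (ENNReal.tendsto_toReal ENNReal.zero_ne_top).comp h0
    simpa [Function.comp_def, ENNReal.toReal_ofReal, sq_nonneg] using this
  have h2 : Tendsto (fun n => f (n + n₀) ω - F ω) atTop (𝓝 0) := by
    rw [tendsto_zero_iff_abs_tendsto_zero]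
    have := (Real.continuous_sqrt.tendsto 0).comp h1
    simpa [Function.comp_def, Real.sqrt_sq_eq_abs] using this
  rw [← tendsto_add_atTop_iff_nat n₀]
  simpa using h2.add_const (F ω)

/-- An adapted `L²`-continuous field has a predictable modification. -/
lemma exists_predictable_modification (hT : 0 ≤ T) (h𝓕 : ∀ a ≤ T, 𝓕 a ≤ mΩ)
    {v : Icc (0 : ℝ) T × ℝ → Lp ℝ 2 P} (hv : Continuous v)
    (hva : ∀ p, AEStronglyMeasurable[𝓕 p.1] (v p) P) :
    ∃ u : ℝ → ℝ → Ω → ℝ, IsPredictableField 𝓕 T u ∧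
      ∀ p : Icc (0 : ℝ) T × ℝ, u p.1 p.2 =ᵐ[P] v p := by
  choose M hM hMv using exists_mesh hT hv
  set Z : Icc (0 : ℝ) T × ℝ → Ω → ℝ := fun p => (hva p).mk (v p) with hZ
  have hZm : ∀ p, Measurable[𝓕 p.1] (Z p) := fun p => (hva p).stronglyMeasurable_mk.measurable
  have hZv : ∀ p, v p =ᵐ[P] Z p := fun p => (hva p).ae_eq_mk
  -- The `limsup` is predictable whether or not the sequence converges, and equals the limit almost
  -- surely at each fixed point, once `n ≥ |x|` makes the mesh bound available.
  refine ⟨fun t x ω => limsup (fun n => gridField hT Z (M n) t x ω) atTop, ?_, fun p => ?_⟩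
  · exact Measurable.limsup fun n => isPredictableField_gridField hT hZm (hM n)
  · obtain ⟨n₀, hn₀⟩ := exists_nat_ge |p.2|
    have h := ae_tendsto_of_eLpNorm_le (P := P) (f := fun n => gridField hT Z (M n) p.1 p.2)
      (F := v p) (n₀ := n₀)
      (fun n => ((hZm _).mono (h𝓕 _ (projIcc 0 T hT _).2.2) le_rfl).aestronglyMeasurable)
      (Lp.aestronglyMeasurable _) (fun n hn => ?_)
    · filter_upwards [h] with ω hω
      exact hω.limsup_eq
    · have h1 := hMv n p.1 p.2 (hn₀.trans (by exact_mod_cast hn))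
      rw [← ENNReal.ofReal_le_ofReal_iff (by positivity), ← edist_dist, Lp.edist_def] at h1
      refine le_trans (le_of_eq (eLpNorm_congr_ae ?_)) h1
      exact (hZv _).symm.sub EventuallyEq.rfl

end Modification

/-! ### Estimates on the Green function -/

section Kernel

variable {T : ℝ} {G : ℝ → ℝ → ℝ}

/-- The kernel `(s,y) ↦ 1_{s ≤ t} G(t-s,x-y)`. -/
noncomputable def mildKernel (G : ℝ → ℝ → ℝ) (t x s y : ℝ) : ℝ :=
  (Iic t).indicator (fun r => G (t - r) (x - y)) s

lemma mildIntegrand_eq {Ω : Type*} (G : ℝ → ℝ → ℝ) (σ : ℝ → ℝ) (u : ℝ → ℝ → Ω → ℝ)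
    (t x s y : ℝ) (ω : Ω) :
    mildIntegrand G σ u t x s y ω = mildKernel G t x s y * σ (u s y ω) := by
  simp only [mildIntegrand, mildKernel]
  by_cases h : s ∈ Iic t
  · rw [indicator_of_mem h, indicator_of_mem h]
  · rw [indicator_of_notMem h, indicator_of_notMem h, zero_mul]

lemma measurable_mildKernel (hG : Measurable (fun p : ℝ × ℝ => G p.1 p.2)) (t x : ℝ) :
    Measurable (fun p : ℝ × ℝ => mildKernel G t x p.1 p.2) := by
  have : (fun p : ℝ × ℝ => mildKernel G t x p.1 p.2) =
      (Prod.fst ⁻¹' Iic t).indicator (fun p : ℝ × ℝ => G (t - p.1) (x - p.2)) := by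
    ext p
    rfl
  rw [this]
  exact (hG.comp (f := fun p : ℝ × ℝ => (t - p.1, x - p.2)) (by fun_prop)).indicator
    (measurable_fst measurableSet_Iic)

/-- `∫ G(r,y)² dy`. -/
noncomputable def spaceEnergy (G : ℝ → ℝ → ℝ) (r : ℝ) : ℝ≥0∞ :=
  ∫⁻ y, ENNReal.ofReal (G r y ^ 2)

lemma measurable_spaceEnergy (hG : Measurable (fun p : ℝ × ℝ => G p.1 p.2)) :
    Measurable (spaceEnergy G) :=
  Measurable.lintegral_prod_right' (f := fun p : ℝ × ℝ => ENNReal.ofReal (G p.1 p.2 ^ 2))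
    (hG.pow_const 2).ennreal_ofReal

/-- The weighted energy `∫_0^T ∫ e^{-2βr} G(r,y)² dy dr` of the Green function. -/
noncomputable def kernelWeight (T : ℝ) (G : ℝ → ℝ → ℝ) (β : ℝ) : ℝ≥0∞ :=
  ∫⁻ r in Icc 0 T, spaceEnergy G r * ENNReal.ofReal (Real.exp (-(2 * β * r)))

/-- Integrating in `y` removes `x` by translation invariance. Then `r = t - s` gives `e^{2βs} =
e^{2βt} e^{-2βr}`, so the bound has the same exponential form in `t` as the weight in `s`. -/
lemma lintegral_mildKernel_le (hG : Measurable (fun p : ℝ × ℝ => G p.1 p.2)) (β : ℝ) {t : ℝ}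
    (ht : t ∈ Icc 0 T) (x : ℝ) :
    ∫⁻ s in Icc 0 T, ∫⁻ y, ENNReal.ofReal (mildKernel G t x s y ^ 2) *
      ENNReal.ofReal (Real.exp (2 * β * s)) ≤
    ENNReal.ofReal (Real.exp (2 * β * t)) * kernelWeight T G β := by
  set H : ℝ → ℝ≥0∞ := (Icc 0 T).indicator fun r =>
    spaceEnergy G r * ENNReal.ofReal (Real.exp (2 * β * (t - r))) with hH
  have hHm : Measurable H :=
    ((measurable_spaceEnergy hG).mul (by fun_prop)).indicator measurableSet_Icc
  calc _ ≤ ∫⁻ s in Icc 0 T, H (t - s) := by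
        refine setLIntegral_mono' measurableSet_Icc (fun s hs => ?_)
        rw [lintegral_mul_const' _ _ ENNReal.ofReal_ne_top]
        by_cases h : s ≤ t
        · have hm : t - s ∈ Icc 0 T := ⟨sub_nonneg.2 h, by linarith [hs.1, ht.2]⟩
          rw [hH, indicator_of_mem hm]
          have e : ∫⁻ y, ENNReal.ofReal (mildKernel G t x s y ^ 2) = spaceEnergy G (t - s) := by
            simp only [mildKernel, indicator_of_mem (show s ∈ Iic t from h)]
            exact lintegral_sub_left_eq_self (fun y => ENNReal.ofReal (G (t - s) y ^ 2)) x
          rw [e, sub_sub_cancel]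
        · have e : ∫⁻ y, ENNReal.ofReal (mildKernel G t x s y ^ 2) = 0 := by
            simp [mildKernel, indicator_of_notMem (show s ∉ Iic t from h)]
          rw [e, zero_mul]
          exact zero_le
    _ ≤ ∫⁻ s, H (t - s) := setLIntegral_le_lintegral _ _
    _ = ∫⁻ s, H s := lintegral_sub_left_eq_self H t
    _ = ENNReal.ofReal (Real.exp (2 * β * t)) * kernelWeight T G β := by
        rw [hH, lintegral_indicator measurableSet_Icc, kernelWeight,
          ← lintegral_const_mul' _ _ ENNReal.ofReal_ne_top]
        refine lintegral_congr (fun r => ?_)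
        rw [mul_left_comm, ← ENNReal.ofReal_mul (Real.exp_pos _).le, ← Real.exp_add]
        congr 3
        ring

lemma HypothesisH2.lintegral_spaceEnergy_lt_top (hG : HypothesisH2 T G) :
    ∫⁻ r in Icc 0 T, spaceEnergy G r < ∞ := by
  have h := hG.square_integrable.2
  have h2 : eLpNorm (fun p : ℝ × ℝ => G p.1 p.2) 2
      ((volume.restrict (Icc 0 T)).prod volume) ^ 2 < ∞ := ENNReal.pow_lt_top h
  rw [eLpNorm_two_sq, lintegral_prod _ (hG.measurable.pow_const 2).ennreal_ofReal.aemeasurable]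
    at h2
  exact h2

lemma HypothesisH2.kernelWeight_lt_top (hG : HypothesisH2 T G) {β : ℝ} (hβ : 0 ≤ β) :
    kernelWeight T G β < ∞ := by
  refine lt_of_le_of_lt (setLIntegral_mono' measurableSet_Icc fun r hr => ?_)
    hG.lintegral_spaceEnergy_lt_top
  refine mul_le_of_le_one_right' ?_
  rw [ENNReal.ofReal_le_one, Real.exp_le_one_iff]
  have := mul_nonneg hβ hr.1
  linarith

/-- The source of the contraction. Dominated convergence applies: the exponential tends to zero for
`r > 0`, and `spaceEnergy G` is integrable, hence almost everywhere finite. -/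
lemma HypothesisH2.tendsto_kernelWeight (hG : HypothesisH2 T G) :
    Tendsto (fun n : ℕ => kernelWeight T G n) atTop (𝓝 0) := by
  have hfin : ∀ᵐ r ∂(volume.restrict (Icc 0 T)), spaceEnergy G r < ∞ :=
    ae_lt_top (measurable_spaceEnergy hG.measurable) hG.lintegral_spaceEnergy_lt_top.ne
  have h0 : ∀ᵐ r ∂(volume.restrict (Icc 0 T)), r ∈ Icc 0 T := ae_restrict_mem measurableSet_Icc
  have h1 : ∀ᵐ r ∂(volume.restrict (Icc 0 T)), r ≠ 0 :=
    ae_restrict_of_ae (by simp [ae_iff])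
  have := tendsto_lintegral_of_dominated_convergence (μ := volume.restrict (Icc 0 T))
    (F := fun (n : ℕ) r => spaceEnergy G r * ENNReal.ofReal (Real.exp (-(2 * n * r))))
    (f := fun _ => 0) (spaceEnergy G)
    (fun n => (measurable_spaceEnergy hG.measurable).mul (by fun_prop)) (fun n => ?_)
    hG.lintegral_spaceEnergy_lt_top.ne ?_
  · simpa [kernelWeight] using this
  · filter_upwards [h0] with r hr
    refine mul_le_of_le_one_right' ?_
    rw [ENNReal.ofReal_le_one, Real.exp_le_one_iff]
    have := mul_nonneg (Nat.cast_nonneg (α := ℝ) n) hr.1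
    linarith
  · filter_upwards [h0, h1, hfin] with r hr hr1 hr2
    have hpos : 0 < 2 * r := by have := lt_of_le_of_ne hr.1 hr1.symm; linarith
    have hexp : Tendsto (fun n : ℕ => Real.exp (-(2 * n * r))) atTop (𝓝 0) := by
      refine Real.tendsto_exp_neg_atTop_nhds_zero.comp ?_
      have : Tendsto (fun n : ℕ => (n : ℝ) * (2 * r)) atTop atTop :=
        tendsto_natCast_atTop_atTop.atTop_mul_const hpos
      refine this.congr (fun n => by ring)
    have h2 := ENNReal.Tendsto.const_mul (a := spaceEnergy G r) (ENNReal.tendsto_ofReal hexp)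
      (Or.inr hr2.ne)
    simpa using h2

lemma HypothesisH2.exists_kernelWeight_le (hG : HypothesisH2 T G) {c : ℝ≥0∞} (hc : c ≠ ∞)
    {ε : ℝ≥0∞} (hε : 0 < ε) : ∃ β : ℝ, 0 ≤ β ∧ c * kernelWeight T G β ≤ ε := by
  have h := ENNReal.Tendsto.const_mul (a := c) hG.tendsto_kernelWeight (Or.inr hc)
  rw [mul_zero, ENNReal.tendsto_nhds_zero] at h
  obtain ⟨n, hn⟩ := (h ε hε).exists
  exact ⟨n, Nat.cast_nonneg n, hn⟩

/-- Continuity of translations in `L²(ℝ²)`. -/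
lemma tendsto_lintegral_translate {f : ℝ × ℝ → ℝ} (hf : MemLp f 2 volume) (q₀ : ℝ × ℝ) :
    Tendsto (fun q : ℝ × ℝ => ∫⁻ p, ENNReal.ofReal ((f (p - q) - f (p - q₀)) ^ 2)) (𝓝 q₀)
      (𝓝 0) := by
  have : Fact ((2 : ℝ≥0∞) ≠ ∞) := ⟨by simp⟩
  -- The additive group acts continuously on `L²` by translation of the argument.
  have hc : Continuous (fun q : ℝ × ℝ => (DomAddAct.mk (-q)) +ᵥ (hf.toLp f)) := by
    have h1 : Continuous (fun q : ℝ × ℝ => DomAddAct.mk (-q)) :=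
      DomAddAct.continuous_mk.comp continuous_neg
    exact h1.vadd continuous_const
  have ht := (tendsto_iff_edist_tendsto_0.1 (hc.tendsto q₀))
  have hq : ∀ q : ℝ × ℝ, ∀ᵐ p, ((DomAddAct.mk (-q)) +ᵥ (hf.toLp f) : Lp ℝ 2 volume) p =
      f (p - q) := by
    intro q
    have hqp : Measure.QuasiMeasurePreserving (fun p : ℝ × ℝ => p - q) volume volume :=
      (measurePreserving_sub_right volume q).quasiMeasurePreserving
    filter_upwards [DomAddAct.vadd_Lp_ae_eq (DomAddAct.mk (-q)) (hf.toLp f),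
      hqp.ae hf.coeFn_toLp] with p h1 h2
    rw [h1]
    have : (DomAddAct.mk.symm (DomAddAct.mk (-q)) +ᵥ p) = p - q := by
      simp [vadd_eq_add, sub_eq_neg_add]
    rw [this, h2]
  have h2 := ENNReal.Tendsto.pow (n := 2) ht
  rw [zero_pow two_ne_zero] at h2
  refine h2.congr (fun q => ?_)
  rw [Lp.edist_def, eLpNorm_two_sq]
  refine lintegral_congr_ae ?_
  filter_upwards [hq q, hq q₀] with p h1 h2
  simp only [Pi.sub_apply, h1, h2]

/-- Reflect `G` and extend it by zero outside `[0,T]`. For `s, t ∈ [0,T]`, the condition `t - s ∈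
[0,T]` is the same as `s ≤ t`, so the kernel at `(t,x)` is the translate of one function of `L²(ℝ²)`
by `(t,x)`. -/
lemma HypothesisH2.tendsto_mildKernel (hG : HypothesisH2 T G) {t₀ : ℝ} (ht₀ : t₀ ∈ Icc 0 T)
    (x₀ : ℝ) :
    Tendsto (fun q : ℝ × ℝ => ∫⁻ s in Icc 0 T, ∫⁻ y,
      ENNReal.ofReal ((mildKernel G q.1 q.2 s y - mildKernel G t₀ x₀ s y) ^ 2))
      (𝓝[Icc 0 T ×ˢ univ] (t₀, x₀)) (𝓝 0) := by
  set f : ℝ × ℝ → ℝ := fun p => (Icc 0 T).indicator (fun r => G r (-p.2)) (-p.1) with hf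
  have hfm : Measurable f := by
    have : f = ((fun p : ℝ × ℝ => -p.1) ⁻¹' (Icc 0 T)).indicator
        (fun p : ℝ × ℝ => G (-p.1) (-p.2)) := by
      ext p; rfl
    rw [this]
    exact (hG.measurable.comp (f := fun p : ℝ × ℝ => (-p.1, -p.2)) (by fun_prop)).indicator
      (measurable_fst.neg measurableSet_Icc)
  have hf2 : MemLp f 2 volume := by
    refine ⟨hfm.aestronglyMeasurable, ?_⟩
    have h2 : eLpNorm f 2 volume ^ 2 = ∫⁻ r in Icc 0 T, spaceEnergy G r := by
      rw [eLpNorm_two_sq, Measure.volume_eq_prod,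
        lintegral_prod _ (hfm.pow_const 2).ennreal_ofReal.aemeasurable]
      have e : ∀ s : ℝ, ∫⁻ y, ENNReal.ofReal (f (s, y) ^ 2) =
          (Icc 0 T).indicator (spaceEnergy G) (-s) := by
        intro s
        by_cases h : -s ∈ Icc 0 T
        · simp only [hf, indicator_of_mem h]
          exact lintegral_neg_eq_self (fun y => ENNReal.ofReal (G (-s) y ^ 2))
        · simp [hf, indicator_of_notMem h]
      simp_rw [e]
      rw [lintegral_neg_eq_self ((Icc 0 T).indicator (spaceEnergy G)),
        lintegral_indicator measurableSet_Icc]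
    have h3 := hG.lintegral_spaceEnergy_lt_top
    rw [← h2] at h3
    exact (ENNReal.pow_lt_top_iff.1 h3).resolve_right (by simp)
  have hk : ∀ t ∈ Icc 0 T, ∀ x, ∀ s ∈ Icc 0 T, ∀ y, mildKernel G t x s y = f ((s, y) - (t, x)) := by
    intro t ht x s hs y
    simp only [mildKernel, hf, Prod.mk_sub_mk, neg_sub]
    by_cases h : s ≤ t
    · have hm : t - s ∈ Icc 0 T := ⟨sub_nonneg.2 h, by linarith [hs.1, ht.2]⟩
      rw [indicator_of_mem (show s ∈ Iic t from h), indicator_of_mem hm]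
    · rw [indicator_of_notMem (show s ∉ Iic t from h), indicator_of_notMem]
      intro h'
      exact h (sub_nonneg.1 h'.1)
  have hlim := (tendsto_lintegral_translate hf2 (t₀, x₀)).mono_left
    (nhdsWithin_le_nhds (s := Icc 0 T ×ˢ univ))
  refine tendsto_of_tendsto_of_tendsto_of_le_of_le' tendsto_const_nhds hlim
    (Eventually.of_forall fun _ => zero_le) ?_
  filter_upwards [self_mem_nhdsWithin] with q hq
  have hm : Measurable fun p : ℝ × ℝ => ENNReal.ofReal ((f (p - q) - f (p - (t₀, x₀))) ^ 2) :=
    (((hfm.comp (measurable_id.sub_const q)).sub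
      (hfm.comp (measurable_id.sub_const (t₀, x₀)))).pow_const 2).ennreal_ofReal
  rw [Measure.volume_eq_prod, lintegral_prod _ hm.aemeasurable]
  refine le_trans (setLIntegral_mono' measurableSet_Icc fun s hs => ?_)
    (setLIntegral_le_lintegral (Icc 0 T) _)
  refine lintegral_mono fun y => ?_
  rw [hk q.1 hq.1 q.2 s hs y, hk t₀ ht₀ x₀ s hs y]

end Kernel

/-! ### The integrand of the mild formulation -/

section Integrand

variable {Ω : Type*} {𝓕 : ℝ → MeasurableSpace Ω} {T : ℝ}

/-- Makes deterministic kernels predictable. Generating rectangles are bounded in space, so the sets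
needed are countable unions over `[-n,n]`. -/
lemma measurable_predictable_coords :
    Measurable[predictableSigma 𝓕 T]
      (fun p : Icc (0 : ℝ) T × ℝ × Ω => (((p.1 : ℝ), p.2.1) : ℝ × ℝ)) := by
  have hball : ∀ n : ℕ, Bornology.IsBounded (Icc (-n : ℝ) n) := fun n => Metric.isBounded_Icc _ _
  refine Measurable.prodMk ?_ ?_
  · refine measurable_of_Ioi (mδ := predictableSigma 𝓕 T) (fun c => ?_)
    rcases lt_or_ge c 0 with hc | hc
    · convert @MeasurableSet.univ _ (predictableSigma 𝓕 T)
      ext p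
      simpa using hc.trans_le p.1.2.1
    · have : (fun p : Icc (0 : ℝ) T × ℝ × Ω => (p.1 : ℝ)) ⁻¹' Ioi c =
          ⋃ n : ℕ, {p | (p.1 : ℝ) ∈ Ioc c T ∧ p.2.1 ∈ Icc (-n : ℝ) n ∧ p.2.2 ∈ univ} := by
        ext p
        simp only [Set.mem_preimage, Set.mem_Ioi, Set.mem_iUnion, Set.mem_ofPred_eq, Set.mem_Ioc,
          Set.mem_univ, and_true, exists_and_left]
        constructor
        · intro h
          obtain ⟨n, hn⟩ := exists_nat_ge |p.2.1|
          exact ⟨⟨h, p.1.2.2⟩, n, abs_le.1 hn⟩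
        · exact fun h => h.1.1
      rw [this]
      exact MeasurableSet.iUnion fun n => measurableSet_predictable_Ioc hc measurableSet_Icc
        (hball n) MeasurableSet.univ
  · intro A hA
    have : (fun p : Icc (0 : ℝ) T × ℝ × Ω => p.2.1) ⁻¹' A =
        ⋃ n : ℕ, ({p | (p.1 : ℝ) = 0 ∧ p.2.1 ∈ A ∩ Icc (-n : ℝ) n ∧ p.2.2 ∈ univ} ∪
          {p | (p.1 : ℝ) ∈ Ioc 0 T ∧ p.2.1 ∈ A ∩ Icc (-n : ℝ) n ∧ p.2.2 ∈ univ}) := by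
      ext p
      simp only [Set.mem_preimage, Set.mem_iUnion, Set.mem_union, Set.mem_ofPred_eq, Set.mem_Ioc,
        Set.mem_univ, and_true, Set.mem_inter_iff]
      constructor
      · intro h
        obtain ⟨n, hn⟩ := exists_nat_ge |p.2.1|
        refine ⟨n, ?_⟩
        rcases eq_or_lt_of_le p.1.2.1 with h0 | h0
        · exact Or.inl ⟨h0.symm, h, abs_le.1 hn⟩
        · exact Or.inr ⟨⟨h0, p.1.2.2⟩, h, abs_le.1 hn⟩
      · rintro ⟨n, h | h⟩
        exacts [h.2.1, h.2.1]
    rw [this]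
    exact MeasurableSet.iUnion fun n => (measurableSet_predictable_zero
      (hA.inter measurableSet_Icc) ((hball n).subset inter_subset_right) MeasurableSet.univ).union
      (measurableSet_predictable_Ioc le_rfl (hA.inter measurableSet_Icc)
        ((hball n).subset inter_subset_right) MeasurableSet.univ)

lemma isPredictableField_mildIntegrand {G : ℝ → ℝ → ℝ}
    (hG : Measurable (fun p : ℝ × ℝ => G p.1 p.2)) {σ : ℝ → ℝ} (hσ : Continuous σ)
    {u : ℝ → ℝ → Ω → ℝ} (hu : IsPredictableField 𝓕 T u) (t x : ℝ) :
    IsPredictableField 𝓕 T (mildIntegrand G σ u t x) := by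
  unfold IsPredictableField
  simp_rw [mildIntegrand_eq]
  exact ((measurable_mildKernel hG t x).comp measurable_predictable_coords).mul
    (hσ.measurable.comp hu)

end Integrand

section Energy

variable {Ω : Type*} [MeasurableSpace Ω] {P : Measure Ω} [IsProbabilityMeasure P] {T : ℝ}

lemma energy_mul_le {g : ℝ → ℝ → ℝ} {Z : ℝ → ℝ → Ω → ℝ}
    (hm : Measurable (fieldFun T fun s y ω => g s y * Z s y ω)) {B : ℝ → ℝ≥0∞}
    (hB : ∀ s ∈ Icc 0 T, ∀ y, ∫⁻ ω, ENNReal.ofReal (Z s y ω ^ 2) ∂P ≤ B s) :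
    energy P T (fun s y ω => g s y * Z s y ω) ≤
      ∫⁻ s in Icc 0 T, ∫⁻ y, ENNReal.ofReal (g s y ^ 2) * B s := by
  rw [energy_eq_lintegral hm]
  refine setLIntegral_mono' measurableSet_Icc fun s hs => lintegral_mono fun y => ?_
  simp_rw [mul_pow, ENNReal.ofReal_mul (sq_nonneg (g s y))]
  rw [lintegral_const_mul' _ _ ENNReal.ofReal_ne_top]
  gcongr
  exact hB s hs y

end Energy

/-! ### Moment estimates and the stochastic convolution. -/

section Mild

variable {Ω : Type*} [mΩ : MeasurableSpace Ω] {P : Measure Ω} [IsProbabilityMeasure P] {T : ℝ}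
  {ν : Measure ℝ} {N : Ω → Measure (ℝ × ℝ × ℝ)} {L : ℝ → Set ℝ → Ω → ℝ}
  {w G : ℝ → ℝ → ℝ} {σ : ℝ → ℝ} {C : ℝ≥0}

lemma ofReal_lipschitz_sq (hσ : LipschitzWith C σ) (a b : ℝ) :
    ENNReal.ofReal ((σ a - σ b) ^ 2) ≤ (C : ℝ≥0∞) ^ 2 * ENNReal.ofReal ((a - b) ^ 2) := by
  have h := hσ.dist_le_mul a b
  rw [Real.dist_eq, Real.dist_eq] at h
  have h2 : (σ a - σ b) ^ 2 ≤ (C : ℝ) ^ 2 * (a - b) ^ 2 := by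
    rw [← sq_abs (σ a - σ b), ← sq_abs (a - b), ← mul_pow]
    exact pow_le_pow_left₀ (abs_nonneg _) h 2
  refine (ENNReal.ofReal_le_ofReal h2).trans (le_of_eq ?_)
  rw [ENNReal.ofReal_mul (by positivity), ENNReal.ofReal_pow (NNReal.coe_nonneg C), ENNReal.ofReal_coe_nnreal]

/-- A bound on the second moment of `σ(Z)` when that of `Z` is at most `K`. -/
noncomputable def sigmaBound (σ : ℝ → ℝ) (C : ℝ≥0) (K : ℝ≥0∞) : ℝ≥0∞ :=
  2 * ENNReal.ofReal (σ 0 ^ 2) + 2 * ((C : ℝ≥0∞) ^ 2 * K)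

lemma sigmaBound_ne_top {K : ℝ≥0∞} (hK : K ≠ ∞) : sigmaBound σ C K ≠ ∞ := by
  unfold sigmaBound
  finiteness

lemma lintegral_sigma_sq_le (hσ : LipschitzWith C σ) {Z : Ω → ℝ} {K : ℝ≥0∞}
    (hZ : ∫⁻ ω, ENNReal.ofReal (Z ω ^ 2) ∂P ≤ K) :
    ∫⁻ ω, ENNReal.ofReal (σ (Z ω) ^ 2) ∂P ≤ sigmaBound σ C K := by
  have h : ∀ ω, ENNReal.ofReal (σ (Z ω) ^ 2) ≤
      2 * ENNReal.ofReal (σ 0 ^ 2) + (2 * (C : ℝ≥0∞) ^ 2) * ENNReal.ofReal (Z ω ^ 2) := by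
    intro ω
    have h1 := ofReal_lipschitz_sq hσ (Z ω) 0
    rw [sub_zero] at h1
    have h2 : σ (Z ω) ^ 2 ≤ 2 * σ 0 ^ 2 + 2 * (σ (Z ω) - σ 0) ^ 2 := by
      nlinarith [sq_nonneg (σ (Z ω) - 2 * σ 0)]
    refine (ENNReal.ofReal_le_ofReal h2).trans ?_
    rw [ENNReal.ofReal_add (by positivity) (by positivity), ENNReal.ofReal_mul two_pos.le,
      ENNReal.ofReal_mul two_pos.le, ENNReal.ofReal_ofNat, mul_assoc]
    gcongr
  refine (lintegral_mono h).trans ?_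
  rw [lintegral_add_left measurable_const, lintegral_const, measure_univ, mul_one,
    lintegral_const_mul' _ _ (by finiteness), sigmaBound, mul_assoc]
  gcongr

/-- The contraction estimate. The weight `e^{2βs}` is reproduced as `e^{2βt}`, so after division by
it the gain `C² kernelWeight T G β` is uniform in `(t,x)`. -/
lemma energy_mildIntegrand_sub_le (hT : 0 ≤ T) (hL : IsLevyWhiteNoise P T ν N L)
    (hG : HypothesisH2 T G) (hσ : LipschitzWith C σ) {u₁ u₂ : ℝ → ℝ → Ω → ℝ}
    (hu₁ : IsPredictableField (noiseFiltration L) T u₁)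
    (hu₂ : IsPredictableField (noiseFiltration L) T u₂) {A : ℝ≥0∞} (hA : A ≠ ∞) {β : ℝ}
    (h : ∀ s ∈ Icc 0 T, ∀ y, ∫⁻ ω, ENNReal.ofReal ((u₁ s y ω - u₂ s y ω) ^ 2) ∂P ≤
      A * ENNReal.ofReal (Real.exp (2 * β * s))) {t : ℝ} (ht : t ∈ Icc 0 T) (x : ℝ) :
    energy P T (mildIntegrand G σ u₁ t x - mildIntegrand G σ u₂ t x) ≤
      (C : ℝ≥0∞) ^ 2 * A * (ENNReal.ofReal (Real.exp (2 * β * t)) * kernelWeight T G β) := by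
  have e : mildIntegrand G σ u₁ t x - mildIntegrand G σ u₂ t x =
      fun s y ω => mildKernel G t x s y * (σ (u₁ s y ω) - σ (u₂ s y ω)) := by
    ext s y ω
    simp only [Pi.sub_apply, mildIntegrand_eq]
    ring
  have hm := ((isPredictableField_mildIntegrand hG.measurable hσ.continuous hu₁ t
    x).measurable_fieldFun hT hL).sub ((isPredictableField_mildIntegrand hG.measurable
    hσ.continuous hu₂ t x).measurable_fieldFun hT hL)
  change Measurable (fieldFun T (mildIntegrand G σ u₁ t x - mildIntegrand G σ u₂ t x)) at hm
  rw [e] at hm ⊢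
  refine (energy_mul_le hm (Z := fun s y ω => σ (u₁ s y ω) - σ (u₂ s y ω))
    (B := fun s => (C : ℝ≥0∞) ^ 2 * A * ENNReal.ofReal (Real.exp (2 * β * s)))
    (fun s hs y => ?_)).trans ?_
  · refine (lintegral_mono fun ω => ofReal_lipschitz_sq hσ _ _).trans ?_
    rw [lintegral_const_mul' _ _ (by finiteness), mul_assoc]
    gcongr
    exact h s hs y
  · have hc : (C : ℝ≥0∞) ^ 2 * A ≠ ∞ := by finiteness
    simp_rw [mul_left_comm (ENNReal.ofReal (mildKernel G t x _ _ ^ 2))]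
    simp_rw [lintegral_const_mul' _ _ hc]
    gcongr
    exact lintegral_mildKernel_le hG.measurable β ht x

lemma energy_mildIntegrand_le (hT : 0 ≤ T) (hL : IsLevyWhiteNoise P T ν N L)
    (hG : HypothesisH2 T G) (hσ : LipschitzWith C σ) {u : ℝ → ℝ → Ω → ℝ}
    (hu : IsPredictableField (noiseFiltration L) T u) {K : ℝ≥0∞} (hK : K ≠ ∞)
    (h : ∀ s ∈ Icc 0 T, ∀ y, ∫⁻ ω, ENNReal.ofReal (u s y ω ^ 2) ∂P ≤ K) {t : ℝ}
    (ht : t ∈ Icc 0 T) (x : ℝ) :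
    energy P T (mildIntegrand G σ u t x) ≤ sigmaBound σ C K * kernelWeight T G 0 := by
  have e : mildIntegrand G σ u t x = fun s y ω => mildKernel G t x s y * σ (u s y ω) := by
    ext s y ω
    exact mildIntegrand_eq _ _ _ _ _ _ _ _
  have hm := (isPredictableField_mildIntegrand hG.measurable hσ.continuous hu t
    x).measurable_fieldFun hT hL
  rw [e] at hm ⊢
  refine (energy_mul_le hm (Z := fun s y ω => σ (u s y ω)) (B := fun _ => sigmaBound σ C K)
    (fun s hs y => lintegral_sigma_sq_le hσ (h s hs y))).trans ?_
  have h0 := lintegral_mildKernel_le hG.measurable 0 ht x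
  simp only [mul_zero, zero_mul, Real.exp_zero, ENNReal.ofReal_one, mul_one, one_mul] at h0
  simp_rw [lintegral_mul_const' _ _ (sigmaBound_ne_top (σ := σ) (C := C) hK)]
  rw [mul_comm]
  gcongr

/-- Here the field is fixed and the kernel moves: this gives the `L²`-continuity of the convolution.
-/
lemma energy_mildIntegrand_sub_le' (hT : 0 ≤ T) (hL : IsLevyWhiteNoise P T ν N L)
    (hG : HypothesisH2 T G) (hσ : LipschitzWith C σ) {u : ℝ → ℝ → Ω → ℝ}
    (hu : IsPredictableField (noiseFiltration L) T u) {K : ℝ≥0∞} (hK : K ≠ ∞)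
    (h : ∀ s ∈ Icc 0 T, ∀ y, ∫⁻ ω, ENNReal.ofReal (u s y ω ^ 2) ∂P ≤ K) (t x t₀ x₀ : ℝ) :
    energy P T (mildIntegrand G σ u t x - mildIntegrand G σ u t₀ x₀) ≤
      sigmaBound σ C K * ∫⁻ s in Icc 0 T, ∫⁻ y,
        ENNReal.ofReal ((mildKernel G t x s y - mildKernel G t₀ x₀ s y) ^ 2) := by
  have e : mildIntegrand G σ u t x - mildIntegrand G σ u t₀ x₀ =
      fun s y ω => (mildKernel G t x s y - mildKernel G t₀ x₀ s y) * σ (u s y ω) := by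
    ext s y ω
    simp only [Pi.sub_apply, mildIntegrand_eq]
    ring
  have hm := ((isPredictableField_mildIntegrand hG.measurable hσ.continuous hu t
    x).measurable_fieldFun hT hL).sub ((isPredictableField_mildIntegrand hG.measurable
    hσ.continuous hu t₀ x₀).measurable_fieldFun hT hL)
  change Measurable (fieldFun T (mildIntegrand G σ u t x - mildIntegrand G σ u t₀ x₀)) at hm
  rw [e] at hm ⊢
  refine (energy_mul_le (g := fun s y => mildKernel G t x s y - mildKernel G t₀ x₀ s y) hm
    (Z := fun s y ω => σ (u s y ω)) (B := fun _ => sigmaBound σ C K)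
    (fun s hs y => lintegral_sigma_sq_le hσ (h s hs y))).trans ?_
  simp_rw [lintegral_mul_const' _ _ (sigmaBound_ne_top (σ := σ) (C := C) hK)]
  rw [mul_comm]

omit [IsProbabilityMeasure P] in
lemma IsItoIntegral.congr {X : ℝ → ℝ → Ω → ℝ} {F F' : Ω → ℝ} (h : IsItoIntegral P T L X F)
    (hF : F =ᵐ[P] F') : IsItoIntegral P T L X F' := by
  obtain ⟨h1, h2, h3, S, hS, hI⟩ := h
  refine ⟨h1, h2, (memLp_congr_ae hF).1 h3, S, hS, hI.congr fun n => ?_⟩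
  exact eLpNorm_congr_ae (hF.sub EventuallyEq.rfl)

/-- The stochastic convolution of the Green function with `σ(U)`. -/
lemma exists_convolution (hT : 0 ≤ T) (hL : IsLevyWhiteNoise P T ν N L)
    (hν : IsSquareIntegrableLevyMeasure ν) (hN : IsPoissonRandomMeasure P (intensity T ν) N)
    (hG : HypothesisH2 T G) (hσ : LipschitzWith C σ) {U : Icc (0 : ℝ) T × ℝ → Lp ℝ 2 P}
    (hU : Continuous U) {R : ℝ} (hR : ∀ p, ‖U p‖ ≤ R)
    (hUa : ∀ p, AEStronglyMeasurable[noiseFiltration L p.1] (U p) P) :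
    ∃ (u : ℝ → ℝ → Ω → ℝ) (F : Icc (0 : ℝ) T × ℝ → Lp ℝ 2 P),
      IsPredictableField (noiseFiltration L) T u ∧
      (∀ p : Icc (0 : ℝ) T × ℝ, u p.1 p.2 =ᵐ[P] U p) ∧ Continuous F ∧
      (∃ R', ∀ p, ‖F p‖ ≤ R') ∧
      (∀ p, AEStronglyMeasurable[noiseFiltration L p.1] (F p) P) ∧
      ∀ p : Icc (0 : ℝ) T × ℝ, IsItoIntegral P T L (mildIntegrand G σ u p.1 p.2) (F p) := by
  obtain ⟨u, hu, huU⟩ := exists_predictable_modification (𝓕 := noiseFiltration L) hT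
    (fun a ha => hL.noiseFiltration_le ha) hU hUa
  set K : ℝ≥0∞ := ENNReal.ofReal R ^ 2 with hKdef
  have hK : K ≠ ∞ := by finiteness
  have hmom : ∀ s ∈ Icc 0 T, ∀ y, ∫⁻ ω, ENNReal.ofReal (u s y ω ^ 2) ∂P ≤ K := by
    intro s hs y
    rw [← eLpNorm_two_sq, eLpNorm_congr_ae (huU (⟨s, hs⟩, y)), ← Lp.enorm_def, hKdef]
    refine pow_le_pow_left' ?_ 2
    rw [← ofReal_norm]
    exact ENNReal.ofReal_le_ofReal (hR _)
  have hE : ∀ t ∈ Icc 0 T, ∀ x, energy P T (mildIntegrand G σ u t x) < ∞ := fun t ht x =>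
    (energy_mildIntegrand_le hT hL hG hσ hu hK hmom ht x).trans_lt
      (ENNReal.mul_lt_top (sigmaBound_ne_top hK).lt_top (hG.kernelWeight_lt_top le_rfl))
  choose F hF hFa using fun p : Icc (0 : ℝ) T × ℝ => hL.exists_isItoIntegral hT hν hN
    (isPredictableField_mildIntegrand hG.measurable hσ.continuous hu p.1 p.2)
    (hE p.1 p.1.2 p.2) p.1.2.2 (fun s x ω hs => by
      rw [mildIntegrand, indicator_of_notMem]
      exact not_le.2 hs)
  refine ⟨u, F, hu, huU, ?_, ?_, hFa, hF⟩
  · rw [continuous_iff_continuousAt]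
    intro p
    rw [ContinuousAt, tendsto_iff_edist_tendsto_0]
    refine tendsto_zero_of_sq ?_
    have hmap : Tendsto (fun q : Icc (0 : ℝ) T × ℝ => (((q.1 : ℝ), q.2) : ℝ × ℝ)) (𝓝 p)
        (𝓝[Icc 0 T ×ˢ univ] ((p.1 : ℝ), p.2)) := by
      refine tendsto_nhdsWithin_iff.2 ⟨?_, Eventually.of_forall fun q => ⟨q.1.2, trivial⟩⟩
      exact Continuous.tendsto (by fun_prop) p
    have hlim := ENNReal.Tendsto.const_mul
      (a := ENNReal.ofReal (levyVariance ν) * sigmaBound σ C K)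
      ((hG.tendsto_mildKernel p.1.2 p.2).comp hmap)
      (Or.inr (ENNReal.mul_ne_top ENNReal.ofReal_ne_top (sigmaBound_ne_top hK)))
    rw [mul_zero] at hlim
    refine tendsto_of_tendsto_of_tendsto_of_le_of_le tendsto_const_nhds hlim
      (fun q => zero_le) (fun q => ?_)
    simp only [Function.comp_apply]
    rw [Lp.edist_def, (hF q).isometry hT hL hν hN (hF p), mul_assoc]
    gcongr
    exact energy_mildIntegrand_sub_le' hT hL hG hσ hu hK hmom _ _ _ _
  · have hz : IsPredictableField (noiseFiltration L) T (0 : ℝ → ℝ → Ω → ℝ) :=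
      @measurable_const _ _ _ (predictableSigma (noiseFiltration L) T) (0 : ℝ)
    -- A version of the integral of the zero process: the isometry bounds differences of integrals,
    -- so comparison with it bounds the norm of `F p`.
    obtain ⟨F₀, hF₀, -⟩ := hL.exists_isItoIntegral hT hν hN hz (by simp [energy]) le_rfl
      (fun _ _ _ _ => rfl)
    set r : ℝ≥0∞ := ENNReal.ofReal (levyVariance ν) *
      (sigmaBound σ C K * kernelWeight T G 0) with hr
    have hrt : r ≠ ∞ := ENNReal.mul_ne_top ENNReal.ofReal_ne_top
      (ENNReal.mul_ne_top (sigmaBound_ne_top hK) (hG.kernelWeight_lt_top le_rfl).ne)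
    -- With `d² ≤ r`, the inequality `2d ≤ d² + 1` bounds `d` without a square root.
    have hb : ∀ p, dist (F p) F₀ ≤ r.toReal + 1 := by
      intro p
      have h1 : edist (F p) F₀ ^ 2 ≤ r := by
        rw [Lp.edist_def, (hF p).isometry hT hL hν hN hF₀, sub_zero, hr]
        refine mul_le_mul' le_rfl ?_
        exact energy_mildIntegrand_le hT hL hG hσ hu hK hmom p.1.2 p.2
      rw [edist_dist, ← ENNReal.ofReal_pow dist_nonneg] at h1
      have h2 := ENNReal.toReal_mono hrt h1
      rw [ENNReal.toReal_ofReal (by positivity)] at h2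
      nlinarith [sq_nonneg (dist (F p) F₀ - 1), dist_nonneg (x := F p) (y := F₀)]
    refine ⟨r.toReal + 1 + ‖F₀‖, fun p => ?_⟩
    calc ‖F p‖ = ‖(F p - F₀) + F₀‖ := by rw [sub_add_cancel]
      _ ≤ ‖F p - F₀‖ + ‖F₀‖ := norm_add_le _ _
      _ ≤ _ := by
        rw [← dist_eq_norm]
        gcongr
        exact hb p

/-! ### The fixed-point argument. -/

/-- The bounded continuous adapted `L²`-valued fields on `[0,T] × ℝ`. -/
def adaptedFields (P : Measure Ω) [IsProbabilityMeasure P] (T : ℝ) (L : ℝ → Set ℝ → Ω → ℝ) :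
    Set (BoundedContinuousFunction (Icc (0 : ℝ) T × ℝ) (Lp ℝ 2 P)) :=
  {V | ∀ p, AEStronglyMeasurable[noiseFiltration L p.1] (V p) P}

lemma isClosed_adaptedFields (hL : IsLevyWhiteNoise P T ν N L) :
    IsClosed (adaptedFields P T L) := by
  have : adaptedFields P T L = ⋂ p : Icc (0 : ℝ) T × ℝ,
      (fun V : BoundedContinuousFunction (Icc (0 : ℝ) T × ℝ) (Lp ℝ 2 P) => V p) ⁻¹'
        {f : Lp ℝ 2 P | AEStronglyMeasurable[noiseFiltration L p.1] f P} := by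
    ext V
    simp [adaptedFields]
  rw [this]
  exact isClosed_iInter fun p => (isClosed_aestronglyMeasurable
    (hL.noiseFiltration_le p.1.2.2)).preimage (BoundedContinuousFunction.lipschitz_eval_const _).continuous

/-- `V'` is the image of `V` under the map of the mild formulation, both weighted by `e^{-βt}`. -/
def IsMildImage (P : Measure Ω) [IsProbabilityMeasure P] (T : ℝ) (L : ℝ → Set ℝ → Ω → ℝ)
    (w G : ℝ → ℝ → ℝ) (σ : ℝ → ℝ) (β : ℝ) (V V' : Icc (0 : ℝ) T × ℝ → Lp ℝ 2 P) : Prop :=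
  ∃ (u : ℝ → ℝ → Ω → ℝ) (F : Icc (0 : ℝ) T × ℝ → Lp ℝ 2 P),
    IsPredictableField (noiseFiltration L) T u ∧
    (∀ p : Icc (0 : ℝ) T × ℝ, u p.1 p.2 =ᵐ[P] ⇑(Real.exp (β * p.1) • V p)) ∧
    (∀ p : Icc (0 : ℝ) T × ℝ, IsItoIntegral P T L (mildIntegrand G σ u p.1 p.2) (F p)) ∧
    ∀ p : Icc (0 : ℝ) T × ℝ,
      V' p = Real.exp (-(β * p.1)) • (Lp.constL 2 P ℝ (w p.1 p.2) + F p)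

/-- The weight `e^{βt}` is bounded on `[0,T]`, so `exists_convolution` applies to the unweighted
field; `β ≥ 0` makes the factor `e^{-βt}` at most `1`. Continuity and adaptedness come from those of
`w` and of the convolution. -/
lemma exists_mildImage (hT : 0 ≤ T) (hL : IsLevyWhiteNoise P T ν N L)
    (hν : IsSquareIntegrableLevyMeasure ν) (hN : IsPoissonRandomMeasure P (intensity T ν) N)
    (hw : HypothesisH1 T w) (hG : HypothesisH2 T G) (hσ : LipschitzWith C σ) {β : ℝ}
    (hβ : 0 ≤ β) (V : adaptedFields P T L) :
    ∃ V' : adaptedFields P T L, IsMildImage P T L w G σ β V.1 V'.1 := by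
  obtain ⟨V, hV⟩ := V
  obtain ⟨u, F, hu, huU, hFc, ⟨R, hFR⟩, hFa, hF⟩ := exists_convolution hT hL hν hN hG hσ
    (U := fun p => Real.exp (β * p.1) • V p) (by fun_prop) (R := Real.exp (β * T) * ‖V‖)
    (fun p => by
      rw [norm_smul, Real.norm_eq_abs, Real.abs_exp]
      gcongr
      · exact p.1.2.2
      · exact V.norm_coe_le_norm p)
    (fun p => ((hV p).const_smul (Real.exp (β * p.1))).congr (Lp.coeFn_smul _ _).symm)
  obtain ⟨K, hK⟩ := hw.bounded
  have hwc : Continuous fun p : Icc (0 : ℝ) T × ℝ => w p.1 p.2 :=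
    hw.continuous.comp_continuous (f := fun p : Icc (0 : ℝ) T × ℝ => ((p.1 : ℝ), p.2))
      (by fun_prop) (fun p => ⟨p.1.2, trivial⟩)
  have hcont : Continuous fun p : Icc (0 : ℝ) T × ℝ =>
      Real.exp (-(β * p.1)) • (Lp.constL 2 P ℝ (w p.1 p.2) + F p) := by
    have : Continuous fun p : Icc (0 : ℝ) T × ℝ => Lp.constL 2 P ℝ (w p.1 p.2) :=
      (Lp.constL 2 P ℝ).continuous.comp hwc
    fun_prop
  have hbound : ∀ p : Icc (0 : ℝ) T × ℝ,
      ‖Real.exp (-(β * p.1)) • (Lp.constL 2 P ℝ (w p.1 p.2) + F p)‖ ≤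
        ‖(Lp.constL 2 P ℝ : ℝ →L[ℝ] Lp ℝ 2 P)‖ * K + R := by
    intro p
    have h1 : Real.exp (-(β * p.1)) ≤ 1 := by
      rw [Real.exp_le_one_iff]
      have := mul_nonneg hβ p.1.2.1
      linarith
    rw [norm_smul, Real.norm_eq_abs, Real.abs_exp]
    refine (mul_le_of_le_one_left (norm_nonneg _) h1).trans ((norm_add_le _ _).trans ?_)
    refine add_le_add ?_ (hFR p)
    refine (ContinuousLinearMap.le_opNorm (Lp.constL 2 P ℝ : ℝ →L[ℝ] Lp ℝ 2 P) _).trans ?_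
    gcongr
    exact hK p.1 p.1.2 p.2
  refine ⟨⟨BoundedContinuousFunction.ofNormedAddCommGroup _ hcont _ hbound, fun p => ?_⟩,
    u, F, hu, huU, hF, fun p => rfl⟩
  have h1 : AEStronglyMeasurable[noiseFiltration L p.1] (Lp.constL 2 P ℝ (w p.1 p.2)) P :=
    (aestronglyMeasurable_const (m := noiseFiltration L p.1) (b := w p.1 p.2)).congr
      (Lp.coeFn_const _ _ _).symm
  exact (((h1.add (hFa p)).congr (Lp.coeFn_add _ _).symm).const_smul _).congr
    (Lp.coeFn_smul _ _).symm

/-- The bound holds for any choice of the predictable versions and of the integrals. After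
cancellation of the exponentials, the factor `1/4` on squared distances becomes `1/2`. -/
lemma IsMildImage.dist_le (hT : 0 ≤ T) (hL : IsLevyWhiteNoise P T ν N L)
    (hν : IsSquareIntegrableLevyMeasure ν) (hN : IsPoissonRandomMeasure P (intensity T ν) N)
    (hG : HypothesisH2 T G) (hσ : LipschitzWith C σ) {β : ℝ}
    (hβ : ENNReal.ofReal (levyVariance ν) * (C : ℝ≥0∞) ^ 2 * kernelWeight T G β ≤
      ENNReal.ofReal (1 / 4))
    {V₁ V₂ V₁' V₂' : Icc (0 : ℝ) T × ℝ → Lp ℝ 2 P} (h₁ : IsMildImage P T L w G σ β V₁ V₁')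
    (h₂ : IsMildImage P T L w G σ β V₂ V₂') {d : ℝ} (hd : 0 ≤ d)
    (h : ∀ p, dist (V₁ p) (V₂ p) ≤ d) (p : Icc (0 : ℝ) T × ℝ) :
    dist (V₁' p) (V₂' p) ≤ 1 / 2 * d := by
  obtain ⟨u₁, F₁, hu₁, hV₁, hF₁, hV₁'⟩ := h₁
  obtain ⟨u₂, F₂, hu₂, hV₂, hF₂, hV₂'⟩ := h₂
  have hdiff : ∀ s ∈ Icc 0 T, ∀ y, ∫⁻ ω, ENNReal.ofReal ((u₁ s y ω - u₂ s y ω) ^ 2) ∂P ≤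
      ENNReal.ofReal (d ^ 2) * ENNReal.ofReal (Real.exp (2 * β * s)) := by
    intro s hs y
    have e := eLpNorm_two_sq (μ := P) (u₁ s y - u₂ s y)
    simp only [Pi.sub_apply] at e
    rw [← e, eLpNorm_congr_ae ((hV₁ (⟨s, hs⟩, y)).sub (hV₂ (⟨s, hs⟩, y))), ← Lp.edist_def,
      edist_dist, dist_smul₀, Real.norm_eq_abs, Real.abs_exp,
      ← ENNReal.ofReal_pow (by positivity), ← ENNReal.ofReal_mul (by positivity)]
    refine ENNReal.ofReal_le_ofReal ?_
    rw [mul_pow, mul_comm (d ^ 2), ← Real.exp_nat_mul]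
    have e2 : ((2 : ℕ) : ℝ) * (β * s) = 2 * β * s := by push_cast; ring
    simp only [e2]
    gcongr
    exact h _
  have hE := energy_mildIntegrand_sub_le hT hL hG hσ hu₁ hu₂ ENNReal.ofReal_ne_top hdiff p.1.2 p.2
  have hF : edist (F₁ p) (F₂ p) ^ 2 ≤
      ENNReal.ofReal ((1 / 2 * d * Real.exp (β * p.1)) ^ 2) := by
    rw [Lp.edist_def, (hF₁ p).isometry hT hL hν hN (hF₂ p)]
    calc _ ≤ ENNReal.ofReal (levyVariance ν) * ((C : ℝ≥0∞) ^ 2 * ENNReal.ofReal (d ^ 2) *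
          (ENNReal.ofReal (Real.exp (2 * β * p.1)) * kernelWeight T G β)) := by gcongr
      _ = ENNReal.ofReal (levyVariance ν) * (C : ℝ≥0∞) ^ 2 * kernelWeight T G β *
          (ENNReal.ofReal (d ^ 2) * ENNReal.ofReal (Real.exp (2 * β * p.1))) := by ring
      _ ≤ ENNReal.ofReal (1 / 4) *
          (ENNReal.ofReal (d ^ 2) * ENNReal.ofReal (Real.exp (2 * β * p.1))) := by gcongr
      _ = _ := by
        rw [← ENNReal.ofReal_mul (by positivity), ← ENNReal.ofReal_mul (by positivity)]
        congr 1
        have : Real.exp (2 * β * p.1) = Real.exp (β * p.1) ^ 2 := by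
          rw [← Real.exp_nat_mul]; congr 1; push_cast; ring
        rw [this]
        ring
  rw [ENNReal.ofReal_pow (by positivity), ENNReal.pow_le_pow_left_iff two_ne_zero, edist_dist,
    ENNReal.ofReal_le_ofReal_iff (by positivity)] at hF
  rw [hV₁' p, hV₂' p, dist_smul₀, dist_add_left, Real.norm_eq_abs, Real.abs_exp]
  calc _ ≤ Real.exp (-(β * p.1)) * (1 / 2 * d * Real.exp (β * p.1)) := by gcongr
    _ = 1 / 2 * d * (Real.exp (-(β * p.1)) * Real.exp (β * p.1)) := by ring
    _ = 1 / 2 * d := by rw [← Real.exp_add]; simp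

/-- Two solutions with bounded second moments coincide. -/
lemma IsMildSolution.unique (hT : 0 ≤ T) (hL : IsLevyWhiteNoise P T ν N L)
    (hν : IsSquareIntegrableLevyMeasure ν) (hN : IsPoissonRandomMeasure P (intensity T ν) N)
    (hG : HypothesisH2 T G) (hσ : LipschitzWith C σ) {u₁ u₂ : ℝ → ℝ → Ω → ℝ}
    (h₁ : IsMildSolution P T L w G σ u₁) (h₂ : IsMildSolution P T L w G σ u₂)
    (hs₁ : supSecondMoment P T u₁ < ∞) (hs₂ : supSecondMoment P T u₂ < ∞) {t : ℝ}
    (ht : t ∈ Icc 0 T) (x : ℝ) : u₁ t x =ᵐ[P] u₂ t x := by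
  obtain ⟨β, hβ0, hβ⟩ := hG.exists_kernelWeight_le
    (c := ENNReal.ofReal (levyVariance ν) * (C : ℝ≥0∞) ^ 2) (by finiteness)
    (ε := ENNReal.ofReal (1 / 4)) (by simp)
  set D : ℝ → ℝ → ℝ≥0∞ := fun s y => ∫⁻ ω, ENNReal.ofReal ((u₁ s y ω - u₂ s y ω) ^ 2) ∂P with hD
  -- The squared weighted distance of the two solutions. Its finiteness, from the bounded second
  -- moments, is what allows `A = 0` to be deduced from `A ≤ A/4`.
  set A : ℝ≥0∞ := ⨆ s ∈ Icc 0 T, ⨆ y, D s y * ENNReal.ofReal (Real.exp (-(2 * β * s))) with hA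
  have hDle : ∀ s ∈ Icc 0 T, ∀ y,
      D s y ≤ 2 * supSecondMoment P T u₁ + 2 * supSecondMoment P T u₂ := by
    intro s hs y
    have b : ∀ {u : ℝ → ℝ → Ω → ℝ}, ∫⁻ ω, ENNReal.ofReal (u s y ω ^ 2) ∂P ≤
        supSecondMoment P T u := fun {u} =>
      le_iSup₂_of_le (f := fun t (_ : t ∈ Icc 0 T) => ⨆ x : ℝ, ∫⁻ ω, ENNReal.ofReal (u t x ω ^ 2) ∂P)
        s hs (le_iSup (fun x : ℝ => ∫⁻ ω, ENNReal.ofReal (u s x ω ^ 2) ∂P) y)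
    have hm : AEMeasurable (fun ω => 2 * ENNReal.ofReal (u₁ s y ω ^ 2)) P := by
      have h1 := (h₁.equation s hs y).2.2.1.1.aemeasurable
      -- The equation places `u₁ - w` in `L²(Ω)`; adding back the deterministic `w` gives
      -- measurability.
      have h2 : AEMeasurable (u₁ s y) P := by
        simpa using h1.add_const (w s y)
      exact (h2.pow_const 2).ennreal_ofReal.const_mul 2
    calc D s y ≤ ∫⁻ ω, 2 * ENNReal.ofReal (u₁ s y ω ^ 2) + 2 * ENNReal.ofReal (u₂ s y ω ^ 2) ∂P := by
          refine lintegral_mono fun ω => ?_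
          have h2 : (u₁ s y ω - u₂ s y ω) ^ 2 ≤ 2 * u₁ s y ω ^ 2 + 2 * u₂ s y ω ^ 2 := by
            nlinarith [sq_nonneg (u₁ s y ω + u₂ s y ω)]
          refine (ENNReal.ofReal_le_ofReal h2).trans (le_of_eq ?_)
          rw [ENNReal.ofReal_add (by positivity) (by positivity), ENNReal.ofReal_mul two_pos.le,
            ENNReal.ofReal_mul two_pos.le, ENNReal.ofReal_ofNat]
      _ ≤ _ := by
          rw [lintegral_add_left' hm, lintegral_const_mul' _ _ (by simp),
            lintegral_const_mul' _ _ (by simp)]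
          gcongr
          exacts [b, b]
  have hAtop : A ≠ ∞ := by
    refine ne_top_of_le_ne_top (b := 2 * supSecondMoment P T u₁ + 2 * supSecondMoment P T u₂)
      (by finiteness) ?_
    refine iSup₂_le fun s hs => iSup_le fun y => ?_
    refine (mul_le_of_le_one_right' ?_).trans (hDle s hs y)
    rw [ENNReal.ofReal_le_one, Real.exp_le_one_iff]
    have := mul_nonneg hβ0 hs.1
    linarith
  have hDA : ∀ s ∈ Icc 0 T, ∀ y, D s y ≤ A * ENNReal.ofReal (Real.exp (2 * β * s)) := by
    intro s hs y
    have h1 : D s y * ENNReal.ofReal (Real.exp (-(2 * β * s))) ≤ A :=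
      le_iSup₂_of_le (f := fun s (_ : s ∈ Icc 0 T) => ⨆ y, D s y *
        ENNReal.ofReal (Real.exp (-(2 * β * s)))) s hs
        (le_iSup (fun y => D s y * ENNReal.ofReal (Real.exp (-(2 * β * s)))) y)
    calc D s y = D s y * ENNReal.ofReal (Real.exp (-(2 * β * s))) *
          ENNReal.ofReal (Real.exp (2 * β * s)) := by
          rw [mul_assoc, ← ENNReal.ofReal_mul (by positivity), ← Real.exp_add]
          simp
      _ ≤ _ := by gcongr
  have hstep : ∀ s ∈ Icc 0 T, ∀ y,
      D s y ≤ ENNReal.ofReal (1 / 4) * A * ENNReal.ofReal (Real.exp (2 * β * s)) := by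
    intro s hs y
    have h3 := (h₁.equation s hs y).isometry hT hL hν hN (h₂.equation s hs y)
    rw [eLpNorm_two_sq] at h3
    simp only [Pi.sub_apply, sub_sub_sub_cancel_right] at h3
    have hE := energy_mildIntegrand_sub_le hT hL hG hσ h₁.predictable h₂.predictable hAtop hDA hs y
    calc D s y ≤ ENNReal.ofReal (levyVariance ν) * ((C : ℝ≥0∞) ^ 2 * A *
          (ENNReal.ofReal (Real.exp (2 * β * s)) * kernelWeight T G β)) := by
          rw [hD]
          simp only
          rw [h3]
          gcongr
      _ = ENNReal.ofReal (levyVariance ν) * (C : ℝ≥0∞) ^ 2 * kernelWeight T G β *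
          (A * ENNReal.ofReal (Real.exp (2 * β * s))) := by ring
      _ ≤ _ := by
          rw [mul_assoc (ENNReal.ofReal (1 / 4))]
          gcongr
  have hA4 : A ≤ ENNReal.ofReal (1 / 4) * A := by
    refine iSup₂_le fun s hs => iSup_le fun y => ?_
    calc D s y * ENNReal.ofReal (Real.exp (-(2 * β * s)))
        ≤ ENNReal.ofReal (1 / 4) * A * ENNReal.ofReal (Real.exp (2 * β * s)) *
          ENNReal.ofReal (Real.exp (-(2 * β * s))) := by
          gcongr
          exact hstep s hs y
      _ = _ := by
          rw [mul_assoc, ← ENNReal.ofReal_mul (by positivity), ← Real.exp_add]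
          simp
  have hA0 : A = 0 := by
    have h1 := ENNReal.toReal_mono (by finiteness) hA4
    rw [ENNReal.toReal_mul, ENNReal.toReal_ofReal (by norm_num)] at h1
    have h2 : A.toReal = 0 := le_antisymm (by linarith) ENNReal.toReal_nonneg
    exact ((ENNReal.toReal_eq_zero_iff _).1 h2).resolve_right hAtop
  have hD0 : D t x = 0 := by
    have := hDA t ht x
    rw [hA0, zero_mul] at this
    exact le_antisymm this zero_le
  have hn : eLpNorm (u₁ t x - u₂ t x) 2 P = 0 := by
    have h1 := eLpNorm_two_sq (μ := P) (u₁ t x - u₂ t x)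
    rw [show ∫⁻ ω, ENNReal.ofReal ((u₁ t x - u₂ t x) ω ^ 2) ∂P = 0 from hD0] at h1
    exact pow_eq_zero_iff two_ne_zero |>.1 h1
  have hm : AEStronglyMeasurable (u₁ t x - u₂ t x) P := by
    have := (h₁.equation t ht x).2.2.1.1.sub (h₂.equation t ht x).2.2.1.1
    refine this.congr (ae_of_all _ fun ω => ?_)
    simp
  filter_upwards [(eLpNorm_eq_zero_iff hm two_ne_zero).1 hn] with ω hω
  exact sub_eq_zero.1 hω

/-- Existence of a solution. -/
lemma exists_mildSolution (hT : 0 ≤ T) (hL : IsLevyWhiteNoise P T ν N L)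
    (hν : IsSquareIntegrableLevyMeasure ν) (hN : IsPoissonRandomMeasure P (intensity T ν) N)
    (hw : HypothesisH1 T w) (hG : HypothesisH2 T G) (hσ : LipschitzWith C σ) :
    ∃ u : ℝ → ℝ → Ω → ℝ, IsMildSolution P T L w G σ u ∧ IsL2Continuous P T u ∧
      supSecondMoment P T u < ∞ := by
  obtain ⟨β, hβ0, hβ⟩ := hG.exists_kernelWeight_le
    (c := ENNReal.ofReal (levyVariance ν) * (C : ℝ≥0∞) ^ 2) (by finiteness)
    (ε := ENNReal.ofReal (1 / 4)) (by simp)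
  -- One image is selected for each field; `IsMildImage.dist_le` makes the selected map a
  -- contraction.
  choose Φ hΦ using exists_mildImage (P := P) hT hL hν hN hw hG hσ hβ0
  have hcompl : CompleteSpace (adaptedFields P T L) :=
    (isClosed_adaptedFields hL).completeSpace_coe
  have hne : Nonempty (adaptedFields P T L) := by
    refine ⟨0, fun p => ?_⟩
    exact (aestronglyMeasurable_const (m := noiseFiltration L p.1) (b := (0 : ℝ))).congr
      (Lp.coeFn_zero _ _ _).symm
  have hcontr : ContractingWith (1 / 2) Φ := by
    refine ⟨by
      rw [← NNReal.coe_lt_coe]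
      norm_num, LipschitzWith.of_dist_le_mul fun V₁ V₂ => ?_⟩
    rw [Subtype.dist_eq]
    refine (BoundedContinuousFunction.dist_le (by positivity)).2 fun p => ?_
    have := (hΦ V₁).dist_le hT hL hν hN hG hσ hβ (hΦ V₂) (d := dist V₁ V₂) dist_nonneg
      (fun p => BoundedContinuousFunction.dist_coe_le_dist p) p
    simpa using this
  set V := hcontr.fixedPoint with hV
  have hfix : Φ V = V := hcontr.fixedPoint_isFixedPt
  obtain ⟨u, F, hu, huV, hF, hVF⟩ := hΦ V
  rw [hfix] at hVF
  -- Removing the weight from the fixed point gives the solution as an element of `L²(Ω)` at each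
  -- point.
  set U : Icc (0 : ℝ) T × ℝ → Lp ℝ 2 P := fun p => Real.exp (β * p.1) • V.1 p with hU
  have hUc : Continuous U := by
    have : Continuous fun p => V.1 p := V.1.continuous
    fun_prop
  have hUF : ∀ p, U p = Lp.constL 2 P ℝ (w p.1 p.2) + F p := by
    intro p
    rw [hU]
    simp only
    rw [hVF p, smul_smul, ← Real.exp_add]
    simp
  refine ⟨u, ⟨hu, fun t ht x => ?_⟩, ⟨fun t ht x => ?_, fun t ht x => ?_⟩, ?_⟩
  · refine (hF (⟨t, ht⟩, x)).congr ?_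
    have h1 := huV (⟨t, ht⟩, x)
    change u t x =ᵐ[P] U (⟨t, ht⟩, x) at h1
    rw [hUF] at h1
    filter_upwards [h1, Lp.coeFn_add (Lp.constL 2 P ℝ (w t x)) (F (⟨t, ht⟩, x)),
      Lp.coeFn_const 2 P (w t x)] with ω h2 h3 h4
    rw [h2, h3, Pi.add_apply]
    change _ = (Lp.const 2 P (w t x) : Lp ℝ 2 P) ω + _ - _
    rw [h4]
    simp
  · exact (memLp_congr_ae (huV (⟨t, ht⟩, x))).2 (Lp.memLp _)
  -- Projecting time onto `[0,T]` extends `U` continuously to the plane; near points of the strip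
  -- the extension agrees with `U`.
  · have hc : Continuous fun q : ℝ × ℝ => U (projIcc 0 T hT q.1, q.2) :=
      hUc.comp ((continuous_projIcc.comp continuous_fst).prodMk continuous_snd)
    have hlim := tendsto_iff_edist_tendsto_0.1 (hc.tendsto (t, x))
    refine (hlim.mono_left nhdsWithin_le_nhds).congr' ?_
    filter_upwards [self_mem_nhdsWithin] with q hq
    rw [projIcc_of_mem hT ht, projIcc_of_mem hT hq.1, Lp.edist_def]
    exact (eLpNorm_congr_ae ((huV (⟨q.1, hq.1⟩, q.2)).sub (huV (⟨t, ht⟩, x)))).symm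
  · have hb : supSecondMoment P T u ≤ ENNReal.ofReal (Real.exp (β * T) * ‖V.1‖) ^ 2 := by
      refine iSup₂_le fun t ht => iSup_le fun x => ?_
      rw [← eLpNorm_two_sq, eLpNorm_congr_ae (huV (⟨t, ht⟩, x)), ← Lp.enorm_def]
      refine pow_le_pow_left' ?_ 2
      rw [← ofReal_norm, norm_smul, Real.norm_eq_abs, Real.abs_exp]
      refine ENNReal.ofReal_le_ofReal ?_
      gcongr
      · exact ht.2
      · exact V.1.norm_coe_le_norm _
    exact hb.trans_lt (by finiteness)

end Mild

end LevySPDE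

theorem mainTheorem2 {Ω : Type*} [MeasurableSpace Ω] (P : Measure Ω) [IsProbabilityMeasure P]
    (T : ℝ) (hT : 0 < T)
    (ν : Measure ℝ) (hν : LevySPDE.IsSquareIntegrableLevyMeasure ν)
    (N : Ω → Measure (ℝ × ℝ × ℝ))
    (hN : LevySPDE.IsPoissonRandomMeasure P (LevySPDE.intensity T ν) N)
    (L : ℝ → Set ℝ → Ω → ℝ) (hL : LevySPDE.IsLevyWhiteNoise P T ν N L)
    (w G : ℝ → ℝ → ℝ) (hw : LevySPDE.HypothesisH1 T w) (hG : LevySPDE.HypothesisH2 T G)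
    (σ : ℝ → ℝ) (C : ℝ≥0) (hσ : LipschitzWith C σ) :
    ∃ u : ℝ → ℝ → Ω → ℝ,
      LevySPDE.IsMildSolution P T L w G σ u ∧
      LevySPDE.IsL2Continuous P T u ∧
      LevySPDE.supSecondMoment P T u < ∞ ∧
      ∀ u' : ℝ → ℝ → Ω → ℝ,
        LevySPDE.IsMildSolution P T L w G σ u' →
        LevySPDE.supSecondMoment P T u' < ∞ →
        ∀ t ∈ Icc 0 T, ∀ x : ℝ, u' t x =ᵐ[P] u t x := by
  obtain ⟨u, hu, hc, hs⟩ := LevySPDE.exists_mildSolution hT.le hL hν hN hw hG hσ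
  exact ⟨u, hu, hc, hs, fun u' hu' hs' t ht x =>
    hu'.unique hT.le hL hν hN hG hσ hu hs' hs ht x⟩
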